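/- Let $k$ be an algebraically closed field of characteristic zero (for instance $k=\mathbb C$). Let $A$ and $B$ be cosemisimple Hopf algebras over $k$ (every right comodule is completely reducible) that are non-trivial, i.e. $A\neq k$ and $B\neq k$, and let $A*B$ be their free product: the free product of the algebras $A$ and $B$, with the Hopf algebra structure extending those of $A$ and $B$. For a Hopf algebra $H$ over $k$, let $\mathcal{YD}_H^H$ be the abelian category of right-right Yetter--Drinfeld modules over $H$: right $H$-modules and right $H$-comodules $V$ such that $(v\cdot a)_{(0)}\otimes (v\cdot a)_{(1)} = v_{(0)}\cdot a_{(2)}\otimes S(a_{(1)})v_{(1)}a_{(3)}$ for all $v\in V$, $a\in H$, with the $H$-linear $H$-colinear maps as morphisms. For $V\in\mathcal{YD}_H^H$ put $H^n_{\rm GS}(H,V)=\mathrm{Ext}^n_{\mathcal{YD}_H^H}(k,V)$, where $k$ is the trivial Yetter--Drinfeld module, and let $$\mathrm{cd}_{\rm GS}(H)=\sup\{n : H^n_{\rm GS}(H,V)\neq 0 \text{ for some } V\in\mathcal{YD}_H^H\}\in\mathbb N\cup\{\infty\}.$$ Then $$\mathrm{cd}_{\rm GS}(A*B)=\begin{cases}1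 & \text{if } \mathrm{cd}_{\rm GS}(A)=0=\mathrm{cd}_{\rm GS}(B),\\ \max(\mathrm{cd}_{\rm GS}(A),\mathrm{cd}_{\rm GS}(B)) & \text{if } \max(\mathrm{cd}_{\rm GS}(A),\mathrm{cd}_{\rm GS}(B))\geq 1.\end{cases}$$ -/

import Mathlib

universe u

noncomputable section

open TensorProduct CategoryTheory

/-! ## The Hopf algebra structure on a free product -/

namespace LinearAlgebra.FreeProduct

universe v w

section Ext

variable {I : Type u} [DecidableEq I] {k : Type v} [CommSemiring k]
  {H : I → Type w} [∀ i, Semiring (H i)] [∀ i, Algebra k (H i)]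

theorem algHom_ext' {B : Type*} [Semiring B] [Algebra k B]
    {f g : LinearAlgebra.FreeProduct k H →ₐ[k] B}
    (h : ∀ i, f.comp (ι k H i) = g.comp (ι k H i)) : f = g := by
  rw [lift_unique k H (fun {i} => g.comp (ι k H i)) f h]
  exact (lift_unique k H (fun {i} => g.comp (ι k H i)) g fun _ => rfl).symm

theorem lift_ι_apply {B : Type*} [Semiring B] [Algebra k B] (f : ∀ i, H i →ₐ[k] B) (i : I)
    (a : H i) : lift k H (fun {i} => f i) (ι k H i a) = f i a :=
  DFunLike.congr_fun (lift_comp_ι k H (fun {i} => f i)) a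

/-- A subalgebra that contains all factors is everything. -/
theorem mem_of_factors (S : Subalgebra k (LinearAlgebra.FreeProduct k H))
    (hS : ∀ i a, ι k H i a ∈ S) (x : LinearAlgebra.FreeProduct k H) : x ∈ S := by
  let f : LinearAlgebra.FreeProduct k H →ₐ[k] S :=
    lift k H (fun {i} => (ι k H i).codRestrict S (hS i))
  have hf : S.val.comp f = AlgHom.id k _ := by
    apply algHom_ext'
    intro i
    ext a
    simp only [AlgHom.comp_apply, f, lift_ι_apply (fun i => (ι k H i).codRestrict S (hS i))]
    rfl
  have := DFunLike.congr_fun hf x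
  simp only [AlgHom.comp_apply, AlgHom.id_apply] at this
  rw [← this]
  exact (f x).2

end Ext

section Hopf

variable {I : Type u} [DecidableEq I] (k : Type v) [CommRing k]
  (H : I → Type w) [∀ i, Ring (H i)] [∀ i, HopfAlgebra k (H i)]

/-- The comultiplication of a free product: the algebra map extending those of the factors. -/
def comulHom : LinearAlgebra.FreeProduct k H →ₐ[k]
    LinearAlgebra.FreeProduct k H ⊗[k] LinearAlgebra.FreeProduct k H :=
  lift k H (fun {i} =>
    (Algebra.TensorProduct.map (ι k H i) (ι k H i)).comp (Bialgebra.comulAlgHom k (H i)))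

/-- The counit of a free product: the algebra map extending those of the factors. -/
def counitHom : LinearAlgebra.FreeProduct k H →ₐ[k] k :=
  lift k H (fun {i} => Bialgebra.counitAlgHom k (H i))

/-- The antipode of a free product: the algebra anti-morphism extending those of the factors. -/
def antipodeHom : LinearAlgebra.FreeProduct k H →ₐ[k] (LinearAlgebra.FreeProduct k H)ᵐᵒᵖ :=
  lift k H (fun {i} => (AlgHom.op (ι k H i)).comp (HopfAlgebra.antipodeAlgHomOp k (H i)))

theorem comulHom_ι (i : I) (a : H i) : comulHom k H (ι k H i a) =
    Algebra.TensorProduct.map (ι k H i) (ι k H i) (Coalgebra.comul (R := k) a) :=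
  lift_ι_apply (fun i => (Algebra.TensorProduct.map (ι k H i) (ι k H i)).comp
    (Bialgebra.comulAlgHom k (H i))) i a

theorem counitHom_ι (i : I) (a : H i) :
    counitHom k H (ι k H i a) = Coalgebra.counit (R := k) a :=
  lift_ι_apply (fun i => Bialgebra.counitAlgHom k (H i)) i a

theorem antipodeHom_ι (i : I) (a : H i) :
    antipodeHom k H (ι k H i a) = MulOpposite.op (ι k H i (HopfAlgebra.antipode k a)) :=
  lift_ι_apply (fun i => (AlgHom.op (ι k H i)).comp (HopfAlgebra.antipodeAlgHomOp k (H i))) i a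

instance instBialgebra : Bialgebra k (LinearAlgebra.FreeProduct k H) :=
  Bialgebra.ofAlgHom (comulHom k H) (counitHom k H)
    (by
      apply algHom_ext'
      intro i
      ext a
      have h1 : ∀ t : H i ⊗[k] H i,
          Algebra.TensorProduct.assoc k k k _ _ _
            (Algebra.TensorProduct.map (comulHom k H) (.id k _)
              (Algebra.TensorProduct.map (ι k H i) (ι k H i) t)) =
          Algebra.TensorProduct.map (ι k H i)
            (Algebra.TensorProduct.map (ι k H i) (ι k H i))
            (TensorProduct.assoc k _ _ _ (Coalgebra.comul.rTensor (H i) t)) := by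
        intro t
        induction t with
        | zero => simp
        | add x y hx hy => simp only [map_add, hx, hy]
        | tmul x y =>
          simp only [Algebra.TensorProduct.map_tmul, comulHom_ι, LinearMap.rTensor_tmul,
            AlgHom.id_apply]
          generalize (Coalgebra.comul (R := k) x) = u
          induction u with
          | zero => simp
          | add x y hx hy => simp only [map_add, TensorProduct.add_tmul, hx, hy]
          | tmul x y => simp
      have h2 : ∀ t : H i ⊗[k] H i,
          Algebra.TensorProduct.map (.id k _) (comulHom k H)
            (Algebra.TensorProduct.map (ι k H i) (ι k H i) t) =
          Algebra.TensorProduct.map (ι k H i)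
            (Algebra.TensorProduct.map (ι k H i) (ι k H i))
            (Coalgebra.comul.lTensor (H i) t) := by
        intro t
        induction t with
        | zero => simp
        | add x y hx hy => simp only [map_add, hx, hy]
        | tmul x y => simp [comulHom_ι]
      have h3 := h1 (Coalgebra.comul (R := k) a)
      rw [Coalgebra.coassoc_apply, ← h2, ← comulHom_ι] at h3
      exact h3)
    (by
      apply algHom_ext'
      intro i
      ext a
      have h1 : ∀ t : H i ⊗[k] H i,
          Algebra.TensorProduct.map (counitHom k H) (.id k _)
            (Algebra.TensorProduct.map (ι k H i) (ι k H i) t) =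
          (ι k H i).toLinearMap.lTensor k (Coalgebra.counit.rTensor (H i) t) := by
        intro t
        induction t with
        | zero => simp
        | add x y hx hy => simp only [map_add, hx, hy]
        | tmul x y => simp [counitHom_ι]
      have h3 := h1 (Coalgebra.comul (R := k) a)
      rw [Coalgebra.rTensor_counit_comul, ← comulHom_ι] at h3
      exact h3)
    (by
      apply algHom_ext'
      intro i
      ext a
      have h1 : ∀ t : H i ⊗[k] H i,
          Algebra.TensorProduct.map (.id k _) (counitHom k H)
            (Algebra.TensorProduct.map (ι k H i) (ι k H i) t) =
          (ι k H i).toLinearMap.rTensor k (Coalgebra.counit.lTensor (H i) t) := by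
        intro t
        induction t with
        | zero => simp
        | add x y hx hy => simp only [map_add, hx, hy]
        | tmul x y => simp [counitHom_ι]
      have h3 := h1 (Coalgebra.comul (R := k) a)
      rw [Coalgebra.lTensor_counit_comul, ← comulHom_ι] at h3
      exact h3)

theorem comul_eq (x : LinearAlgebra.FreeProduct k H) :
    Coalgebra.comul (R := k) x = comulHom k H x := rfl

theorem counit_eq (x : LinearAlgebra.FreeProduct k H) :
    Coalgebra.counit (R := k) x = counitHom k H x := rfl

/-- The antipode as a linear endomorphism. -/
def antipodeLin : LinearAlgebra.FreeProduct k H →ₗ[k] LinearAlgebra.FreeProduct k H :=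
  (MulOpposite.opLinearEquiv k).symm.toLinearMap ∘ₗ (antipodeHom k H).toLinearMap

theorem antipodeLin_mul (x y : LinearAlgebra.FreeProduct k H) :
    antipodeLin k H (x * y) = antipodeLin k H y * antipodeLin k H x := by
  simp [antipodeLin]

theorem antipodeLin_one : antipodeLin k H 1 = 1 := by
  simp [antipodeLin]

theorem antipodeLin_ι (i : I) (a : H i) :
    antipodeLin k H (ι k H i a) = ι k H i (HopfAlgebra.antipode k a) := by
  simp [antipodeLin, antipodeHom_ι]

theorem antipode_left (x : LinearAlgebra.FreeProduct k H) :
    LinearMap.mul' k _ ((antipodeLin k H).rTensor _ (comulHom k H x)) =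
      algebraMap k _ (counitHom k H x) := by
  let m : LinearAlgebra.FreeProduct k H ⊗[k] LinearAlgebra.FreeProduct k H →ₗ[k]
      LinearAlgebra.FreeProduct k H := LinearMap.mul' k _ ∘ₗ (antipodeLin k H).rTensor _
  have hm : ∀ s x y, m (s * (x ⊗ₜ y)) = antipodeLin k H x * m s * y := by
    intro s x y
    induction s with
    | zero => simp
    | add s t hs ht => simp only [map_add, add_mul, mul_add, hs, ht]
    | tmul s t => simp [m, antipodeLin_mul, mul_assoc]
  have hm' : ∀ s t c, m s = algebraMap k _ c → m (s * t) = algebraMap k _ c * m t := by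
    intro s t c hs
    induction t with
    | zero => simp
    | add x y hx hy => simp only [map_add, mul_add, hx, hy]
    | tmul x y => rw [hm, hs, ← Algebra.commutes]; simp [m, mul_assoc]
  let S : Subalgebra k (LinearAlgebra.FreeProduct k H) :=
    { carrier := {x | m (comulHom k H x) = algebraMap k _ (counitHom k H x)}
      mul_mem' := by
        intro x y hx hy
        change m (comulHom k H _) = algebraMap k _ (counitHom k H _) at hx hy ⊢
        rw [map_mul, hm' _ _ _ hx, hy, map_mul, map_mul]
      add_mem' := by
        intro x y hx hy
        change m (comulHom k H _) = algebraMap k _ (counitHom k H _) at hx hy ⊢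
        simp only [map_add, hx, hy]
      algebraMap_mem' := by
        intro c
        simp [m, Algebra.TensorProduct.one_def, antipodeLin_one,
          Algebra.algebraMap_eq_smul_one] }
  refine mem_of_factors S ?_ x
  intro i a
  change m (comulHom k H (ι k H i a)) = algebraMap k _ (counitHom k H (ι k H i a))
  rw [comulHom_ι, counitHom_ι]
  have h1 : ∀ t : H i ⊗[k] H i, m (Algebra.TensorProduct.map (ι k H i) (ι k H i) t) =
      ι k H i (LinearMap.mul' k _ ((HopfAlgebra.antipode k).rTensor _ t)) := by
    intro t
    induction t with
    | zero => simp
    | add x y hx hy => simp only [map_add, hx, hy]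
    | tmul x y => simp [m, antipodeLin_ι]
  rw [h1, HopfAlgebra.mul_antipode_rTensor_comul_apply, AlgHom.commutes]

theorem antipode_right (x : LinearAlgebra.FreeProduct k H) :
    LinearMap.mul' k _ ((antipodeLin k H).lTensor _ (comulHom k H x)) =
      algebraMap k _ (counitHom k H x) := by
  let m : LinearAlgebra.FreeProduct k H ⊗[k] LinearAlgebra.FreeProduct k H →ₗ[k]
      LinearAlgebra.FreeProduct k H := LinearMap.mul' k _ ∘ₗ (antipodeLin k H).lTensor _
  have hm : ∀ s x y, m ((x ⊗ₜ y) * s) = x * m s * antipodeLin k H y := by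
    intro s x y
    induction s with
    | zero => simp
    | add s t hs ht => simp only [map_add, add_mul, mul_add, hs, ht]
    | tmul s t => simp [m, antipodeLin_mul, mul_assoc]
  have hm' : ∀ s t c, m t = algebraMap k _ c → m (s * t) = m s * algebraMap k _ c := by
    intro s t c hs
    induction s with
    | zero => simp
    | add x y hx hy => simp only [map_add, add_mul, hx, hy]
    | tmul x y => rw [hm, hs, mul_assoc, Algebra.commutes]; simp [m, mul_assoc]
  let S : Subalgebra k (LinearAlgebra.FreeProduct k H) :=
    { carrier := {x | m (comulHom k H x) = algebraMap k _ (counitHom k H x)}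
      mul_mem' := by
        intro x y hx hy
        change m (comulHom k H _) = algebraMap k _ (counitHom k H _) at hx hy ⊢
        rw [map_mul, hm' _ _ _ hy, hx, map_mul, map_mul]
      add_mem' := by
        intro x y hx hy
        change m (comulHom k H _) = algebraMap k _ (counitHom k H _) at hx hy ⊢
        simp only [map_add, hx, hy]
      algebraMap_mem' := by
        intro c
        simp [m, Algebra.TensorProduct.one_def, antipodeLin_one,
          Algebra.algebraMap_eq_smul_one] }
  refine mem_of_factors S ?_ x
  intro i a
  change m (comulHom k H (ι k H i a)) = algebraMap k _ (counitHom k H (ι k H i a))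
  rw [comulHom_ι, counitHom_ι]
  have h1 : ∀ t : H i ⊗[k] H i, m (Algebra.TensorProduct.map (ι k H i) (ι k H i) t) =
      ι k H i (LinearMap.mul' k _ ((HopfAlgebra.antipode k).lTensor _ t)) := by
    intro t
    induction t with
    | zero => simp
    | add x y hx hy => simp only [map_add, hx, hy]
    | tmul x y => simp [m, antipodeLin_ι]
  rw [h1, HopfAlgebra.mul_antipode_lTensor_comul_apply, AlgHom.commutes]

instance instHopfAlgebra : HopfAlgebra k (LinearAlgebra.FreeProduct k H) where
  antipode := antipodeLin k H
  mul_antipode_rTensor_comul := LinearMap.ext (antipode_left k H)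
  mul_antipode_lTensor_comul := LinearMap.ext (antipode_right k H)

end Hopf
end LinearAlgebra.FreeProduct

/-- The two-element family of algebras with members `A` and `B`. -/
def FactorPair (A B : Type u) : Bool → Type u
  | false => A
  | true => B

instance FactorPair.instRing (A B : Type u) [Ring A] [Ring B] :
    ∀ b, Ring (FactorPair A B b)
  | false => inferInstanceAs (Ring A)
  | true => inferInstanceAs (Ring B)

instance FactorPair.instHopfAlgebra (k A B : Type u) [CommRing k] [Ring A] [HopfAlgebra k A]
    [Ring B] [HopfAlgebra k B] : ∀ b, HopfAlgebra k (FactorPair A B b)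
  | false => inferInstanceAs (HopfAlgebra k A)
  | true => inferInstanceAs (HopfAlgebra k B)

/-- The free product `A * B` of two Hopf algebras over `k`: the free product (coproduct) of
algebras, with the comultiplication, counit and antipode that extend those of `A` and `B`. -/
abbrev HopfFreeProduct (k A B : Type u) [CommRing k] [Ring A] [HopfAlgebra k A]
    [Ring B] [HopfAlgebra k B] : Type u :=
  LinearAlgebra.FreeProduct k (FactorPair A B)

/-! ## Comodules and cosemisimplicity -/

/-- A right comodule `V` over a coalgebra `A`, with coaction `v ↦ v₍₀₎ ⊗ v₍₁₎`. -/
class RightComodule (k A V : Type*) [CommSemiring k] [AddCommMonoid A] [Module k A]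
    [Coalgebra k A] [AddCommMonoid V] [Module k V] where
  /-- The coaction. -/
  coact : V →ₗ[k] V ⊗[k] A
  coassoc : (TensorProduct.assoc k V A A).toLinearMap ∘ₗ coact.rTensor A ∘ₗ coact =
    Coalgebra.comul.lTensor V ∘ₗ coact
  counit_coact : (TensorProduct.rid k V).toLinearMap ∘ₗ Coalgebra.counit.lTensor V ∘ₗ coact =
    LinearMap.id

/-- `W` is a subcomodule of `V`: the coaction maps `W` into the image of `W ⊗ A`. -/
def IsSubcomodule {k : Type*} (A : Type*) {V : Type*} [CommRing k] [AddCommGroup A] [Module k A]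
    [Coalgebra k A] [AddCommGroup V] [Module k V] [RightComodule k A V]
    (W : Submodule k V) : Prop :=
  ∀ w ∈ W, RightComodule.coact (A := A) w ∈ LinearMap.range (W.subtype.rTensor A)

/-- A coalgebra is cosemisimple if each right comodule is completely reducible: each of
its subcomodules has a complement that is a subcomodule. -/
def IsCosemisimple (k A : Type u) [Field k] [AddCommGroup A] [Module k A]
    [Coalgebra k A] : Prop :=
  ∀ (V : Type u) [AddCommGroup V] [Module k V] [RightComodule k A V] (W : Submodule k V),
    IsSubcomodule A W → ∃ W' : Submodule k V, IsSubcomodule A W' ∧ IsCompl W W'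

/-! ## Yetter-Drinfeld modules -/

section YD

variable (k A : Type u) [Field k] [Ring A] [HopfAlgebra k A]

section Op

variable (V : Type u) [AddCommGroup V] [Module k V] [Module Aᵐᵒᵖ V] [IsScalarTower k Aᵐᵒᵖ V]

/-- The right action of `b : A` on a right `A`-module. -/
def rightAct (b : A) : V →ₗ[k] V := Algebra.lsmul k k V (MulOpposite.op b)

@[simp] theorem rightAct_apply (b : A) (v : V) : rightAct k A V b v = MulOpposite.op b • v := rfl

/-- The linear map `(a ⊗ b) ⊗ c ↦ (v ⊗ x ↦ v · b ⊗ S(a) x c)`. -/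
def ydTwist : (A ⊗[k] A) ⊗[k] A →ₗ[k] (V ⊗[k] A →ₗ[k] V ⊗[k] A) :=
  TensorProduct.lift <| TensorProduct.lift <| LinearMap.mk₂ k
    (fun a b =>
      { toFun := fun c => TensorProduct.map (rightAct k A V b)
          (LinearMap.mulRight k c ∘ₗ LinearMap.mulLeft k (HopfAlgebra.antipode k a))
        map_add' := by intros; ext; simp [mul_add, TensorProduct.tmul_add]
        map_smul' := by intros; ext; simp })
    (by intros; ext; simp [add_mul, TensorProduct.tmul_add])
    (by intros; ext; simp)
    (by intros; ext; simp [add_smul, TensorProduct.add_tmul])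
    (by intros; ext; simp [TensorProduct.smul_tmul'])

@[simp] theorem ydTwist_tmul (a b c x : A) (v : V) :
    ydTwist k A V ((a ⊗ₜ b) ⊗ₜ c) (v ⊗ₜ x) =
      (MulOpposite.op b • v) ⊗ₜ (HopfAlgebra.antipode k a * x * c) := rfl

end Op

/-- A right-right Yetter-Drinfeld module over the Hopf algebra `A`: a right `A`-module (that is,
an `Aᵐᵒᵖ`-module) and right `A`-comodule such that
`(v · a)₍₀₎ ⊗ (v · a)₍₁₎ = v₍₀₎ · a₍₂₎ ⊗ S(a₍₁₎) v₍₁₎ a₍₃₎`. -/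
structure YetterDrinfeld where
  carrier : Type u
  [addCommGroup : AddCommGroup carrier]
  [module : Module k carrier]
  [opModule : Module Aᵐᵒᵖ carrier]
  [isScalarTower : IsScalarTower k Aᵐᵒᵖ carrier]
  [comodule : RightComodule k A carrier]
  compat : ∀ (v : carrier) (a : A),
    RightComodule.coact (k := k) (A := A) (MulOpposite.op a • v) =
      ydTwist k A carrier (Coalgebra.comul.rTensor A (Coalgebra.comul (R := k) a))
        (RightComodule.coact v)

namespace YetterDrinfeld

attribute [instance] addCommGroup module opModule isScalarTower comodule

variable {k A}

instance : CoeSort (YetterDrinfeld k A) (Type u) := ⟨carrier⟩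

/-- The coaction of a Yetter-Drinfeld module. -/
abbrev coact (X : YetterDrinfeld k A) : X →ₗ[k] X ⊗[k] A := RightComodule.coact

/-- Morphisms of Yetter-Drinfeld modules: the `A`-linear `A`-colinear maps. -/
@[ext]
structure Hom (X Y : YetterDrinfeld k A) where
  toLin : X →ₗ[k] Y
  map_act : ∀ (a : A) (v : X), toLin (MulOpposite.op a • v) = MulOpposite.op a • toLin v
  map_coact : ∀ v : X, Y.coact (toLin v) = toLin.rTensor A (X.coact v)

instance : Category (YetterDrinfeld k A) where
  Hom X Y := Hom X Y
  id X := ⟨LinearMap.id, fun _ _ => rfl, fun _ => by simp⟩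
  comp f g := ⟨g.toLin ∘ₗ f.toLin, fun a v => by simp [f.map_act, g.map_act],
    fun v => by simp [f.map_coact, g.map_coact, LinearMap.rTensor_comp]⟩

variable {X Y Z : YetterDrinfeld k A}

@[ext] theorem hom_ext {f g : X ⟶ Y} (h : ∀ v, f.toLin v = g.toLin v) : f = g :=
  Hom.ext (LinearMap.ext h)

@[simp] theorem id_toLin (v : X) : (𝟙 X : X ⟶ X).toLin v = v := rfl
@[simp] theorem comp_toLin (f : X ⟶ Y) (g : Y ⟶ Z) (v : X) :
    (f ≫ g).toLin v = g.toLin (f.toLin v) := rfl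

instance : Zero (X ⟶ Y) := ⟨⟨0, by simp, by simp⟩⟩
instance : Add (X ⟶ Y) := ⟨fun f g => ⟨f.toLin + g.toLin, by simp [f.map_act, g.map_act],
  by simp [f.map_coact, g.map_coact, LinearMap.rTensor_add]⟩⟩
instance : Neg (X ⟶ Y) := ⟨fun f => ⟨-f.toLin, by simp [f.map_act],
  by simp [f.map_coact, LinearMap.rTensor_neg]⟩⟩

@[simp] theorem zero_toLin (v : X) : (0 : X ⟶ Y).toLin v = 0 := rfl
@[simp] theorem add_toLin (f g : X ⟶ Y) (v : X) : (f + g).toLin v = f.toLin v + g.toLin v := rfl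
@[simp] theorem neg_toLin (f : X ⟶ Y) (v : X) : (-f).toLin v = -f.toLin v := rfl

instance : AddCommGroup (X ⟶ Y) where
  add_assoc _ _ _ := by ext; simp [add_assoc]
  zero_add _ := by ext; simp
  add_zero _ := by ext; simp
  nsmul := nsmulRec
  zsmul := zsmulRec
  neg_add_cancel _ := by ext; simp
  add_comm _ _ := by ext; simp [add_comm]

instance : Preadditive (YetterDrinfeld k A) where
  add_comp _ _ _ _ _ _ := by ext; simp
  comp_add _ _ _ _ _ _ := by ext; simp

/-- The trivial Yetter-Drinfeld module `k`: `A` acts through the counit, and `1` is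
coinvariant. -/
def trivial (k A : Type u) [Field k] [Ring A] [HopfAlgebra k A] : YetterDrinfeld k A :=
  letI : Module Aᵐᵒᵖ k := Module.compHom k
    ((Bialgebra.counitAlgHom k A).toRingHom.fromOpposite fun _ _ => mul_comm _ _)
  haveI : IsScalarTower k Aᵐᵒᵖ k := ⟨fun c a x => by
    change Coalgebra.counit (R := k) (c • a.unop) * x = c * (Coalgebra.counit (R := k) a.unop * x)
    rw [map_smul, smul_eq_mul, mul_assoc]⟩
  letI : RightComodule k A k :=
    { coact := (TensorProduct.mk k k A).flip 1
      coassoc := by ext; simp [Algebra.TensorProduct.one_def]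
      counit_coact := by ext; simp }
  { carrier := k
    compat := by
      intro v a
      have h1 : ∀ t : (A ⊗[k] A) ⊗[k] A, ydTwist k A k t (v ⊗ₜ 1) =
          v ⊗ₜ LinearMap.mul' k A ((HopfAlgebra.antipode k).rTensor A
            (((TensorProduct.rid k A).toLinearMap ∘ₗ
              Coalgebra.counit.lTensor A).rTensor A t)) := by
        intro t
        induction t with
        | zero => simp
        | add x y hx hy => simp only [map_add, LinearMap.add_apply, hx, hy, TensorProduct.tmul_add]
        | tmul x c =>
          induction x with
          | zero => simp
          | add x y hx hy =>
            simp only [map_add, LinearMap.add_apply, hx, hy, TensorProduct.tmul_add,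
              TensorProduct.add_tmul]
          | tmul a b =>
            have h2 : (MulOpposite.op b • v : k) = Coalgebra.counit (R := k) b • v := rfl
            simp only [ydTwist_tmul, h2, LinearMap.rTensor_tmul, LinearMap.comp_apply,
              LinearMap.lTensor_tmul, LinearEquiv.coe_coe, TensorProduct.rid_tmul,
              LinearMap.mul'_apply, mul_one, TensorProduct.smul_tmul, mul_smul_comm]
      have h3 : ((TensorProduct.rid k A).toLinearMap ∘ₗ Coalgebra.counit.lTensor A) ∘ₗ
          Coalgebra.comul (R := k) (A := A) = LinearMap.id := by
        ext; simp
      have h4 : (MulOpposite.op a • v : k) = Coalgebra.counit (R := k) a • v := rfl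
      change (MulOpposite.op a • v : k) ⊗ₜ[k] (1 : A) = ydTwist k A k _ (v ⊗ₜ 1)
      rw [h1, ← LinearMap.rTensor_comp_apply A _ (Coalgebra.comul (R := k) (A := A)), h3,
        LinearMap.rTensor_id, LinearMap.id_apply,
        HopfAlgebra.mul_antipode_rTensor_comul_apply, h4, TensorProduct.smul_tmul,
        Algebra.algebraMap_eq_smul_one] }

theorem ydTwist_natural {V W : Type u} [AddCommGroup V] [Module k V] [Module Aᵐᵒᵖ V]
    [IsScalarTower k Aᵐᵒᵖ V] [AddCommGroup W] [Module k W] [Module Aᵐᵒᵖ W]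
    [IsScalarTower k Aᵐᵒᵖ W] (f : V →ₗ[k] W)
    (hf : ∀ (a : A) (v : V), f (MulOpposite.op a • v) = MulOpposite.op a • f v)
    (t : (A ⊗[k] A) ⊗[k] A) (x : V ⊗[k] A) :
    f.rTensor A (ydTwist k A V t x) = ydTwist k A W t (f.rTensor A x) := by
  induction x with
  | zero => simp
  | add x y hx hy => simp only [map_add, hx, hy]
  | tmul v x =>
    induction t with
    | zero => simp
    | add x y hx hy => simp only [map_add, LinearMap.add_apply, hx, hy]
    | tmul t c =>
      induction t with
      | zero => simp
      | add x y hx hy =>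
        simp only [map_add, LinearMap.add_apply, hx, hy, TensorProduct.add_tmul]
      | tmul a b => simp [hf]

/-- The underlying `A`-linear map of a morphism. -/
def Hom.opLin (f : X ⟶ Y) : X →ₗ[Aᵐᵒᵖ] Y where
  toFun := f.toLin
  map_add' := map_add _
  map_smul' a v := f.map_act a.unop v

theorem rTensor_injective {V W : Type u} [AddCommGroup V] [Module k V] [AddCommGroup W]
    [Module k W] (f : V →ₗ[k] W) (hf : Function.Injective f) :
    Function.Injective (f.rTensor A) :=
  Module.Flat.rTensor_preserves_injective_linearMap f hf

section Comodule

variable {V W : Type u} [AddCommGroup V] [Module k V] [AddCommGroup W] [Module k W]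

theorem rTensor_assoc (f : V →ₗ[k] W) (t : (V ⊗[k] A) ⊗[k] A) :
    f.rTensor (A ⊗[k] A) (TensorProduct.assoc k V A A t) =
      TensorProduct.assoc k W A A ((f.rTensor A).rTensor A t) := by
  induction t with
  | zero => simp
  | add x y hx hy => simp only [map_add, hx, hy]
  | tmul t c =>
    induction t with
    | zero => simp
    | add x y hx hy => simp only [map_add, hx, hy, TensorProduct.add_tmul]
    | tmul a b => simp

theorem rTensor_comul (f : V →ₗ[k] W) (t : V ⊗[k] A) :
    f.rTensor (A ⊗[k] A) (Coalgebra.comul.lTensor V t) =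
      Coalgebra.comul.lTensor W (f.rTensor A t) := by
  induction t with
  | zero => simp
  | add x y hx hy => simp only [map_add, hx, hy]
  | tmul v a => simp

theorem rid_counit (f : V →ₗ[k] W) (t : V ⊗[k] A) :
    f (TensorProduct.rid k V (Coalgebra.counit.lTensor V t)) =
      TensorProduct.rid k W (Coalgebra.counit.lTensor W (f.rTensor A t)) := by
  induction t with
  | zero => simp
  | add x y hx hy => simp only [map_add, hx, hy]
  | tmul v a => simp

theorem coassoc_apply [RightComodule k A V] (v : V) :
    TensorProduct.assoc k V A A ((RightComodule.coact (k := k) (A := A) (V := V)).rTensor A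
      (RightComodule.coact v)) = Coalgebra.comul.lTensor V (RightComodule.coact v) :=
  LinearMap.congr_fun RightComodule.coassoc v

theorem counit_coact_apply [RightComodule k A V] (v : V) :
    TensorProduct.rid k V (Coalgebra.counit.lTensor V (RightComodule.coact (A := A) v)) = v :=
  LinearMap.congr_fun (RightComodule.counit_coact (k := k) (A := A) (V := V)) v

theorem coassoc_of_comp_eq [RightComodule k A V] (f : V →ₗ[k] W) (δ : W →ₗ[k] W ⊗[k] A)
    (hδ : δ ∘ₗ f = f.rTensor A ∘ₗ RightComodule.coact) (v : V) :
    TensorProduct.assoc k W A A (δ.rTensor A (δ (f v))) =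
      Coalgebra.comul.lTensor W (δ (f v)) := by
  have h : δ (f v) = f.rTensor A (RightComodule.coact v) := LinearMap.congr_fun hδ v
  rw [h, ← LinearMap.rTensor_comp_apply, hδ, LinearMap.rTensor_comp_apply, ← rTensor_assoc,
    coassoc_apply, rTensor_comul]

theorem counit_of_comp_eq [RightComodule k A V] (f : V →ₗ[k] W) (δ : W →ₗ[k] W ⊗[k] A)
    (hδ : δ ∘ₗ f = f.rTensor A ∘ₗ RightComodule.coact) (v : V) :
    TensorProduct.rid k W (Coalgebra.counit.lTensor W (δ (f v))) = f v := by
  have h : δ (f v) = f.rTensor A (RightComodule.coact v) := LinearMap.congr_fun hδ v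
  rw [h, ← rid_counit, counit_coact_apply]

theorem exists_coact_of_injective [RightComodule k A W] (f : V →ₗ[k] W)
    (hf : Function.Injective f)
    (h : ∀ v, RightComodule.coact (A := A) (f v) ∈ LinearMap.range (f.rTensor A)) :
    ∃ δ : V →ₗ[k] V ⊗[k] A, f.rTensor A ∘ₗ δ = RightComodule.coact ∘ₗ f := by
  refine ⟨(LinearEquiv.ofInjective (f.rTensor A) (rTensor_injective f hf)).symm.toLinearMap ∘ₗ
    (RightComodule.coact ∘ₗ f).codRestrict _ h, ?_⟩
  ext v
  exact congrArg Subtype.val ((LinearEquiv.ofInjective (f.rTensor A)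
    (rTensor_injective f hf)).apply_symm_apply ⟨RightComodule.coact (f v), h v⟩)

/-- The comodule structure on `V` induced by an injective map to a comodule `W` such that the
coaction of `W` maps the image of `V` to the image of `V ⊗ A`. -/
@[reducible]
def comoduleOfInjective [RightComodule k A W] (f : V →ₗ[k] W) (hf : Function.Injective f)
    (h : ∀ v, RightComodule.coact (A := A) (f v) ∈ LinearMap.range (f.rTensor A)) :
    RightComodule k A V where
  coact := (exists_coact_of_injective f hf h).choose
  coassoc := by
    have hδ := (exists_coact_of_injective f hf h).choose_spec
    set δ := (exists_coact_of_injective f hf h).choose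
    have hδ' : ∀ v, f.rTensor A (δ v) = RightComodule.coact (f v) := LinearMap.congr_fun hδ
    ext v
    apply Module.Flat.rTensor_preserves_injective_linearMap (M := A ⊗[k] A) f hf
    change f.rTensor (A ⊗[k] A) (TensorProduct.assoc k V A A (δ.rTensor A (δ v))) =
      f.rTensor (A ⊗[k] A) (Coalgebra.comul.lTensor V (δ v))
    rw [rTensor_assoc, rTensor_comul, ← LinearMap.rTensor_comp_apply, hδ,
      LinearMap.rTensor_comp_apply, hδ', coassoc_apply]
  counit_coact := by
    have hδ := (exists_coact_of_injective f hf h).choose_spec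
    set δ := (exists_coact_of_injective f hf h).choose
    have hδ' : ∀ v, f.rTensor A (δ v) = RightComodule.coact (f v) := LinearMap.congr_fun hδ
    ext v
    apply hf
    change f (TensorProduct.rid k V (Coalgebra.counit.lTensor V (δ v))) = f v
    rw [rid_counit, hδ', counit_coact_apply]

theorem comoduleOfInjective_coact [RightComodule k A W] (f : V →ₗ[k] W)
    (hf : Function.Injective f)
    (h : ∀ v, RightComodule.coact (A := A) (f v) ∈ LinearMap.range (f.rTensor A)) (v : V) :
    f.rTensor A ((comoduleOfInjective f hf h).coact v) = RightComodule.coact (f v) :=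
  LinearMap.congr_fun (exists_coact_of_injective f hf h).choose_spec v

theorem exists_desc (f : V →ₗ[k] W) (hf : Function.Surjective f) {U : Type u} [AddCommGroup U]
    [Module k U] (g : V →ₗ[k] U) (h : ∀ v, f v = 0 → g v = 0) :
    ∃ l : W →ₗ[k] U, l ∘ₗ f = g := by
  refine ⟨(LinearMap.ker f).liftQ g h ∘ₗ (f.quotKerEquivOfSurjective hf).symm.toLinearMap, ?_⟩
  ext v
  have : (f.quotKerEquivOfSurjective hf).symm (f v) = (LinearMap.ker f).mkQ v := by
    rw [LinearEquiv.symm_apply_eq]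
    rfl
  rw [LinearMap.comp_apply, LinearMap.comp_apply, LinearEquiv.coe_coe, this]
  rfl

/-- The comodule structure on `W` induced by a surjective map from a comodule `V`, provided
the coaction of `V` maps the kernel to zero in `W ⊗ A`. -/
@[reducible]
def comoduleOfSurjective [RightComodule k A V] (f : V →ₗ[k] W) (hf : Function.Surjective f)
    (h : ∀ v, f v = 0 → (f.rTensor A ∘ₗ RightComodule.coact (A := A)) v = 0) :
    RightComodule k A W where
  coact := (exists_desc f hf _ h).choose
  coassoc := by
    ext w
    obtain ⟨v, rfl⟩ := hf w
    exact coassoc_of_comp_eq f _ (exists_desc f hf _ h).choose_spec v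
  counit_coact := by
    ext w
    obtain ⟨v, rfl⟩ := hf w
    exact counit_of_comp_eq f _ (exists_desc f hf _ h).choose_spec v

theorem comoduleOfSurjective_coact [RightComodule k A V] (f : V →ₗ[k] W)
    (hf : Function.Surjective f)
    (h : ∀ v, f v = 0 → (f.rTensor A ∘ₗ RightComodule.coact (A := A)) v = 0) (v : V) :
    (comoduleOfSurjective f hf h).coact (f v) = f.rTensor A (RightComodule.coact v) :=
  LinearMap.congr_fun (exists_desc f hf _ h).choose_spec v

end Comodule

section Induced

variable (V : Type u) [AddCommGroup V] [Module k V] [Module Aᵐᵒᵖ V] [IsScalarTower k Aᵐᵒᵖ V]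

/-- The Yetter-Drinfeld module structure on an `A`-module `V` induced by an injective
`A`-linear map. -/
def ofInjective (X : YetterDrinfeld k A) (f : V →ₗ[k] X) (hf : Function.Injective f)
    (hact : ∀ (a : A) (v : V), f (MulOpposite.op a • v) = MulOpposite.op a • f v)
    (h : ∀ v, X.coact (f v) ∈ LinearMap.range (f.rTensor A)) : YetterDrinfeld k A where
  carrier := V
  comodule := comoduleOfInjective f hf h
  compat v a := by
    apply rTensor_injective f hf
    rw [ydTwist_natural f hact, comoduleOfInjective_coact, comoduleOfInjective_coact, hact,
      X.compat]

/-- The Yetter-Drinfeld module structure on an `A`-module `V` induced by a surjective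
`A`-linear map. -/
def ofSurjective (X : YetterDrinfeld k A) (f : X →ₗ[k] V) (hf : Function.Surjective f)
    (hact : ∀ (a : A) (v : X), f (MulOpposite.op a • v) = MulOpposite.op a • f v)
    (h : ∀ v, f v = 0 → (f.rTensor A ∘ₗ X.coact) v = 0) : YetterDrinfeld k A where
  carrier := V
  comodule := comoduleOfSurjective f hf h
  compat v a := by
    obtain ⟨v, rfl⟩ := hf v
    rw [← hact, comoduleOfSurjective_coact, comoduleOfSurjective_coact,
      ← ydTwist_natural f hact, X.compat]

/-- The structure map of an induced Yetter-Drinfeld module is a morphism. -/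
def ofInjectiveHom (X : YetterDrinfeld k A) (f : V →ₗ[k] X) (hf : Function.Injective f)
    (hact : ∀ (a : A) (v : V), f (MulOpposite.op a • v) = MulOpposite.op a • f v)
    (h : ∀ v, X.coact (f v) ∈ LinearMap.range (f.rTensor A)) :
    ofInjective V X f hf hact h ⟶ X :=
  Hom.mk (X := ofInjective V X f hf hact h) f hact
    fun v => (comoduleOfInjective_coact f hf h v).symm

/-- The structure map of a coinduced Yetter-Drinfeld module is a morphism. -/
def ofSurjectiveHom (X : YetterDrinfeld k A) (f : X →ₗ[k] V) (hf : Function.Surjective f)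
    (hact : ∀ (a : A) (v : X), f (MulOpposite.op a • v) = MulOpposite.op a • f v)
    (h : ∀ v, f v = 0 → (f.rTensor A ∘ₗ X.coact) v = 0) :
    X ⟶ ofSurjective V X f hf hact h :=
  Hom.mk (Y := ofSurjective V X f hf hact h) f hact
    fun v => comoduleOfSurjective_coact f hf h v

end Induced

/-- A morphism that factors, on underlying spaces, through an injective morphism. -/
def liftOfInjective (f : X ⟶ Y) (hf : Function.Injective f.toLin) (g : Z ⟶ Y)
    (h : ∀ z, g.toLin z ∈ LinearMap.range f.toLin) : Z ⟶ X :=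
  let l : Z →ₗ[k] X := (LinearEquiv.ofInjective f.toLin hf).symm.toLinearMap ∘ₗ
      g.toLin.codRestrict _ h
  have hl : ∀ z, f.toLin (l z) = g.toLin z := fun z =>
    congrArg Subtype.val ((LinearEquiv.ofInjective f.toLin hf).apply_symm_apply
      ⟨g.toLin z, h z⟩)
  { toLin := l
    map_act := fun a v => hf <| by rw [hl, f.map_act, g.map_act, hl]
    map_coact := fun v => rTensor_injective f.toLin hf <| by
      have h2 : f.toLin ∘ₗ l = g.toLin := LinearMap.ext hl
      rw [← f.map_coact, hl, g.map_coact, ← LinearMap.rTensor_comp_apply, h2] }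

theorem liftOfInjective_comp (f : X ⟶ Y) (hf : Function.Injective f.toLin) (g : Z ⟶ Y)
    (h : ∀ z, g.toLin z ∈ LinearMap.range f.toLin) : liftOfInjective f hf g h ≫ f = g := by
  ext z
  exact congrArg Subtype.val ((LinearEquiv.ofInjective f.toLin hf).apply_symm_apply
      ⟨g.toLin z, h z⟩)

/-- A morphism that factors, on underlying spaces, through a surjective morphism. -/
def descOfSurjective (f : X ⟶ Y) (hf : Function.Surjective f.toLin) (g : X ⟶ Z)
    (h : ∀ x, f.toLin x = 0 → g.toLin x = 0) : Y ⟶ Z :=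
  have hl := LinearMap.congr_fun (exists_desc f.toLin hf g.toLin h).choose_spec
  { toLin := (exists_desc f.toLin hf g.toLin h).choose
    map_act := fun a v => by
      obtain ⟨v, rfl⟩ := hf v
      rw [← f.map_act]
      exact (hl _).trans ((g.map_act a v).trans (congrArg _ (hl v).symm))
    map_coact := fun v => by
      obtain ⟨v, rfl⟩ := hf v
      rw [f.map_coact, ← LinearMap.rTensor_comp_apply,
        (exists_desc f.toLin hf g.toLin h).choose_spec, ← g.map_coact]
      exact congrArg _ (hl v) }

theorem comp_descOfSurjective (f : X ⟶ Y) (hf : Function.Surjective f.toLin) (g : X ⟶ Z)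
    (h : ∀ x, f.toLin x = 0 → g.toLin x = 0) : f ≫ descOfSurjective f hf g h = g := by
  ext x
  exact LinearMap.congr_fun (exists_desc f.toLin hf g.toLin h).choose_spec x

/-- The kernel of a morphism, included in its source. -/
def kerIncl (f : X ⟶ Y) : LinearMap.ker (Hom.opLin f) →ₗ[k] X :=
  (LinearMap.ker (Hom.opLin f)).subtype.restrictScalars k

theorem kerIncl_injective (f : X ⟶ Y) : Function.Injective (kerIncl f) :=
  Submodule.injective_subtype (LinearMap.ker (Hom.opLin f))

theorem coact_mem_range (f : X ⟶ Y) (v : LinearMap.ker (Hom.opLin f)) :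
    X.coact (kerIncl f v) ∈ LinearMap.range ((kerIncl f).rTensor A) := by
  have hex : Function.Exact (kerIncl f) f.toLin := by
    intro x
    exact ⟨fun hx => ⟨⟨x, hx⟩, rfl⟩, by rintro ⟨x, rfl⟩; exact x.2⟩
  refine (Module.Flat.rTensor_exact A hex _).1 ?_
  rw [← f.map_coact, (show f.toLin (kerIncl f v) = 0 from v.2), map_zero]

/-- The kernel of a morphism. -/
def ker (f : X ⟶ Y) : YetterDrinfeld k A :=
  ofInjective (LinearMap.ker (Hom.opLin f)) X (kerIncl f)
    (kerIncl_injective f) (fun _ _ => rfl) (coact_mem_range f)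

/-- The inclusion of the kernel. -/
def kerι (f : X ⟶ Y) : ker f ⟶ X :=
  ofInjectiveHom (LinearMap.ker (Hom.opLin f)) X (kerIncl f)
    (kerIncl_injective f) (fun _ _ => rfl) (coact_mem_range f)

theorem kerι_injective (f : X ⟶ Y) : Function.Injective (kerι f).toLin :=
  kerIncl_injective f

theorem toLin_kerIncl (f : X ⟶ Y) (v : LinearMap.ker (Hom.opLin f)) :
    f.toLin (kerIncl f v) = 0 := v.2

theorem kerι_comp (f : X ⟶ Y) : kerι f ≫ f = 0 :=
  hom_ext fun v => toLin_kerIncl f v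

theorem mem_range_kerIncl (f : X ⟶ Y) (v : X) (h : f.toLin v = 0) :
    v ∈ LinearMap.range (kerIncl f) :=
  ⟨⟨v, h⟩, rfl⟩

theorem mem_range_kerι (f : X ⟶ Y) (v : X) (h : f.toLin v = 0) :
    v ∈ LinearMap.range (kerι f).toLin :=
  mem_range_kerIncl f v h

/-- The projection of the target of a morphism to its cokernel. -/
def cokerProj (f : X ⟶ Y) : Y →ₗ[k] (Y ⧸ LinearMap.range (Hom.opLin f)) :=
  (LinearMap.range (Hom.opLin f)).mkQ.restrictScalars k

theorem cokerProj_surjective (f : X ⟶ Y) : Function.Surjective (cokerProj f) :=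
  Submodule.mkQ_surjective (LinearMap.range (Hom.opLin f))

theorem cokerProj_toLin (f : X ⟶ Y) (x : X) : cokerProj f (f.toLin x) = 0 :=
  (Submodule.Quotient.mk_eq_zero (LinearMap.range (Hom.opLin f))).2 ⟨x, rfl⟩

theorem mem_range_of_cokerProj (f : X ⟶ Y) (v : Y) (h : cokerProj f v = 0) :
    v ∈ LinearMap.range f.toLin :=
  (Submodule.Quotient.mk_eq_zero (LinearMap.range (Hom.opLin f))).1 h

theorem cokerProj_coact (f : X ⟶ Y) (v : Y) (hv : cokerProj f v = 0) :
    ((cokerProj f).rTensor A ∘ₗ Y.coact) v = 0 := by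
  obtain ⟨x, rfl⟩ := mem_range_of_cokerProj f v hv
  have h : cokerProj f ∘ₗ f.toLin = 0 := LinearMap.ext fun x => cokerProj_toLin f x
  rw [LinearMap.comp_apply, f.map_coact, ← LinearMap.rTensor_comp_apply, h,
    LinearMap.rTensor_zero, LinearMap.zero_apply]

/-- The cokernel of a morphism. -/
def coker (f : X ⟶ Y) : YetterDrinfeld k A :=
  ofSurjective (Y ⧸ LinearMap.range (Hom.opLin f)) Y (cokerProj f)
    (cokerProj_surjective f) (fun _ _ => rfl) (cokerProj_coact f)

/-- The projection to the cokernel. -/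
def cokerπ (f : X ⟶ Y) : Y ⟶ coker f :=
  ofSurjectiveHom (Y ⧸ LinearMap.range (Hom.opLin f)) Y (cokerProj f)
    (cokerProj_surjective f) (fun _ _ => rfl) (cokerProj_coact f)

theorem cokerπ_surjective (f : X ⟶ Y) : Function.Surjective (cokerπ f).toLin :=
  cokerProj_surjective f

theorem comp_cokerπ (f : X ⟶ Y) : f ≫ cokerπ f = 0 :=
  hom_ext fun v => cokerProj_toLin f v

theorem mem_range_of_cokerπ (f : X ⟶ Y) (v : Y) (h : (cokerπ f).toLin v = 0) :
    v ∈ LinearMap.range f.toLin :=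
  mem_range_of_cokerProj f v h

/-- The coaction on a product. -/
def prodCoact (X Y : YetterDrinfeld k A) : X × Y →ₗ[k] (X × Y) ⊗[k] A :=
  (LinearMap.inl k X Y).rTensor A ∘ₗ X.coact ∘ₗ LinearMap.fst k X Y +
    (LinearMap.inr k X Y).rTensor A ∘ₗ Y.coact ∘ₗ LinearMap.snd k X Y

theorem prodCoact_inl : prodCoact X Y ∘ₗ LinearMap.inl k X Y =
    (LinearMap.inl k X Y).rTensor A ∘ₗ X.coact := by
  ext v; simp [prodCoact]

theorem prodCoact_inr : prodCoact X Y ∘ₗ LinearMap.inr k X Y =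
    (LinearMap.inr k X Y).rTensor A ∘ₗ Y.coact := by
  ext v; simp [prodCoact]

/-- The product of two Yetter-Drinfeld modules. -/
def prod (X Y : YetterDrinfeld k A) : YetterDrinfeld k A where
  carrier := X × Y
  comodule :=
    { coact := prodCoact X Y
      coassoc := by
        apply LinearMap.prod_ext
        · ext v; exact coassoc_of_comp_eq _ _ prodCoact_inl v
        · ext v; exact coassoc_of_comp_eq _ _ prodCoact_inr v
      counit_coact := by
        apply LinearMap.prod_ext
        · ext1 v; exact counit_of_comp_eq _ _ prodCoact_inl v
        · ext1 v; exact counit_of_comp_eq _ _ prodCoact_inr v }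
  compat v a := by
    change prodCoact X Y (MulOpposite.op a • v) = ydTwist k A (X × Y) _ (prodCoact X Y v)
    simp only [prodCoact, LinearMap.add_apply, LinearMap.comp_apply, map_add]
    rw [← ydTwist_natural _ (fun _ _ => by simp), ← ydTwist_natural _ (fun _ _ => by simp)]
    exact congrArg₂ (· + ·) (congrArg _ (X.compat v.1 a)) (congrArg _ (Y.compat v.2 a))

open Limits

theorem injective_of_mono (f : X ⟶ Y) [Mono f] : Function.Injective f.toLin := by
  have h : kerι f = 0 := by rw [← cancel_mono f, kerι_comp, zero_comp]
  rw [injective_iff_map_eq_zero]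
  intro v hv
  obtain ⟨w, rfl⟩ := mem_range_kerι f v hv
  rw [h, zero_toLin]

theorem surjective_of_epi (f : X ⟶ Y) [Epi f] : Function.Surjective f.toLin := by
  have h : cokerπ f = 0 := by rw [← cancel_epi f, comp_cokerπ, comp_zero]
  intro v
  exact mem_range_of_cokerπ f v (by rw [h, zero_toLin])

/-- An injective morphism whose image is the zero set of `g` is a kernel of `g`. -/
def isLimitOfInjective (f : X ⟶ Y) (hf : Function.Injective f.toLin) (g : Y ⟶ Z)
    (w : f ≫ g = 0) (h : ∀ y, g.toLin y = 0 → y ∈ LinearMap.range f.toLin) :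
    IsLimit (KernelFork.ofι f w) :=
  KernelFork.IsLimit.ofι f w
    (fun g' hg' => liftOfInjective f hf g' fun z =>
      h _ (by rw [← comp_toLin, hg', zero_toLin]))
    (fun _ _ => liftOfInjective_comp _ _ _ _)
    (fun _ _ m hm => by
      ext v
      apply hf
      rw [← comp_toLin, ← comp_toLin, hm, liftOfInjective_comp])

/-- A surjective morphism whose zero set is the image of `f` is a cokernel of `f`. -/
def isColimitOfSurjective (f : X ⟶ Y) (g : Y ⟶ Z) (hg : Function.Surjective g.toLin)
    (w : f ≫ g = 0) (h : ∀ y, g.toLin y = 0 → y ∈ LinearMap.range f.toLin) :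
    IsColimit (CokernelCofork.ofπ g w) :=
  CokernelCofork.IsColimit.ofπ g w
    (fun g' hg' => descOfSurjective g hg g' fun y hy => by
      obtain ⟨x, rfl⟩ := h y hy
      rw [← comp_toLin, hg', zero_toLin])
    (fun _ _ => comp_descOfSurjective _ _ _ _)
    (fun _ _ m hm => by
      ext v
      obtain ⟨v, rfl⟩ := hg v
      rw [← comp_toLin, ← comp_toLin, hm, comp_descOfSurjective])

instance : HasZeroObject (YetterDrinfeld k A) :=
  ⟨coker (𝟙 (trivial k A)), by
    rw [IsZero.iff_id_eq_zero]
    ext v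
    obtain ⟨v, rfl⟩ := cokerπ_surjective _ v
    have h := congrArg (fun g => Hom.toLin g v) (comp_cokerπ (𝟙 (trivial k A)))
    simpa using h⟩

theorem fst_prodCoact (v : X × Y) :
    X.coact v.1 = (LinearMap.fst k X Y).rTensor A (prodCoact X Y v) := by
  simp [prodCoact, ← LinearMap.rTensor_comp_apply, LinearMap.rTensor_zero]

theorem snd_prodCoact (v : X × Y) :
    Y.coact v.2 = (LinearMap.snd k X Y).rTensor A (prodCoact X Y v) := by
  simp [prodCoact, ← LinearMap.rTensor_comp_apply, LinearMap.rTensor_zero]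

theorem inl_act (a : A) (v : X) : LinearMap.inl k X Y (MulOpposite.op a • v) =
    MulOpposite.op a • LinearMap.inl k X Y v := by simp

theorem inr_act (a : A) (v : Y) : LinearMap.inr k X Y (MulOpposite.op a • v) =
    MulOpposite.op a • LinearMap.inr k X Y v := by simp

/-- The biproduct of two Yetter-Drinfeld modules. -/
def bicone (X Y : YetterDrinfeld k A) : BinaryBicone X Y where
  pt := prod X Y
  fst := Hom.mk (X := prod X Y) (LinearMap.fst k X Y) (fun _ _ => rfl) fst_prodCoact
  snd := Hom.mk (X := prod X Y) (LinearMap.snd k X Y) (fun _ _ => rfl) snd_prodCoact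
  inl := Hom.mk (Y := prod X Y) (LinearMap.inl k X Y) inl_act (LinearMap.congr_fun prodCoact_inl)
  inr := Hom.mk (Y := prod X Y) (LinearMap.inr k X Y) inr_act (LinearMap.congr_fun prodCoact_inr)
  inl_fst := by ext; rfl
  inl_snd := by ext; rfl
  inr_fst := by ext; rfl
  inr_snd := by ext; rfl

instance : HasBinaryBiproducts (YetterDrinfeld k A) where
  has_binary_biproduct X Y := hasBinaryBiproduct_of_total (bicone X Y) <| by
    ext v
    exact Prod.fst_add_snd (M := X) (N := Y) v

instance : Abelian (YetterDrinfeld k A) where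
  has_finite_products :=
    haveI : HasBinaryProducts (YetterDrinfeld k A) := inferInstance
    haveI : HasTerminal (YetterDrinfeld k A) := inferInstance
    hasFiniteProducts_of_has_binary_and_terminal
  has_kernels := ⟨fun f => ⟨⟨⟨_, isLimitOfInjective (kerι f) (kerι_injective f) f
    (kerι_comp f) (mem_range_kerι f)⟩⟩⟩⟩
  has_cokernels := ⟨fun f => ⟨⟨⟨_, isColimitOfSurjective f (cokerπ f) (cokerπ_surjective f)
    (comp_cokerπ f) (mem_range_of_cokerπ f)⟩⟩⟩⟩
  normalMonoOfMono f _ := ⟨⟨_, cokerπ f, comp_cokerπ f,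
    isLimitOfInjective f (injective_of_mono f) _ _ (mem_range_of_cokerπ f)⟩⟩
  normalEpiOfEpi f _ := ⟨⟨_, kerι f, kerι_comp f,
    isColimitOfSurjective _ f (surjective_of_epi f) _ (mem_range_kerι f)⟩⟩

end YetterDrinfeld

/-! ## Gerstenhaber-Schack cohomology -/

/-- `H_GS^n(A, V) = Ext^n(k, V)` in the category of Yetter-Drinfeld modules over `A`. -/
def GSCohomology (V : YetterDrinfeld k A) (n : ℕ) : Type (u + 1) :=
  haveI : HasExt.{u + 1} (YetterDrinfeld k A) := HasExt.standard _
  Abelian.Ext.{u + 1} (YetterDrinfeld.trivial k A) V n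

instance (V : YetterDrinfeld k A) (n : ℕ) : AddCommGroup (GSCohomology k A V n) :=
  haveI : HasExt.{u + 1} (YetterDrinfeld k A) := HasExt.standard _
  inferInstanceAs (AddCommGroup (Abelian.Ext.{u + 1} (YetterDrinfeld.trivial k A) V n))

/-- The Gerstenhaber-Schack cohomological dimension of `A`: the supremum in `ℕ ∪ {∞}` of the
degrees `n` such that `H_GS^n(A, V) ≠ 0` for some Yetter-Drinfeld module `V`. -/
def cdGS : ℕ∞ :=
  sSup {d : ℕ∞ | ∃ (n : ℕ) (V : YetterDrinfeld k A), d = n ∧ Nontrivial (GSCohomology k A V n)}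

end YD

end

/-
For `H = A * B` there is an exact sequence `0 → H → ind_A k ⊕ ind_B k → k → 0` of Yetter-Drinfeld
modules over `H`, where the first term is the free module on the trivial comodule. Its injectivity
on the left comes from the linear map `D : H → H` with `D(xy) = D(x) y + ε(x) D(y)`,
`D(a) = a - ε(a)` on `A` and `D(b) = 0` on `B`.

A cosemisimple Hopf algebra has a Haar functional, and averaging against it makes free modules
projective. The Haar functionals also provide conditional expectations of `H` onto `A` and `B`,
which make induction reflect projective objects, while the universal property of `H` makes
induction preserve monomorphisms. Hence `ind_A k` over `H` has the projective dimension of `k`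
over `A`, and by the exact sequence `cd H ≤ n + 1` if and only if `cd A ≤ n + 1` and
`cd B ≤ n + 1`.

Finally `cd H ≥ 1`. If `k` were projective, `H` would contain an integral `t` with `ε(t) = 1`.
A map `D : H → A ⊗ B` as above then satisfies `D(t) x + D(x) = 0` whenever `ε(x) = 0`, so that
`D(t) a = -a` and `D(t) b = 0`, and `a ⊗ b = 0` for all `a`, `b` of counit zero.
-/

noncomputable section

open TensorProduct CategoryTheory

section Convolution

open WithConv Coalgebra

variable {k C X Y : Type*} [CommSemiring k] [AddCommMonoid C] [Module k C] [AddCommMonoid X]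
  [Module k X] [AddCommMonoid Y] [Module k Y]

/-- The linear map `T` transports the operators `f c` on `X` to the operators `g c` on `Y`. The
families are elements of convolution algebras, because `T` then also transports convolution
products. -/
def Intertwines (T : X →ₗ[k] Y) (f : WithConv (C →ₗ[k] Module.End k X))
    (g : WithConv (C →ₗ[k] Module.End k Y)) : Prop :=
  ∀ c, T ∘ₗ f c = g c ∘ₗ T

theorem Intertwines.apply {T : X →ₗ[k] Y} {f : WithConv (C →ₗ[k] Module.End k X)}
    {g : WithConv (C →ₗ[k] Module.End k Y)} (h : Intertwines T f g) (c : C) (x : X) :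
    T (f c x) = g c (T x) :=
  LinearMap.congr_fun (h c) x

theorem Intertwines.convMul [Coalgebra k C] {T : X →ₗ[k] Y}
    {f f' : WithConv (C →ₗ[k] Module.End k X)} {g g' : WithConv (C →ₗ[k] Module.End k Y)}
    (h : Intertwines T f g) (h' : Intertwines T f' g') : Intertwines T (f * f') (g * g') := by
  intro c
  ext x
  simp only [(ℛ k c).convMul_apply, LinearMap.comp_apply, LinearMap.sum_apply, map_sum,
    Module.End.mul_apply, h.apply, h'.apply]

/-- The composition of a linear map with an element of a convolution algebra. -/
def convComp {D : Type*} [AddCommMonoid D] [Module k D] (g : C →ₗ[k] D)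
    (f : WithConv (D →ₗ[k] X)) : WithConv (C →ₗ[k] X) :=
  toConv (f.ofConv ∘ₗ g)

@[simp] theorem convComp_apply {D : Type*} [AddCommMonoid D] [Module k D] (g : C →ₗ[k] D)
    (f : WithConv (D →ₗ[k] X)) (c : C) : convComp g f c = f (g c) := rfl

end Convolution

section Antipode

open WithConv Coalgebra HopfAlgebra Algebra.TensorProduct

variable {k A H : Type*} [CommSemiring k] [Semiring A] [HopfAlgebra k A] [Semiring H]
  [HopfAlgebra k H]

/-- The antipode of `A` is the convolution inverse of the identity, so both sides are the
convolution inverse of `φ`. -/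
theorem antipode_bialgHom (φ : A →ₐc[k] H) (a : A) : antipode k (φ a) = φ (antipode k a) := by
  have left : toConv (antipode k ∘ₗ (φ : A →ₗ[k] H)) * toConv (φ : A →ₗ[k] H) = 1 := by
    apply ofConv_injective
    have h := LinearMap.convMul_comp_coalgHom_distrib (toConv (antipode k)) (toConv LinearMap.id)
      (φ : A →ₗc[k] H)
    rw [LinearMap.antipode_mul_id] at h
    exact h.symm.trans (by ext; simp)
  have right : toConv (φ : A →ₗ[k] H) * toConv ((φ : A →ₗ[k] H) ∘ₗ antipode k) = 1 := by
    apply ofConv_injective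
    have h := LinearMap.algHom_comp_convMul_distrib (φ : A →ₐ[k] H) (toConv LinearMap.id)
      (toConv (antipode k))
    rw [LinearMap.id_mul_antipode] at h
    exact h.symm.trans (LinearMap.ext fun a => AlgHomClass.commutes φ (counit a))
  exact LinearMap.congr_fun (congrArg ofConv (left_inv_eq_right_inv left right)) a

theorem convMul_antipode_algHom {R : Type*} [Semiring R] [Algebra k R] (j : A →ₐ[k] R) :
    toConv (j.toLinearMap ∘ₗ antipode k) * toConv j.toLinearMap = 1 := by
  apply ofConv_injective
  have h := LinearMap.algHom_comp_convMul_distrib j (toConv (antipode k)) (toConv LinearMap.id)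
  rw [LinearMap.antipode_mul_id] at h
  exact h.symm.trans (LinearMap.ext fun a => j.commutes (counit a))

theorem comul_antipode (a : A) :
    comul (antipode k a) = TensorProduct.map (antipode k) (antipode k)
      (TensorProduct.comm k A A (comul a)) := by
  let l : A →ₐ[k] A ⊗[k] A := includeLeft
  let r : A →ₐ[k] A ⊗[k] A := includeRight
  have comul_eq : toConv (comul (R := k)) = toConv l.toLinearMap * toConv r.toLinearMap := by
    ext a
    rw [(ℛ k a).convMul_apply]
    simp [l, r, (ℛ k a).eq]
  have inv_eq : toConv (TensorProduct.map (antipode k) (antipode k) ∘ₗ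
      (TensorProduct.comm k A A).toLinearMap ∘ₗ comul) =
      toConv (r.toLinearMap ∘ₗ antipode k) * toConv (l.toLinearMap ∘ₗ antipode k) := by
    ext a
    rw [(ℛ k a).convMul_apply]
    simp [l, r, ← (ℛ k a).eq]
  have left : (toConv (r.toLinearMap ∘ₗ antipode k) * toConv (l.toLinearMap ∘ₗ antipode k)) *
      toConv (comul (R := k)) = 1 := by
    rw [comul_eq, mul_assoc, ← mul_assoc (toConv (l.toLinearMap ∘ₗ antipode k)),
      convMul_antipode_algHom, one_mul, convMul_antipode_algHom]
  rw [← inv_eq] at left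
  exact (LinearMap.congr_fun
    (congrArg ofConv (left_inv_eq_right_inv left LinearMap.comul_right_inv)) a).symm

end Antipode

section ComulSnd

open Coalgebra

variable {k C X : Type*} [CommSemiring k] [AddCommMonoid C] [Module k C] [Coalgebra k C]
  [AddCommMonoid X] [Module k X]

variable (k C X) in
/-- The linear map `x ⊗ c ↦ (x ⊗ c₁) ⊗ c₂`. -/
def comulSnd : X ⊗[k] C →ₗ[k] (X ⊗[k] C) ⊗[k] C :=
  (TensorProduct.assoc k X C C).symm.toLinearMap ∘ₗ comul.lTensor X

theorem comulSnd_tmul (x : X) (c : C) :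
    comulSnd k C X (x ⊗ₜ c) = (TensorProduct.mk k X C x).rTensor C (comul c) := by
  simp [comulSnd, ← (ℛ k c).eq, TensorProduct.tmul_sum]

theorem comulSnd_comp_map {D Y : Type*} [AddCommMonoid D] [Module k D] [Coalgebra k D]
    [AddCommMonoid Y] [Module k Y] (f : X →ₗ[k] Y) (φ : C →ₗc[k] D) :
    comulSnd k D Y ∘ₗ TensorProduct.map f φ.toLinearMap =
      TensorProduct.map (TensorProduct.map f φ.toLinearMap) φ.toLinearMap ∘ₗ comulSnd k C X := by
  refine TensorProduct.ext' fun x c => ?_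
  have h : comul (φ c) = TensorProduct.map φ.toLinearMap φ.toLinearMap (comul c) :=
    (CoalgHomClass.map_comp_comul_apply φ c).symm
  simp [comulSnd_tmul, h, ← (ℛ k c).eq]

end ComulSnd

section Twist

open WithConv Coalgebra HopfAlgebra

variable {k A X Y : Type*} [CommSemiring k] [Semiring A] [HopfAlgebra k A] [AddCommMonoid X]
  [Module k X] [AddCommMonoid Y] [Module k Y]

variable (k A X) in
/-- `a` acts on `X ⊗ A` by `x ⊗ g ↦ x ⊗ S(a) g`. -/
def leftAntipode : WithConv (A →ₗ[k] Module.End k (X ⊗[k] A)) :=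
  toConv (LinearMap.lTensorHom X ∘ₗ LinearMap.mul k A ∘ₗ antipode k)

variable (k A X) in
/-- `a` acts on `X ⊗ A` by `x ⊗ g ↦ x ⊗ g a`. -/
def rightMul : WithConv (A →ₗ[k] Module.End k (X ⊗[k] A)) :=
  toConv (LinearMap.lTensorHom X ∘ₗ (LinearMap.mul k A).flip)

/-- `a` acts on `X ⊗ A` through an action `ρ` on `X`. -/
def firstAct (ρ : WithConv (A →ₗ[k] Module.End k X)) :
    WithConv (A →ₗ[k] Module.End k (X ⊗[k] A)) :=
  toConv (LinearMap.rTensorHom A ∘ₗ ρ.ofConv)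

@[simp] theorem leftAntipode_tmul (a g : A) (x : X) :
    leftAntipode k A X a (x ⊗ₜ g) = x ⊗ₜ (antipode k a * g) := rfl

@[simp] theorem rightMul_tmul (a g : A) (x : X) : rightMul k A X a (x ⊗ₜ g) = x ⊗ₜ (g * a) := rfl

@[simp] theorem firstAct_tmul (ρ : WithConv (A →ₗ[k] Module.End k X)) (a g : A) (x : X) :
    firstAct ρ a (x ⊗ₜ g) = ρ a x ⊗ₜ g := rfl

theorem firstAct_mul (ρ σ : WithConv (A →ₗ[k] Module.End k X)) :
    firstAct (ρ * σ) = firstAct ρ * firstAct σ :=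
  ofConv_injective (LinearMap.algHom_comp_convMul_distrib (Module.End.rTensorAlgHom k X A) ρ σ)

/-- The action `x ⊗ g ↦ x · a₂ ⊗ S(a₁) g a₃` occurring in the Yetter-Drinfeld condition. It is a
threefold convolution product, which reduces its properties to those of the three factors. -/
def twist (ρ : WithConv (A →ₗ[k] Module.End k X)) : WithConv (A →ₗ[k] Module.End k (X ⊗[k] A)) :=
  leftAntipode k A X * firstAct ρ * rightMul k A X

section BialgHom

variable {H : Type*} [Semiring H] [HopfAlgebra k H] (φ : A →ₐc[k] H)

theorem convComp_mul {R : Type*} [Semiring R] [Algebra k R] (f g : WithConv (H →ₗ[k] R)) :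
    convComp (φ : A →ₗ[k] H) (f * g) =
      convComp (φ : A →ₗ[k] H) f * convComp (φ : A →ₗ[k] H) g :=
  ofConv_injective (LinearMap.convMul_comp_coalgHom_distrib f g (φ : A →ₗc[k] H))

theorem intertwines_map_twist (f : X →ₗ[k] Y) {ρ : WithConv (A →ₗ[k] Module.End k X)}
    {σ : WithConv (H →ₗ[k] Module.End k Y)} (h : Intertwines f ρ (convComp (φ : A →ₗ[k] H) σ)) :
    Intertwines (TensorProduct.map f (φ : A →ₗ[k] H)) (twist ρ)
      (convComp (φ : A →ₗ[k] H) (twist σ)) := by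
  rw [twist, twist, convComp_mul, convComp_mul]
  refine .convMul (.convMul ?_ ?_) ?_ <;> refine fun a => TensorProduct.ext' fun x g => ?_
  · simp [antipode_bialgHom]
  · simpa using congrArg (· ⊗ₜ φ g) (h.apply a x)
  · simp

end BialgHom

theorem intertwines_rTensor_twist (f : X →ₗ[k] Y) {ρ : WithConv (A →ₗ[k] Module.End k X)}
    {σ : WithConv (A →ₗ[k] Module.End k Y)} (h : Intertwines f ρ σ) :
    Intertwines (f.rTensor A) (twist ρ) (twist σ) :=
  intertwines_map_twist (BialgHom.id k A) f h

theorem intertwines_comulSnd_leftAntipode : Intertwines (comulSnd k A X) (leftAntipode k A X)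
    (leftAntipode k A (X ⊗[k] A) * firstAct (leftAntipode k A X)) := by
  refine fun a => TensorProduct.ext' fun x g => ?_
  rw [(ℛ k a).convMul_apply]
  simp [comulSnd_tmul, Bialgebra.comul_mul, comul_antipode, ← (ℛ k a).eq, ← (ℛ k g).eq,
    Finset.sum_mul_sum]

theorem intertwines_comulSnd_rightMul : Intertwines (comulSnd k A X) (rightMul k A X)
    (firstAct (rightMul k A X) * rightMul k A (X ⊗[k] A)) := by
  refine fun a => TensorProduct.ext' fun x g => ?_
  rw [(ℛ k a).convMul_apply]
  simp [comulSnd_tmul, Bialgebra.comul_mul, ← (ℛ k a).eq, ← (ℛ k g).eq,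
    Finset.sum_mul_sum, Finset.sum_comm (s := (ℛ k a).index)]

theorem intertwines_comulSnd_twist (ρ : WithConv (A →ₗ[k] Module.End k X)) :
    Intertwines (comulSnd k A X) (twist ρ) (twist (twist ρ)) := by
  have twist_twist : twist (twist ρ) =
      leftAntipode k A (X ⊗[k] A) * firstAct (leftAntipode k A X) * firstAct (firstAct ρ) *
        (firstAct (rightMul k A X) * rightMul k A (X ⊗[k] A)) := by
    simp only [twist, firstAct_mul, mul_assoc]
  rw [twist_twist]
  refine .convMul (.convMul intertwines_comulSnd_leftAntipode fun a => ?_)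
    intertwines_comulSnd_rightMul
  refine TensorProduct.ext' fun x g => ?_
  simp [comulSnd_tmul, ← (ℛ k g).eq]

theorem intertwines_counit_twist (ρ : WithConv (A →ₗ[k] Module.End k X)) :
    Intertwines ((TensorProduct.rid k X).toLinearMap ∘ₗ counit.lTensor X) (twist ρ) ρ := by
  have h : Intertwines ((TensorProduct.rid k X).toLinearMap ∘ₗ counit.lTensor X) (twist ρ)
      (1 * ρ * 1) := by
    refine .convMul (.convMul ?_ ?_) ?_ <;> refine fun a => TensorProduct.ext' fun x g => ?_
    · simp [smul_smul, mul_comm]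
    · simp
    · simp [smul_smul, mul_comm]
  simpa using h

end Twist

section TwistModule

variable (k A V : Type u) [Field k] [Ring A] [HopfAlgebra k A] [AddCommGroup V] [Module k V]
  [Module Aᵐᵒᵖ V] [IsScalarTower k Aᵐᵒᵖ V]

/-- The right action of `A` on an `A`-module, in the convolution algebra. -/
def rightActHom : WithConv (A →ₗ[k] Module.End k V) :=
  WithConv.toConv
    { toFun := rightAct k A V
      map_add' := fun _ _ => by ext; simp [add_smul]
      map_smul' := fun _ _ => by ext; simp }

@[simp] theorem rightActHom_apply (a : A) (v : V) :
    rightActHom k A V a v = MulOpposite.op a • v := rfl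

theorem ydTwist_comul (a : A) :
    ydTwist k A V (Coalgebra.comul.rTensor A (Coalgebra.comul (R := k) a)) =
      twist (rightActHom k A V) a := by
  rw [twist, (Coalgebra.Repr.arbitrary k a).convMul_apply]
  nth_rw 1 [← (Coalgebra.Repr.arbitrary k a).eq]
  simp only [map_sum, LinearMap.rTensor_tmul]
  refine Finset.sum_congr rfl fun i _ => TensorProduct.ext' fun v g => ?_
  have h := Coalgebra.Repr.arbitrary k ((Coalgebra.Repr.arbitrary k a).left i)
  rw [h.convMul_apply, ← h.eq]
  simp [TensorProduct.sum_tmul, mul_assoc]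

variable {k A V}

theorem ydTwist_mul (s t : (A ⊗[k] A) ⊗[k] A) :
    ydTwist k A V (s * t) = ydTwist k A V t ∘ₗ ydTwist k A V s := by
  suffices h : (LinearMap.mul k ((A ⊗[k] A) ⊗[k] A)).compr₂ (ydTwist k A V) =
      (LinearMap.llcomp k _ _ _).flip.compl₁₂ (ydTwist k A V) (ydTwist k A V) from
    LinearMap.congr_fun₂ h s t
  ext
  simp [HopfAlgebra.antipode_mul_antidistrib, mul_assoc, mul_smul]

theorem twist_rightActHom_mul (a b : A) (z : V ⊗[k] A) :
    twist (rightActHom k A V) (a * b) z =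
      twist (rightActHom k A V) b (twist (rightActHom k A V) a z) := by
  have rTensor_mul : ∀ s t : A ⊗[k] A, (Coalgebra.comul (R := k)).rTensor A (s * t) =
      Coalgebra.comul.rTensor A s * Coalgebra.comul.rTensor A t :=
    map_mul (Algebra.TensorProduct.map (Bialgebra.comulAlgHom k A) (AlgHom.id k A))
  rw [← ydTwist_comul, ← ydTwist_comul, ← ydTwist_comul, Bialgebra.comul_mul, rTensor_mul,
    ydTwist_mul, LinearMap.comp_apply]

theorem twist_rightActHom_one (z : V ⊗[k] A) : twist (rightActHom k A V) 1 z = z := by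
  have h : ydTwist k A V ((1 ⊗ₜ 1) ⊗ₜ 1) = LinearMap.id := by
    ext
    simp
  rw [← ydTwist_comul, Bialgebra.comul_one, Algebra.TensorProduct.one_def, LinearMap.rTensor_tmul,
    Bialgebra.comul_one, Algebra.TensorProduct.one_def, h, LinearMap.id_apply]

end TwistModule

section Comodule

variable {k A H : Type u} [Field k] [AddCommGroup A] [Module k A] [Coalgebra k A]
  [AddCommGroup H] [Module k H] [Coalgebra k H]
  {V W U : Type u} [AddCommGroup V] [Module k V] [AddCommGroup W] [Module k W]
  [AddCommGroup U] [Module k U]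

namespace RightComodule

theorem rTensor_coact_comp_coact (c : RightComodule k A V) :
    c.coact.rTensor A ∘ₗ c.coact = comulSnd k A V ∘ₗ c.coact := by
  rw [comulSnd, LinearMap.comp_assoc, ← c.coassoc]
  ext v
  simp

theorem assoc_comp_rTensor_of_comulSnd {δ : V →ₗ[k] V ⊗[k] A}
    (h : δ.rTensor A ∘ₗ δ = comulSnd k A V ∘ₗ δ) :
    (TensorProduct.assoc k V A A).toLinearMap ∘ₗ δ.rTensor A ∘ₗ δ =
      Coalgebra.comul.lTensor V ∘ₗ δ := by
  rw [h, comulSnd]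
  ext v
  simp

/-- A linear map between comodules over different coalgebras is colinear along `φ` if it sends
the coaction of `V` to that of `W` when the coefficients are transported by `φ`. The usual colinear
maps are those with `φ = LinearMap.id`. -/
def IsColinear (φ : A →ₗ[k] H) (c : RightComodule k A V) (d : RightComodule k H W)
    (g : V →ₗ[k] W) : Prop :=
  ∀ v, d.coact (g v) = TensorProduct.map g φ (c.coact v)

theorem IsColinear.comp {B : Type u} [AddCommGroup B] [Module k B] [Coalgebra k B]
    {φ : A →ₗ[k] H} {ψ : H →ₗ[k] B} {c : RightComodule k A V} {d : RightComodule k H W}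
    {e : RightComodule k B U} {f : W →ₗ[k] U} {g : V →ₗ[k] W} (hf : IsColinear ψ d e f)
    (hg : IsColinear φ c d g) : IsColinear (ψ ∘ₗ φ) c e (f ∘ₗ g) := fun v => by
  rw [LinearMap.comp_apply, hf, hg, TensorProduct.map_map]

/-- The comodule over `H` obtained from a comodule over `A` along a morphism `A → H`. -/
@[reducible]
def push (φ : A →ₗc[k] H) (c : RightComodule k A V) : RightComodule k H V where
  coact := φ.toLinearMap.lTensor V ∘ₗ c.coact
  coassoc := by
    apply assoc_comp_rTensor_of_comulSnd
    have coact_rTensor : (φ.toLinearMap.lTensor V ∘ₗ c.coact).rTensor H ∘ₗ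
        φ.toLinearMap.lTensor V =
        TensorProduct.map (φ.toLinearMap.lTensor V) φ.toLinearMap ∘ₗ c.coact.rTensor A :=
      TensorProduct.ext' fun _ _ => rfl
    rw [← LinearMap.comp_assoc, coact_rTensor, LinearMap.comp_assoc, rTensor_coact_comp_coact,
      ← LinearMap.comp_assoc, ← LinearMap.comp_assoc]
    exact congrArg (· ∘ₗ c.coact) (comulSnd_comp_map LinearMap.id φ).symm
  counit_coact := by
    have h : Coalgebra.counit ∘ₗ φ.toLinearMap = Coalgebra.counit := φ.counit_comp
    rw [← LinearMap.comp_assoc c.coact, ← LinearMap.lTensor_comp, h, c.counit_coact]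

theorem isColinear_push (φ : A →ₗc[k] H) (c : RightComodule k A V) :
    IsColinear φ.toLinearMap c (c.push φ) LinearMap.id := fun _ => rfl

theorem IsColinear.of_push {φ : A →ₗc[k] H} {c : RightComodule k A V} {d : RightComodule k H W}
    {g : V →ₗ[k] W} (hg : IsColinear φ.toLinearMap c d g) :
    IsColinear LinearMap.id (c.push φ) d g := fun v => by
  change _ = TensorProduct.map g LinearMap.id (φ.toLinearMap.lTensor V (c.coact v))
  rw [hg, LinearMap.lTensor, TensorProduct.map_map, LinearMap.comp_id, LinearMap.id_comp]

end RightComodule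

end Comodule

namespace YetterDrinfeld

open RightComodule

variable {k A H : Type u} [Field k] [Ring A] [HopfAlgebra k A] [Ring H] [HopfAlgebra k H]

theorem coact_act (X : YetterDrinfeld k A) (a : A) (v : X) :
    X.coact (MulOpposite.op a • v) = twist (rightActHom k A X) a (X.coact v) := by
  rw [← ydTwist_comul]
  exact X.compat v a

theorem Hom.congr_fun {X Y : YetterDrinfeld k A} {f g : X ⟶ Y} (h : f = g) (v : X) :
    f.toLin v = g.toLin v := by
  rw [h]

theorem sub_toLin {X Y : YetterDrinfeld k A} (f g : X ⟶ Y) (v : X) :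
    (f - g).toLin v = f.toLin v - g.toLin v :=
  (sub_eq_add_neg (f.toLin v) (g.toLin v)).symm

section RelHom

/-- A map from a Yetter-Drinfeld module over `A` to one over `H` that is linear and colinear
along a bialgebra homomorphism `φ : A → H`. -/
structure RelHom (φ : A →ₐc[k] H) (X : YetterDrinfeld k A) (W : YetterDrinfeld k H) where
  toLin : X →ₗ[k] W
  map_act : ∀ (a : A) (v : X), toLin (MulOpposite.op a • v) = MulOpposite.op (φ a) • toLin v
  map_coact : IsColinear (φ : A →ₗ[k] H) X.comodule W.comodule toLin

namespace RelHom

variable {φ : A →ₐc[k] H} {X Y : YetterDrinfeld k A} {W W' : YetterDrinfeld k H}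

/-- The composition with a morphism over `H`. -/
@[simps toLin]
def comp (g : RelHom φ X W) (f : W ⟶ W') : RelHom φ X W' where
  toLin := f.toLin ∘ₗ g.toLin
  map_act a v := by simp [g.map_act, f.map_act]
  map_coact := IsColinear.comp (ψ := LinearMap.id) f.map_coact g.map_coact

/-- The composition with a morphism over `A`. -/
@[simps toLin]
def precomp (g : RelHom φ Y W) (f : X ⟶ Y) : RelHom φ X W where
  toLin := g.toLin ∘ₗ f.toLin
  map_act a v := by simp [g.map_act, f.map_act]
  map_coact := g.map_coact.comp (φ := LinearMap.id) f.map_coact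

/-- A map along the identity is a morphism. -/
@[simps toLin]
def toHom (g : RelHom (BialgHom.id k A) X Y) : X ⟶ Y :=
  Hom.mk g.toLin g.map_act g.map_coact

end RelHom

end RelHom

section Free

variable {V : Type u} [AddCommGroup V] [Module k V]

/-- The coaction `a ⊗ v ↦ a₂ ⊗ v₀ ⊗ S(a₁) v₁ a₃` on `A ⊗ V`. -/
def freeCoact (c : RightComodule k A V) : A ⊗[k] V →ₗ[k] (A ⊗[k] V) ⊗[k] A :=
  TensorProduct.lift
    (LinearMap.lcomp k _ ((TensorProduct.mk k A V 1).rTensor A ∘ₗ c.coact) ∘ₗ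
      (twist (rightActHom k A (A ⊗[k] V))).ofConv)

theorem freeCoact_tmul (c : RightComodule k A V) (a : A) (v : V) :
    freeCoact c (a ⊗ₜ v) = twist (rightActHom k A (A ⊗[k] V)) a
      ((TensorProduct.mk k A V 1).rTensor A (c.coact v)) := rfl

theorem freeCoact_comp_mk_one (c : RightComodule k A V) :
    freeCoact c ∘ₗ TensorProduct.mk k A V 1 =
      (TensorProduct.mk k A V 1).rTensor A ∘ₗ c.coact := by
  ext v
  exact (freeCoact_tmul c 1 v).trans (twist_rightActHom_one _)

theorem op_smul_tmul (a b : A) (v : V) : MulOpposite.op a • (b ⊗ₜ[k] v) = (b * a) ⊗ₜ v := rfl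

theorem tmul_eq_op_smul (a : A) (v : V) :
    a ⊗ₜ[k] v = MulOpposite.op a • TensorProduct.mk k A V 1 v := by
  rw [TensorProduct.mk_apply, op_smul_tmul, one_mul]

theorem intertwines_freeCoact (c : RightComodule k A V) :
    Intertwines (freeCoact c) (rightActHom k A (A ⊗[k] V))
      (twist (rightActHom k A (A ⊗[k] V))) := by
  refine fun a => TensorProduct.ext' fun b v => ?_
  simp only [LinearMap.comp_apply, rightActHom_apply, op_smul_tmul, freeCoact_tmul,
    twist_rightActHom_mul]

theorem rTensor_freeCoact_comp_freeCoact (c : RightComodule k A V) :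
    (freeCoact c).rTensor A ∘ₗ freeCoact c = comulSnd k A (A ⊗[k] V) ∘ₗ freeCoact c := by
  refine TensorProduct.ext' fun a v => ?_
  have one_tmul : (freeCoact c).rTensor A ∘ₗ (TensorProduct.mk k A V 1).rTensor A ∘ₗ c.coact =
      comulSnd k A (A ⊗[k] V) ∘ₗ (TensorProduct.mk k A V 1).rTensor A ∘ₗ c.coact := by
    have h := comulSnd_comp_map (TensorProduct.mk k A V 1) (CoalgHom.id k A)
    rw [← LinearMap.comp_assoc, ← LinearMap.rTensor_comp, freeCoact_comp_mk_one,
      LinearMap.rTensor_comp, LinearMap.comp_assoc, rTensor_coact_comp_coact,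
      ← LinearMap.comp_assoc, ← LinearMap.comp_assoc]
    exact congrArg (· ∘ₗ c.coact) h.symm
  rw [LinearMap.comp_apply, LinearMap.comp_apply, freeCoact_tmul,
    (intertwines_rTensor_twist _ (intertwines_freeCoact c)).apply,
    (intertwines_comulSnd_twist _).apply]
  exact congrArg _ (LinearMap.congr_fun one_tmul v)

theorem rid_counit_comp_freeCoact (c : RightComodule k A V) :
    (TensorProduct.rid k (A ⊗[k] V)).toLinearMap ∘ₗ Coalgebra.counit.lTensor (A ⊗[k] V) ∘ₗ
      freeCoact c = LinearMap.id := by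
  refine TensorProduct.ext' fun a v => ?_
  have h := (intertwines_counit_twist (rightActHom k A (A ⊗[k] V))).apply a
    ((TensorProduct.mk k A V 1).rTensor A (c.coact v))
  refine h.trans ?_
  let := c
  rw [LinearMap.comp_apply, LinearEquiv.coe_coe, ← rid_counit, counit_coact_apply,
    rightActHom_apply, ← tmul_eq_op_smul, LinearMap.id_apply]

/-- The free Yetter-Drinfeld module `A ⊗ V` on a comodule `V`. -/
def free (c : RightComodule k A V) : YetterDrinfeld k A where
  carrier := A ⊗[k] V
  comodule :=
    { coact := freeCoact c
      coassoc := assoc_comp_rTensor_of_comulSnd (rTensor_freeCoact_comp_freeCoact c)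
      counit_coact := rid_counit_comp_freeCoact c }
  compat v a := by
    rw [ydTwist_comul]
    exact (intertwines_freeCoact c).apply a v

/-- The colinear map `v ↦ 1 ⊗ v`, through which colinear maps from `V` extend to `free c`. -/
def freeUnit (c : RightComodule k A V) : V →ₗ[k] free c := TensorProduct.mk k A V 1

theorem isColinear_freeUnit (c : RightComodule k A V) :
    IsColinear LinearMap.id c (free c).comodule (freeUnit c) :=
  LinearMap.congr_fun (freeCoact_comp_mk_one c)

variable {N : Type u} [AddCommGroup N] [Module k N]

/-- The linear map `a ⊗ v ↦ L a v`. -/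
def freeLin (c : RightComodule k A V) (L : A →ₗ[k] V →ₗ[k] N) : free c →ₗ[k] N :=
  TensorProduct.lift L

theorem freeLin_smul_unit (c : RightComodule k A V) (L : A →ₗ[k] V →ₗ[k] N) (a : A) (v : V) :
    freeLin c L (MulOpposite.op a • freeUnit c v) = L a v := by
  refine (congrArg (freeLin c L) (tmul_eq_op_smul a v).symm).trans ?_
  exact TensorProduct.lift.tmul a v

theorem free_linearMap_ext {c : RightComodule k A V} {f g : free c →ₗ[k] N}
    (h : ∀ (a : A) v, f (MulOpposite.op a • freeUnit c v) = g (MulOpposite.op a • freeUnit c v)) :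
    f = g :=
  TensorProduct.ext' fun a v => by
    rw [tmul_eq_op_smul]
    exact h a v

theorem free_hom_ext {c : RightComodule k A V} {X : YetterDrinfeld k A} {f g : free c ⟶ X}
    (h : ∀ v, f.toLin (freeUnit c v) = g.toLin (freeUnit c v)) : f = g :=
  Hom.ext (free_linearMap_ext fun a v => by rw [f.map_act, g.map_act, h])

theorem isColinear_of_comp_freeUnit {φ : A →ₐc[k] H} {c : RightComodule k A V}
    {W : YetterDrinfeld k H} {g : free c →ₗ[k] W}
    (hact : ∀ a x, g (MulOpposite.op a • x) = MulOpposite.op (φ a) • g x)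
    (hunit : IsColinear (φ : A →ₗ[k] H) c W.comodule (g ∘ₗ freeUnit c)) :
    IsColinear (φ : A →ₗ[k] H) (free c).comodule W.comodule g := by
  refine LinearMap.congr_fun (free_linearMap_ext (f := W.coact ∘ₗ g)
    (g := TensorProduct.map g (φ : A →ₗ[k] H) ∘ₗ (free c).coact) fun a v => ?_)
  have h : Intertwines g (rightActHom k A (free c))
      (convComp (φ : A →ₗ[k] H) (rightActHom k H W)) :=
    fun a => LinearMap.ext (hact a)
  have hv : W.coact (g (freeUnit c v)) =
      TensorProduct.map g (φ : A →ₗ[k] H) ((free c).coact (freeUnit c v)) := by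
    rw [isColinear_freeUnit, TensorProduct.map_map]
    exact hunit v
  rw [LinearMap.comp_apply, LinearMap.comp_apply, hact, coact_act, coact_act,
    (intertwines_map_twist φ g h).apply, hv]
  rfl

/-- The linear map `a ⊗ v ↦ g v · φ a`. -/
def extend (φ : A →ₐc[k] H) (c : RightComodule k A V) {W : YetterDrinfeld k H} (g : V →ₗ[k] W) :
    free c →ₗ[k] W :=
  freeLin c (LinearMap.lcomp k W g ∘ₗ (convComp (φ : A →ₗ[k] H) (rightActHom k H W)).ofConv)

theorem extend_smul_unit (φ : A →ₐc[k] H) (c : RightComodule k A V) {W : YetterDrinfeld k H}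
    (g : V →ₗ[k] W) (a : A) (v : V) :
    extend φ c g (MulOpposite.op a • freeUnit c v) = MulOpposite.op (φ a) • g v :=
  freeLin_smul_unit c _ a v

theorem extend_unit (φ : A →ₐc[k] H) (c : RightComodule k A V) {W : YetterDrinfeld k H}
    (g : V →ₗ[k] W) (v : V) : extend φ c g (freeUnit c v) = g v := by
  simpa using extend_smul_unit φ c g 1 v

theorem extend_act (φ : A →ₐc[k] H) (c : RightComodule k A V) {W : YetterDrinfeld k H}
    (g : V →ₗ[k] W) (a : A) (x : free c) :
    extend φ c g (MulOpposite.op a • x) = MulOpposite.op (φ a) • extend φ c g x := by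
  have h : extend φ c g ∘ₗ rightAct k A (free c) a =
      rightAct k H W (φ a) ∘ₗ extend φ c g := free_linearMap_ext fun b v => by
    have hv := extend_smul_unit φ c g (b * a) v
    rw [map_mul, MulOpposite.op_mul, mul_smul, MulOpposite.op_mul, mul_smul,
      ← extend_smul_unit] at hv
    exact hv
  exact LinearMap.congr_fun h x

/-- The map from the free module extending a colinear map. -/
@[simps toLin]
def relFree {φ : A →ₐc[k] H} {c : RightComodule k A V} {W : YetterDrinfeld k H} {g : V →ₗ[k] W}
    (hg : IsColinear (φ : A →ₗ[k] H) c W.comodule g) : RelHom φ (free c) W where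
  toLin := extend φ c g
  map_act := extend_act φ c g
  map_coact := isColinear_of_comp_freeUnit (extend_act φ c g) (by
    rwa [LinearMap.ext (extend_unit φ c g) (f := extend φ c g ∘ₗ freeUnit c)])

/-- The morphism from the free module extending a colinear map. -/
def freeHom {c : RightComodule k A V} {X : YetterDrinfeld k A} {g : V →ₗ[k] X}
    (hg : IsColinear LinearMap.id c X.comodule g) : free c ⟶ X :=
  (relFree (φ := BialgHom.id k A) hg).toHom

theorem freeHom_smul_unit {c : RightComodule k A V} {X : YetterDrinfeld k A} {g : V →ₗ[k] X}
    (hg : IsColinear LinearMap.id c X.comodule g) (a : A) (v : V) :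
    (freeHom hg).toLin (MulOpposite.op a • freeUnit c v) = MulOpposite.op a • g v :=
  extend_smul_unit (BialgHom.id k A) c g a v

theorem freeHom_unit {c : RightComodule k A V} {X : YetterDrinfeld k A} {g : V →ₗ[k] X}
    (hg : IsColinear LinearMap.id c X.comodule g) (v : V) :
    (freeHom hg).toLin (freeUnit c v) = g v :=
  extend_unit (BialgHom.id k A) c g v

/-- The canonical morphism to `X` from the free module on the comodule underlying `X`. -/
def freeCounit (X : YetterDrinfeld k A) : free X.comodule ⟶ X :=
  freeHom (g := LinearMap.id) fun v => by rw [TensorProduct.map_id]; rfl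

theorem freeCounit_unit (X : YetterDrinfeld k A) (v : X) :
    (freeCounit X).toLin (freeUnit X.comodule v) = v :=
  freeHom_unit _ v

theorem freeCounit_surjective (X : YetterDrinfeld k A) :
    Function.Surjective (freeCounit X).toLin :=
  fun x => ⟨_, freeCounit_unit X x⟩

end Free

section Induced

variable (φ : A →ₐc[k] H)

/-- The free module over `H` on the comodule underlying a Yetter-Drinfeld module over `A`. -/
abbrev freeOver (X : YetterDrinfeld k A) : YetterDrinfeld k H :=
  free (X.comodule.push (φ : A →ₗc[k] H))

theorem isColinear_freeOver_unit (X : YetterDrinfeld k A) :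
    IsColinear (φ : A →ₗ[k] H) X.comodule (freeOver φ X).comodule (freeUnit _) :=
  (isColinear_freeUnit _).comp (isColinear_push (φ : A →ₗc[k] H) X.comodule)

/-- The morphism `h ⊗ (a ⊗ v) ↦ h ⊗ v · a - φ a h ⊗ v`, whose cokernel is `X ⊗_A H`. -/
def relatorHom (X : YetterDrinfeld k A) : freeOver φ (free X.comodule) ⟶ freeOver φ X :=
  freeHom (((isColinear_freeOver_unit φ X).comp (φ := LinearMap.id)
      (freeCounit X).map_coact).of_push) -
    freeHom (relFree (isColinear_freeOver_unit φ X)).map_coact.of_push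

theorem relatorHom_apply (X : YetterDrinfeld k A) (h : H) (a : A) (v : X) :
    (relatorHom φ X).toLin
        (MulOpposite.op h • freeUnit _ (MulOpposite.op a • freeUnit X.comodule v)) =
      MulOpposite.op h • freeUnit _ (MulOpposite.op a • v) -
        MulOpposite.op (φ a * h) • freeUnit (X.comodule.push (φ : A →ₗc[k] H)) v := by
  refine (sub_toLin _ _ _).trans ((congrArg₂ (· - ·) (freeHom_smul_unit _ h _)
    (freeHom_smul_unit _ h _)).trans ?_)
  rw [LinearMap.comp_apply, (freeCounit X).map_act, freeCounit_unit, relFree_toLin,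
    extend_smul_unit, MulOpposite.op_mul, mul_smul]

/-- The Yetter-Drinfeld module `X ⊗_A H` over `H` induced by a Yetter-Drinfeld module `X`
over `A`. -/
def ind (X : YetterDrinfeld k A) : YetterDrinfeld k H :=
  coker (relatorHom φ X)

/-- The projection `h ⊗ v ↦ v ⊗ h`. -/
def indπ (X : YetterDrinfeld k A) : freeOver φ X ⟶ ind φ X :=
  cokerπ (relatorHom φ X)

theorem indπ_surjective (X : YetterDrinfeld k A) : Function.Surjective (indπ φ X).toLin :=
  cokerπ_surjective _

/-- The canonical map `v ↦ v ⊗ 1`. -/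
def indUnit (X : YetterDrinfeld k A) : RelHom φ X (ind φ X) where
  toLin := (indπ φ X).toLin ∘ₗ freeUnit _
  map_act a v := by
    have comp_indπ : relatorHom φ X ≫ indπ φ X = 0 := comp_cokerπ _
    have h := Hom.congr_fun comp_indπ
      (MulOpposite.op (1 : H) • freeUnit _ (MulOpposite.op a • freeUnit X.comodule v))
    rw [comp_toLin, relatorHom_apply, map_sub] at h
    rw [LinearMap.comp_apply, LinearMap.comp_apply, ← (indπ φ X).map_act]
    simpa using sub_eq_zero.1 h
  map_coact := IsColinear.comp (ψ := LinearMap.id) (indπ φ X).map_coact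
    (isColinear_freeOver_unit φ X)

theorem indπ_smul_unit (X : YetterDrinfeld k A) (h : H) (v : X) :
    (indπ φ X).toLin (MulOpposite.op h • freeUnit _ v) =
      MulOpposite.op h • (indUnit φ X).toLin v :=
  (indπ φ X).map_act h _

variable {φ}

theorem ind_linearMap_ext {X : YetterDrinfeld k A} {N : Type u} [AddCommGroup N] [Module k N]
    {f g : ind φ X →ₗ[k] N}
    (h : ∀ (h : H) v, f (MulOpposite.op h • (indUnit φ X).toLin v) =
      g (MulOpposite.op h • (indUnit φ X).toLin v)) : f = g := by
  rw [← LinearMap.cancel_right (indπ_surjective φ X)]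
  refine free_linearMap_ext fun a v => ?_
  rw [LinearMap.comp_apply, LinearMap.comp_apply, indπ_smul_unit]
  exact h a v

theorem ind_hom_ext {X : YetterDrinfeld k A} {W : YetterDrinfeld k H} {f g : ind φ X ⟶ W}
    (h : ∀ v, f.toLin ((indUnit φ X).toLin v) = g.toLin ((indUnit φ X).toLin v)) : f = g :=
  Hom.ext (ind_linearMap_ext fun a v => by rw [f.map_act, g.map_act, h])

theorem freeLin_comp_relatorHom {X : YetterDrinfeld k A} {N : Type u} [AddCommGroup N]
    [Module k N] {L : H →ₗ[k] X →ₗ[k] N}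
    (hL : ∀ h a v, L h (MulOpposite.op a • v) = L (φ a * h) v) :
    freeLin (X.comodule.push (φ : A →ₗc[k] H)) L ∘ₗ (relatorHom φ X).toLin = 0 := by
  refine free_linearMap_ext fun h y => ?_
  suffices hy : freeLin _ L ∘ₗ (relatorHom φ X).toLin ∘ₗ rightAct k H _ h ∘ₗ freeUnit _ = 0 from
    LinearMap.congr_fun hy y
  refine free_linearMap_ext fun a v => ?_
  refine (congrArg (freeLin _ L) (relatorHom_apply φ X h a v)).trans ?_
  rw [map_sub, freeLin_smul_unit, freeLin_smul_unit, hL, sub_self, LinearMap.zero_apply]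

theorem exists_indLin {X : YetterDrinfeld k A} {N : Type u} [AddCommGroup N] [Module k N]
    (L : H →ₗ[k] X →ₗ[k] N) (hL : ∀ h a v, L h (MulOpposite.op a • v) = L (φ a * h) v) :
    ∃ l : ind φ X →ₗ[k] N, ∀ h v, l (MulOpposite.op h • (indUnit φ X).toLin v) = L h v := by
  obtain ⟨l, hl⟩ := exists_desc (indπ φ X).toLin (indπ_surjective φ X)
    (freeLin (X.comodule.push (φ : A →ₗc[k] H)) L) (by
      intro x hx
      obtain ⟨y, rfl⟩ := mem_range_of_cokerπ (relatorHom φ X) x hx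
      exact LinearMap.congr_fun (freeLin_comp_relatorHom hL) y)
  refine ⟨l, fun h v => ?_⟩
  rw [← indπ_smul_unit, ← freeLin_smul_unit _ L, ← hl, LinearMap.comp_apply]

theorem relatorHom_comp_freeHom {X : YetterDrinfeld k A} {W : YetterDrinfeld k H}
    (g : RelHom φ X W) : relatorHom φ X ≫ freeHom g.map_coact.of_push = 0 := by
  refine Hom.ext (freeLin_comp_relatorHom fun h a v => ?_)
  change MulOpposite.op h • g.toLin _ = MulOpposite.op (φ a * h) • g.toLin v
  rw [g.map_act, MulOpposite.op_mul, mul_smul]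

/-- The morphism from the induced module given by a map over `A`. -/
def indLift {X : YetterDrinfeld k A} {W : YetterDrinfeld k H} (g : RelHom φ X W) :
    ind φ X ⟶ W :=
  descOfSurjective (indπ φ X) (indπ_surjective φ X) (freeHom g.map_coact.of_push) (by
    intro x hx
    obtain ⟨y, rfl⟩ := mem_range_of_cokerπ (relatorHom φ X) x hx
    exact Hom.congr_fun (relatorHom_comp_freeHom g) y)

theorem indLift_unit {X : YetterDrinfeld k A} {W : YetterDrinfeld k H} (g : RelHom φ X W) (v : X) :
    (indLift g).toLin ((indUnit φ X).toLin v) = g.toLin v := by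
  have h : indπ φ X ≫ indLift g = freeHom g.map_coact.of_push := comp_descOfSurjective _ _ _ _
  exact (Hom.congr_fun h (freeUnit _ v)).trans (freeHom_unit _ v)

variable (φ) in
/-- Induction on morphisms. -/
def indMap {X Y : YetterDrinfeld k A} (f : X ⟶ Y) : ind φ X ⟶ ind φ Y :=
  indLift ((indUnit φ Y).precomp f)

theorem indMap_unit {X Y : YetterDrinfeld k A} (f : X ⟶ Y) (v : X) :
    (indMap φ f).toLin ((indUnit φ X).toLin v) = (indUnit φ Y).toLin (f.toLin v) :=
  indLift_unit _ v

end Induced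

end YetterDrinfeld

section Coseparable

open Coalgebra RightComodule

section Contract

variable {k C X Y : Type u} [Field k] [AddCommGroup C] [Module k C] [AddCommGroup X] [Module k X]
  [AddCommGroup Y] [Module k Y]

variable (X) in
/-- The contraction `(x ⊗ c) ⊗ d ↦ D (c ⊗ d) x` against a bilinear form. -/
def contract (D : C ⊗[k] C →ₗ[k] k) : (X ⊗[k] C) ⊗[k] C →ₗ[k] X :=
  (TensorProduct.rid k X).toLinearMap ∘ₗ D.lTensor X ∘ₗ (TensorProduct.assoc k X C C).toLinearMap

@[simp] theorem contract_tmul (D : C ⊗[k] C →ₗ[k] k) (x : X) (c d : C) :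
    contract X D ((x ⊗ₜ c) ⊗ₜ d) = D (c ⊗ₜ d) • x := rfl

theorem comp_contract (D : C ⊗[k] C →ₗ[k] k) (t : X →ₗ[k] Y) :
    t ∘ₗ contract X D = contract Y D ∘ₗ (t.rTensor C).rTensor C :=
  TensorProduct.ext_threefold fun x c d => by simp

end Contract

variable {k C : Type u} [Field k] [AddCommGroup C] [Module k C] [Coalgebra k C]

/-- A bilinear form exhibiting `C` as a coseparable coalgebra: `c₁ D(c₂, d) = D(c, d₁) d₂` and
`D(c₁, c₂) = ε(c)`. -/
structure IsCoseparabilityForm (D : C ⊗[k] C →ₗ[k] k) : Prop where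
  apply_comul : ∀ c, D (comul c) = counit c
  balanced : contract C D ∘ₗ comul.rTensor C =
    (TensorProduct.lid k C).toLinearMap ∘ₗ D.rTensor C ∘ₗ comulSnd k C C

variable {D : C ⊗[k] C →ₗ[k] k}

section Module

variable {X : Type u} [AddCommGroup X] [Module k X]

theorem IsCoseparabilityForm.contract_comp_comulSnd (hD : IsCoseparabilityForm D) :
    contract X D ∘ₗ comulSnd k C X =
      (TensorProduct.rid k X).toLinearMap ∘ₗ counit.lTensor X := by
  refine TensorProduct.ext' fun x c => ?_
  simp [contract, comulSnd, hD.apply_comul]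

theorem IsCoseparabilityForm.contract_comp_rTensor_comulSnd (hD : IsCoseparabilityForm D) :
    contract (X ⊗[k] C) D ∘ₗ (comulSnd k C X).rTensor C =
      (contract X D).rTensor C ∘ₗ comulSnd k C (X ⊗[k] C) := by
  refine TensorProduct.ext_threefold fun x c d => ?_
  have h := congrArg (x ⊗ₜ[k] ·) (LinearMap.congr_fun hD.balanced (c ⊗ₜ d))
  simp only [LinearMap.comp_apply, LinearMap.rTensor_tmul, comulSnd_tmul] at h ⊢
  simpa [← (ℛ k c).eq, ← (ℛ k d).eq, TensorProduct.sum_tmul, TensorProduct.tmul_sum,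
    TensorProduct.smul_tmul] using h

end Module

variable {V W W' : Type u} [AddCommGroup V] [Module k V] [AddCommGroup W]
  [Module k W] [AddCommGroup W'] [Module k W']

/-- The linear map `v ↦ D(f(v₀)₁, v₁) f(v₀)₀`, an averaging of `f`. -/
def average (D : C ⊗[k] C →ₗ[k] k) (c : RightComodule k C V) (d : RightComodule k C W)
    (f : V →ₗ[k] W) : V →ₗ[k] W :=
  contract W D ∘ₗ (d.coact ∘ₗ f).rTensor C ∘ₗ c.coact

theorem IsCoseparabilityForm.isColinear_average (hD : IsCoseparabilityForm D)
    (c : RightComodule k C V) (d : RightComodule k C W) (f : V →ₗ[k] W) :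
    IsColinear LinearMap.id c d (average D c d f) := by
  have comulSnd_rTensor : comulSnd k C (W ⊗[k] C) ∘ₗ (d.coact ∘ₗ f).rTensor C =
      ((d.coact ∘ₗ f).rTensor C).rTensor C ∘ₗ comulSnd k C V :=
    comulSnd_comp_map (d.coact ∘ₗ f) (CoalgHom.id k C)
  refine LinearMap.congr_fun (f := d.coact ∘ₗ average D c d f)
    (g := (average D c d f).rTensor C ∘ₗ c.coact) ?_
  calc d.coact ∘ₗ average D c d f
    _ = contract (W ⊗[k] C) D ∘ₗ (d.coact.rTensor C ∘ₗ d.coact ∘ₗ f).rTensor C ∘ₗ c.coact := by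
        rw [average, ← LinearMap.comp_assoc, comp_contract, LinearMap.comp_assoc,
          ← LinearMap.comp_assoc c.coact, ← LinearMap.rTensor_comp]
    _ = (contract W D).rTensor C ∘ₗ comulSnd k C (W ⊗[k] C) ∘ₗ (d.coact ∘ₗ f).rTensor C ∘ₗ
          c.coact := by
        rw [← LinearMap.comp_assoc f, rTensor_coact_comp_coact, LinearMap.comp_assoc f,
          LinearMap.rTensor_comp, LinearMap.comp_assoc, ← LinearMap.comp_assoc,
          hD.contract_comp_rTensor_comulSnd, LinearMap.comp_assoc]
    _ = (contract W D).rTensor C ∘ₗ ((d.coact ∘ₗ f).rTensor C).rTensor C ∘ₗ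
          c.coact.rTensor C ∘ₗ c.coact := by
        rw [rTensor_coact_comp_coact, ← LinearMap.comp_assoc c.coact, comulSnd_rTensor,
          LinearMap.comp_assoc]
    _ = (average D c d f).rTensor C ∘ₗ c.coact := by
        simp only [average, LinearMap.rTensor_comp, LinearMap.comp_assoc]

theorem comp_average (c : RightComodule k C V) {d : RightComodule k C W}
    {d' : RightComodule k C W'} {p : W →ₗ[k] W'} (hp : IsColinear LinearMap.id d d' p)
    (f : V →ₗ[k] W) : p ∘ₗ average D c d f = average D c d' (p ∘ₗ f) := by
  have h : p.rTensor C ∘ₗ d.coact = d'.coact ∘ₗ p :=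
    (LinearMap.ext (f := d'.coact ∘ₗ p) (g := p.rTensor C ∘ₗ d.coact) hp).symm
  rw [average, ← LinearMap.comp_assoc, comp_contract, LinearMap.comp_assoc,
    ← LinearMap.comp_assoc c.coact, ← LinearMap.rTensor_comp, ← LinearMap.comp_assoc f, h]
  rfl

theorem IsCoseparabilityForm.average_of_isColinear (hD : IsCoseparabilityForm D)
    {c : RightComodule k C V} {d : RightComodule k C W} {g : V →ₗ[k] W}
    (hg : IsColinear LinearMap.id c d g) : average D c d g = g := by
  have average_id : average D c c LinearMap.id = LinearMap.id := by
    rw [average, LinearMap.comp_id, rTensor_coact_comp_coact, ← LinearMap.comp_assoc,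
      hD.contract_comp_comulSnd]
    exact c.counit_coact
  rw [← LinearMap.comp_id g, ← comp_average c hg, average_id]

theorem IsCoseparabilityForm.exists_colinear_lift (hD : IsCoseparabilityForm D)
    (c : RightComodule k C V) {d : RightComodule k C W} {d' : RightComodule k C W'}
    {p : W →ₗ[k] W'} (hp : IsColinear LinearMap.id d d' p) (hsurj : Function.Surjective p)
    {g : V →ₗ[k] W'} (hg : IsColinear LinearMap.id c d' g) :
    ∃ f : V →ₗ[k] W, IsColinear LinearMap.id c d f ∧ p ∘ₗ f = g := by
  obtain ⟨f, hf⟩ := Module.projective_lifting_property p g hsurj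
  exact ⟨average D c d f, hD.isColinear_average c d f,
    by rw [comp_average c hp, hf, hD.average_of_isColinear hg]⟩

end Coseparable

section Haar

open Coalgebra HopfAlgebra WithConv

/-- A normalized two-sided invariant functional on a bialgebra. -/
structure IsHaar {k A : Type u} [Field k] [Ring A] [Bialgebra k A] (h : A →ₗ[k] k) : Prop where
  map_one : h 1 = 1
  apply_snd : ∀ a, TensorProduct.rid k A (h.lTensor A (comul a)) = h a • (1 : A)
  apply_fst : ∀ a, TensorProduct.lid k A (h.rTensor A (comul a)) = h a • (1 : A)

variable {k A : Type u} [Field k] [Ring A] [HopfAlgebra k A]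

/-- The bilinear form `y ⊗ g ↦ h(y S(g))`. -/
def haarForm (h : A →ₗ[k] k) : A ⊗[k] A →ₗ[k] k :=
  h ∘ₗ LinearMap.mul' k A ∘ₗ (antipode k).lTensor A

theorem haarForm_tmul (h : A →ₗ[k] k) (y g : A) :
    haarForm h (y ⊗ₜ g) = h (y * antipode k g) := rfl

/-- Both sides of `y₁ h(y₂ S(g)) = h(y S(g₁)) g₂` have the same convolution product with the
antipode as functions of `g`, by invariance of `h` at `y S(g)`. -/
theorem IsHaar.haarForm_balanced {h : A →ₗ[k] k} (hh : IsHaar h) :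
    contract A (haarForm h) ∘ₗ comul.rTensor A =
      (TensorProduct.lid k A).toLinearMap ∘ₗ (haarForm h).rTensor A ∘ₗ comulSnd k A A := by
  refine TensorProduct.ext' fun y g => ?_
  let F : WithConv (A →ₗ[k] A) :=
    toConv (contract A (haarForm h) ∘ₗ TensorProduct.mk k (A ⊗[k] A) A (comul y))
  let P : WithConv (A →ₗ[k] A) :=
    toConv (LinearMap.toSpanSingleton k A 1 ∘ₗ haarForm h ∘ₗ TensorProduct.mk k A A y)
  have mul_antipode : F * toConv (antipode k) = P := by
    ext g
    have hP : P g = h (y * antipode k g) • (1 : A) := rfl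
    rw [hP, ← hh.apply_snd, Bialgebra.comul_mul, comul_antipode, (ℛ k g).convMul_apply]
    simp [F, ← (ℛ k g).eq, ← (ℛ k y).eq, haarForm_tmul, Finset.mul_sum,
      Finset.sum_mul, Finset.sum_comm (s := (ℛ k g).index)]
  have F_eq : F = P * toConv LinearMap.id := by
    rw [← mul_antipode, mul_assoc, LinearMap.antipode_mul_id, mul_one]
  refine (LinearMap.congr_fun (congrArg ofConv F_eq) g).trans ?_
  rw [LinearMap.comp_apply, LinearMap.comp_apply, comulSnd_tmul]
  refine ((ℛ k g).convMul_apply P (toConv LinearMap.id)).trans ?_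
  simp [P, ← (ℛ k g).eq]

theorem IsHaar.isCoseparabilityForm {h : A →ₗ[k] k} (hh : IsHaar h) :
    IsCoseparabilityForm (haarForm h) where
  apply_comul a := by
    simp [haarForm, mul_antipode_lTensor_comul_apply, Algebra.algebraMap_eq_smul_one, hh.map_one]
  balanced := hh.haarForm_balanced

end Haar

namespace YetterDrinfeld

open RightComodule

variable {k A H : Type u} [Field k] [Ring A] [HopfAlgebra k A] [Ring H] [HopfAlgebra k H]

section Exactness

variable {X Y : YetterDrinfeld k A}

theorem mono_of_injective (f : X ⟶ Y) (hf : Function.Injective f.toLin) : Mono f :=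
  ⟨fun _ _ e => hom_ext fun v => hf (Hom.congr_fun e v)⟩

theorem epi_of_surjective (f : X ⟶ Y) (hf : Function.Surjective f.toLin) : Epi f :=
  ⟨fun _ _ e => hom_ext (hf.forall.2 fun v => Hom.congr_fun e v)⟩

theorem ker_shortExact (p : X ⟶ Y) (hp : Function.Surjective p.toLin) :
    (ShortComplex.mk (kerι p) p (kerι_comp p)).ShortExact :=
  ShortComplex.ShortExact.mk' (ShortComplex.exact_of_f_is_kernel _
    (isLimitOfInjective _ (kerι_injective _) _ (kerι_comp _) (mem_range_kerι _)))
    (mono_of_injective _ (kerι_injective _)) (epi_of_surjective p hp)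

theorem mem_range_of_exact {S : ShortComplex (YetterDrinfeld k A)} (hS : S.ShortExact) {x : S.X₂}
    (hx : S.g.toLin x = 0) : x ∈ LinearMap.range S.f.toLin := by
  have := hS.mono_f
  obtain ⟨z, rfl⟩ := mem_range_kerι S.g x hx
  have h : hS.exact.lift (kerι S.g) (kerι_comp S.g) ≫ S.f = kerι S.g := hS.exact.lift_f _ _
  exact ⟨_, Hom.congr_fun h z⟩

theorem RelHom.exists_desc {φ : A →ₐc[k] H} {W : YetterDrinfeld k H} (p : X ⟶ Y)
    (hp : Function.Surjective p.toLin) (g : RelHom φ X W)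
    (h : ∀ x, p.toLin x = 0 → g.toLin x = 0) :
    ∃ t : RelHom φ Y W, ∀ x, t.toLin (p.toLin x) = g.toLin x := by
  obtain ⟨l, hl⟩ := YetterDrinfeld.exists_desc p.toLin hp g.toLin h
  have l_apply : ∀ x, l (p.toLin x) = g.toLin x := LinearMap.congr_fun hl
  refine ⟨⟨l, fun a => hp.forall.2 fun v => ?_, hp.forall.2 fun v => ?_⟩, l_apply⟩
  · rw [← p.map_act, l_apply, l_apply, g.map_act]
  · rw [l_apply, p.map_coact, g.map_coact, LinearMap.rTensor, TensorProduct.map_map, hl,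
      LinearMap.comp_id]

end Exactness

section Projective

theorem projective_free {h : A →ₗ[k] k} (hh : IsHaar h) {V : Type u} [AddCommGroup V]
    [Module k V] (c : RightComodule k A V) : Projective (free c) := by
  refine ⟨fun {W W'} g p _ => ?_⟩
  obtain ⟨f, hf, hpf⟩ := hh.isCoseparabilityForm.exists_colinear_lift c (d := W.comodule)
    (d' := W'.comodule) p.map_coact (surjective_of_epi p)
    (IsColinear.comp (φ := LinearMap.id) (ψ := LinearMap.id) g.map_coact (isColinear_freeUnit c))
  refine ⟨freeHom hf, free_hom_ext fun v => ?_⟩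
  exact (congrArg p.toLin (freeHom_unit hf v)).trans (LinearMap.congr_fun hpf v)

variable (φ : A →ₐc[k] H)

theorem indMap_zero (X Y : YetterDrinfeld k A) : indMap φ (0 : X ⟶ Y) = 0 :=
  ind_hom_ext fun v => by rw [indMap_unit, zero_toLin, zero_toLin, map_zero]

theorem epi_indMap {X Y : YetterDrinfeld k A} (p : X ⟶ Y) [Epi p] : Epi (indMap φ p) :=
  ⟨fun _ _ e => ind_hom_ext ((surjective_of_epi p).forall.2 fun v => by
    rw [← indMap_unit, ← comp_toLin, e, comp_toLin])⟩

/-- The functor `X ↦ X ⊗_A H` from Yetter-Drinfeld modules over `A` to those over `H`. -/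
@[simps]
def induction : YetterDrinfeld k A ⥤ YetterDrinfeld k H where
  obj := ind φ
  map := indMap φ
  map_id X := ind_hom_ext fun v => by rw [indMap_unit, id_toLin, id_toLin]
  map_comp f g := ind_hom_ext fun v => by
    rw [comp_toLin, indMap_unit, indMap_unit, indMap_unit, comp_toLin]

instance : (induction φ).PreservesZeroMorphisms where
  map_zero := indMap_zero φ

instance : (induction φ).PreservesEpimorphisms where
  preserves p _ := epi_indMap φ p

/-- The canonical map from a free module over `A` to the corresponding free module over `H`. -/
def relFreeUnit {V : Type u} [AddCommGroup V] [Module k V] (c : RightComodule k A V) :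
    RelHom φ (free c) (free (c.push (φ : A →ₗc[k] H))) :=
  relFree (g := freeUnit (c.push (φ : A →ₗc[k] H)))
    ((isColinear_freeUnit _).comp (isColinear_push (φ : A →ₗc[k] H) c))

theorem relFreeUnit_smul_unit {V : Type u} [AddCommGroup V] [Module k V] (c : RightComodule k A V)
    (a : A) (v : V) : (relFreeUnit φ c).toLin (MulOpposite.op a • freeUnit c v) =
      MulOpposite.op (φ a) • freeUnit (c.push (φ : A →ₗc[k] H)) v :=
  extend_smul_unit φ c _ a v

/-- The morphism `h ⊗ v ↦ (1 ⊗ v) ⊗ h`. -/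
def freeToIndFree {V : Type u} [AddCommGroup V] [Module k V] (c : RightComodule k A V) :
    free (c.push (φ : A →ₗc[k] H)) ⟶ ind φ (free c) :=
  freeHom (g := (indUnit φ (free c)).toLin ∘ₗ freeUnit c)
    (IsColinear.of_push (φ := (φ : A →ₗc[k] H))
      ((indUnit φ (free c)).map_coact.comp (φ := LinearMap.id) (isColinear_freeUnit c)))

theorem freeToIndFree_relFreeUnit {V : Type u} [AddCommGroup V] [Module k V]
    (c : RightComodule k A V) (x : free c) :
    (freeToIndFree φ c).toLin ((relFreeUnit φ c).toLin x) = (indUnit φ (free c)).toLin x := by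
  refine LinearMap.congr_fun (free_linearMap_ext
    (f := (freeToIndFree φ c).toLin ∘ₗ (relFreeUnit φ c).toLin) fun a v => ?_) x
  rw [LinearMap.comp_apply, relFreeUnit_smul_unit, (indUnit φ _).map_act]
  exact freeHom_smul_unit _ _ v

/-- The module induced by a free module is a retract of a free module. -/
def retractIndFree {V : Type u} [AddCommGroup V] [Module k V] (c : RightComodule k A V) :
    Retract (ind φ (free c)) (free (c.push (φ : A →ₗc[k] H))) where
  i := indLift (relFreeUnit φ c)
  r := freeToIndFree φ c
  retract := ind_hom_ext fun x => by
    rw [comp_toLin, indLift_unit, freeToIndFree_relFreeUnit, id_toLin]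

theorem projective_ind {h : H →ₗ[k] k} (hh : IsHaar h) (X : YetterDrinfeld k A) [Projective X] :
    Projective (ind φ X) := by
  have := epi_of_surjective _ (freeCounit_surjective X)
  have : Projective ((induction φ).obj (free X.comodule)) :=
    have := projective_free hh (X.comodule.push (φ : A →ₗc[k] H))
    (retractIndFree φ X.comodule).projective
  let r : Retract X (free X.comodule) :=
    { i := Projective.factorThru (𝟙 X) (freeCounit X)
      r := freeCounit X
      retract := Projective.factorThru_comp _ _ }
  exact (r.map (induction φ)).projective

theorem induction_map_shortExact [(induction φ).PreservesMonomorphisms]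
    {S : ShortComplex (YetterDrinfeld k A)} (hS : S.ShortExact) :
    (S.map (induction φ)).ShortExact := by
  have := hS.mono_f
  have := hS.epi_g
  have exists_desc : ∀ {W : YetterDrinfeld k H} (g : ind φ S.X₂ ⟶ W), indMap φ S.f ≫ g = 0 →
      ∃ t : ind φ S.X₃ ⟶ W, indMap φ S.g ≫ t = g := by
    intro W g hg
    obtain ⟨t, ht⟩ := RelHom.exists_desc S.g (surjective_of_epi _) ((indUnit φ S.X₂).comp g)
      fun x hx => by
        obtain ⟨z, rfl⟩ := mem_range_of_exact hS hx
        rw [RelHom.comp_toLin, LinearMap.comp_apply, ← indMap_unit, ← comp_toLin, hg, zero_toLin]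
    refine ⟨indLift t, ind_hom_ext fun v => ?_⟩
    rw [comp_toLin, indMap_unit, indLift_unit, ht, RelHom.comp_toLin, LinearMap.comp_apply]
  refine ShortComplex.ShortExact.mk' ?_ ((induction φ).map_mono S.f) ((induction φ).map_epi S.g)
  exact ShortComplex.exact_of_g_is_cokernel _ (Limits.CokernelCofork.IsColimit.ofπ _ _
    (fun g hg => (exists_desc g hg).choose) (fun g hg => (exists_desc g hg).choose_spec)
    (fun g hg m hm => ((induction φ).map_epi S.g).left_cancellation _ _
      (hm.trans (exists_desc g hg).choose_spec.symm)))

end Projective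

end YetterDrinfeld

section Expectation

open Coalgebra WithConv

variable {k A H : Type u} [Field k] [Ring A] [HopfAlgebra k A] [Ring H] [HopfAlgebra k H]

/-- A bilinear and bicolinear retraction of a morphism of Hopf algebras. -/
structure IsExpectation (φ : A →ₐc[k] H) (E : H →ₗ[k] A) : Prop where
  apply_map : ∀ a, E (φ a) = a
  map_mul : ∀ a h, E (φ a * h) = a * E h
  mul_map : ∀ h a, E (h * φ a) = E h * a
  comul_fst : ∀ h, E.rTensor H (comul h) = (φ : A →ₗ[k] H).lTensor A (comul (E h))
  comul_snd : ∀ h, E.lTensor H (comul h) = (φ : A →ₗ[k] H).rTensor A (comul (E h))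

namespace IsExpectation

variable {φ : A →ₐc[k] H} {E : H →ₗ[k] A} (hE : IsExpectation φ E)

include hE

theorem isHaar_comp {h : A →ₗ[k] k} (hh : IsHaar h) : IsHaar (h ∘ₗ E) where
  map_one := by rw [LinearMap.comp_apply, ← _root_.map_one φ, hE.apply_map, hh.map_one]
  apply_snd a := by
    have h_lTensor : (TensorProduct.rid k H).toLinearMap ∘ₗ h.lTensor H ∘ₗ
        (φ : A →ₗ[k] H).rTensor A =
        (φ : A →ₗ[k] H) ∘ₗ (TensorProduct.rid k A).toLinearMap ∘ₗ h.lTensor A :=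
      TensorProduct.ext' fun x y => by simp
    rw [LinearMap.lTensor_comp_apply, hE.comul_snd]
    refine (LinearMap.congr_fun h_lTensor _).trans ?_
    simp [hh.apply_snd]
  apply_fst a := by
    have h_rTensor : (TensorProduct.lid k H).toLinearMap ∘ₗ h.rTensor H ∘ₗ
        (φ : A →ₗ[k] H).lTensor A =
        (φ : A →ₗ[k] H) ∘ₗ (TensorProduct.lid k A).toLinearMap ∘ₗ h.rTensor A :=
      TensorProduct.ext' fun x y => by simp
    rw [LinearMap.rTensor_comp_apply, hE.comul_fst]
    refine (LinearMap.congr_fun h_rTensor _).trans ?_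
    simp [hh.apply_fst]

variable {R : Type u} [Ring R] [Algebra k R]

theorem convComp_convMul (f : WithConv (A →ₗ[k] R)) (g : WithConv (H →ₗ[k] R)) :
    convComp E f * g = convComp E (f * convComp (φ : A →ₗ[k] H) g) := by
  ext h
  have := congrArg (LinearMap.mul' k R ∘ₗ TensorProduct.map f.ofConv g.ofConv) (hE.comul_fst h)
  rw [(ℛ k h).convMul_apply, convComp_apply, (ℛ k (E h)).convMul_apply]
  simpa [← (ℛ k h).eq, ← (ℛ k (E h)).eq] using this

theorem convMul_convComp (f : WithConv (A →ₗ[k] R)) (g : WithConv (H →ₗ[k] R)) :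
    g * convComp E f = convComp E (convComp (φ : A →ₗ[k] H) g * f) := by
  ext h
  have := congrArg (LinearMap.mul' k R ∘ₗ TensorProduct.map g.ofConv f.ofConv) (hE.comul_snd h)
  rw [(ℛ k h).convMul_apply, convComp_apply, (ℛ k (E h)).convMul_apply]
  simpa [← (ℛ k h).eq, ← (ℛ k (E h)).eq] using this

variable {X : Type u} [AddCommGroup X] [Module k X]

theorem lTensor_twist (ρ : WithConv (A →ₗ[k] Module.End k X)) (h : H) (z : X ⊗[k] A) :
    (φ : A →ₗ[k] H).lTensor X (twist ρ (E h) z) =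
      twist (convComp E ρ) h ((φ : A →ₗ[k] H).lTensor X z) := by
  have twist_eq : twist (convComp E ρ) =
      convComp E (convComp (φ : A →ₗ[k] H) (leftAntipode k H X) *
        toConv (LinearMap.rTensorHom H ∘ₗ ρ.ofConv) *
        convComp (φ : A →ₗ[k] H) (rightMul k H X)) := by
    rw [← hE.convComp_convMul, ← hE.convMul_convComp]
    rfl
  rw [twist_eq]
  refine Intertwines.apply (T := (φ : A →ₗ[k] H).lTensor X) (.convMul (.convMul ?_ ?_) ?_) (E h) z
    <;> refine fun a => TensorProduct.ext' fun x g => ?_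
  · simp [antipode_bialgHom]
  · rfl
  · simp

end IsExpectation

theorem rTensor_twist_rTensor {X Y : Type u} [AddCommGroup X] [Module k X] [AddCommGroup Y]
    [Module k Y] {ρ : WithConv (H →ₗ[k] Module.End k X)} {σ : WithConv (H →ₗ[k] Module.End k Y)}
    (i : X →ₗ[k] Y) (r : Y →ₗ[k] X) (hr : ∀ h x, r (σ h (i x)) = ρ h x) (h : H) (z : X ⊗[k] H) :
    r.rTensor H (twist σ h (i.rTensor H z)) = twist ρ h z := by
  suffices h : r.rTensor H ∘ₗ twist σ h ∘ₗ i.rTensor H = twist ρ h from LinearMap.congr_fun h z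
  refine TensorProduct.ext' fun x g => ?_
  rw [twist, twist, (ℛ k h).convMul_apply, (ℛ k h).convMul_apply]
  simp [(ℛ k ((ℛ k h).left _)).convMul_apply, hr]

end Expectation

namespace YetterDrinfeld

section Retraction

variable {k A H : Type u} [Field k] [Ring A] [HopfAlgebra k A] [Ring H] [HopfAlgebra k H]
  {φ : A →ₐc[k] H} {E : H →ₗ[k] A} (hE : IsExpectation φ E)

include hE in
theorem exists_indRetract (V : YetterDrinfeld k A) : ∃ l : ind φ V →ₗ[k] V,
    ∀ (h : H) v, l (MulOpposite.op h • (indUnit φ V).toLin v) = MulOpposite.op (E h) • v :=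
  exists_indLin (convComp E (rightActHom k A V)).ofConv fun h a v => by
    change MulOpposite.op (E h) • MulOpposite.op a • v = MulOpposite.op (E (φ a * h)) • v
    rw [hE.map_mul, MulOpposite.op_mul, mul_smul]

/-- The map `v ⊗ h ↦ v · E(h)` on an induced module. -/
def indRetract (V : YetterDrinfeld k A) : ind φ V →ₗ[k] V :=
  (exists_indRetract hE V).choose

theorem indRetract_smul_unit (V : YetterDrinfeld k A) (h : H) (v : V) :
    indRetract hE V (MulOpposite.op h • (indUnit φ V).toLin v) = MulOpposite.op (E h) • v :=
  (exists_indRetract hE V).choose_spec h v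

theorem indRetract_unit (V : YetterDrinfeld k A) (v : V) :
    indRetract hE V ((indUnit φ V).toLin v) = v := by
  have h := indRetract_smul_unit hE V (φ 1) v
  rwa [hE.apply_map, map_one, MulOpposite.op_one, MulOpposite.op_one, one_smul, one_smul] at h

theorem indRetract_act (V : YetterDrinfeld k A) (a : A) (x : ind φ V) :
    indRetract hE V (MulOpposite.op (φ a) • x) = MulOpposite.op a • indRetract hE V x := by
  suffices h : indRetract hE V ∘ₗ rightAct k H (ind φ V) (φ a) =
      rightAct k A V a ∘ₗ indRetract hE V from LinearMap.congr_fun h x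
  refine ind_linearMap_ext fun h v => ?_
  simp only [LinearMap.comp_apply, rightAct_apply, smul_smul, ← MulOpposite.op_mul,
    indRetract_smul_unit, hE.mul_map]

theorem indRetract_map {V W : YetterDrinfeld k A} (p : V ⟶ W) (x : ind φ V) :
    indRetract hE W ((indMap φ p).toLin x) = p.toLin (indRetract hE V x) := by
  suffices h : indRetract hE W ∘ₗ (indMap φ p).toLin = p.toLin ∘ₗ indRetract hE V from
    LinearMap.congr_fun h x
  refine ind_linearMap_ext fun h v => ?_
  rw [LinearMap.comp_apply, LinearMap.comp_apply, (indMap φ p).map_act, indMap_unit,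
    indRetract_smul_unit, indRetract_smul_unit, p.map_act]

theorem indRetract_coact (V : YetterDrinfeld k A) (x : ind φ V) :
    (φ : A →ₗ[k] H).lTensor V (V.coact (indRetract hE V x)) =
      (indRetract hE V).rTensor H ((ind φ V).coact x) := by
  suffices h : (φ : A →ₗ[k] H).lTensor V ∘ₗ V.coact ∘ₗ indRetract hE V =
      (indRetract hE V).rTensor H ∘ₗ (ind φ V).coact from LinearMap.congr_fun h x
  refine ind_linearMap_ext fun h v => ?_
  have coact_unit : (ind φ V).coact ((indUnit φ V).toLin v) =
      (indUnit φ V).toLin.rTensor H ((φ : A →ₗ[k] H).lTensor V (V.coact v)) := by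
    rw [(indUnit φ V).map_coact]
    exact (LinearMap.congr_fun (LinearMap.rTensor_comp_lTensor ..) _).symm
  simp only [LinearMap.comp_apply]
  rw [indRetract_smul_unit, coact_act, coact_act, coact_unit, hE.lTensor_twist]
  exact (rTensor_twist_rTensor (ρ := convComp E (rightActHom k A V)) _ _
    (indRetract_smul_unit hE V) h _).symm

/-- The morphism over `A` underlying a morphism of induced modules. -/
def underlying {X V : YetterDrinfeld k A} (f : ind φ X ⟶ ind φ V) : X ⟶ V where
  toLin := indRetract hE V ∘ₗ f.toLin ∘ₗ (indUnit φ X).toLin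
  map_act a v := by
    rw [LinearMap.comp_apply, LinearMap.comp_apply, (indUnit φ X).map_act, f.map_act,
      indRetract_act, LinearMap.comp_apply, LinearMap.comp_apply]
  map_coact v := by
    have lTensor_injective : Function.Injective ((φ : A →ₗ[k] H).lTensor V) := by
      have h : E.lTensor V ∘ₗ (φ : A →ₗ[k] H).lTensor V = LinearMap.id :=
        TensorProduct.ext' fun v a => by simp [hE.apply_map]
      exact Function.LeftInverse.injective (LinearMap.congr_fun h)
    apply lTensor_injective
    have h := ((indUnit φ X).comp f).map_coact v
    simp only [LinearMap.comp_apply]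
    rw [indRetract_coact]
    refine (congrArg _ h).trans ?_
    rw [LinearMap.rTensor, LinearMap.lTensor, LinearMap.rTensor, TensorProduct.map_map,
      TensorProduct.map_map]
    rfl

end Retraction

section Dimension

variable {k A H : Type u} [Field k] [Ring A] [HopfAlgebra k A] [Ring H] [HopfAlgebra k H]
  {φ : A →ₐc[k] H} {E : H →ₗ[k] A}

theorem projective_of_ind (hE : IsExpectation φ E) (X : YetterDrinfeld k A)
    [Projective (ind φ X)] : Projective X := by
  refine ⟨fun {V W} f p _ => ?_⟩
  have := epi_indMap φ p
  obtain ⟨g, hg⟩ := Projective.factors (indMap φ f) (indMap φ p)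
  refine ⟨underlying hE g, hom_ext fun x => ?_⟩
  rw [comp_toLin]
  change p.toLin (indRetract hE V (g.toLin ((indUnit φ X).toLin x))) = _
  rw [← indRetract_map, ← comp_toLin, hg, indMap_unit, indRetract_unit]

theorem isZero_ind_iff (hE : IsExpectation φ E) (X : YetterDrinfeld k A) :
    Limits.IsZero (ind φ X) ↔ Limits.IsZero X := by
  refine ⟨fun h => ?_, (induction φ).map_isZero⟩
  rw [Limits.IsZero.iff_id_eq_zero]
  refine hom_ext fun v => ?_
  have unit_eq : (indUnit φ X).toLin v = 0 :=
    Hom.congr_fun (h.eq_of_src (𝟙 _) 0) ((indUnit φ X).toLin v)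
  rw [← indRetract_unit hE X v, unit_eq, map_zero, map_zero, map_zero]

theorem hasProjectiveDimensionLT_ind_iff [(induction φ).PreservesMonomorphisms]
    (hE : IsExpectation φ E) {h : A →ₗ[k] k} (hh : IsHaar h) (n : ℕ) (X : YetterDrinfeld k A) :
    HasProjectiveDimensionLT (ind φ X) n ↔ HasProjectiveDimensionLT X n := by
  match n with
  | 0 =>
    rw [hasProjectiveDimensionLT_zero_iff_isZero, hasProjectiveDimensionLT_zero_iff_isZero,
      isZero_ind_iff hE]
  | 1 =>
    rw [← projective_iff_hasProjectiveDimensionLT_one,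
      ← projective_iff_hasProjectiveDimensionLT_one]
    exact ⟨fun _ => projective_of_ind hE X, fun _ => projective_ind φ (hE.isHaar_comp hh) X⟩
  | n + 2 =>
    have hS := ker_shortExact (freeCounit X) (freeCounit_surjective X)
    have hF : Projective (free X.comodule) := projective_free hh _
    have hF' : Projective (ind φ (free X.comodule)) := projective_ind φ (hE.isHaar_comp hh) _
    exact ((induction_map_shortExact φ hS).hasProjectiveDimensionLT_X₃_iff n hF').trans
      ((hasProjectiveDimensionLT_ind_iff hE hh (n + 1) _).trans
        (hS.hasProjectiveDimensionLT_X₃_iff n hF).symm)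

end Dimension

end YetterDrinfeld

section Cosemisimple

open Coalgebra WithConv

variable {k A : Type u} [Field k] [Ring A] [Bialgebra k A]

variable (k A) in
/-- The regular right comodule of a coalgebra, kept reducible so that it can be used as a local
instance. -/
abbrev regularComodule : RightComodule k A A where
  coact := comul
  coassoc := Coalgebra.coassoc
  counit_coact := by ext a; simp

/-- Right invariance `h(a₁) a₂ = h(a) 1` of a functional on a bialgebra. -/
def IsRightInvariant (h : A →ₗ[k] k) : Prop :=
  ∀ a, h.rTensor A (comul a) = h a ⊗ₜ[k] (1 : A)

theorem isRightInvariant_iff_convMul {h : A →ₗ[k] k} :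
    IsRightInvariant h ↔ ∀ f : A →ₗ[k] k, toConv h * toConv f = f 1 • toConv h := by
  have eval (a : A) (f : A →ₗ[k] k) :
      (toConv h * toConv f) a = f (TensorProduct.lid k A (h.rTensor A (comul a))) := by
    rw [(ℛ k a).convMul_apply]
    simp [← (ℛ k a).eq]
  refine ⟨fun hh f => ?_, fun hh a => (TensorProduct.lid k A).injective ?_⟩
  · ext a
    rw [eval, hh, TensorProduct.lid_tmul, map_smul]
    exact mul_comm _ _
  · rw [TensorProduct.lid_tmul, ← sub_eq_zero, ← Module.forall_dual_apply_eq_zero_iff k]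
    intro f
    rw [map_sub, ← eval, hh, map_smul, sub_eq_zero]
    exact mul_comm _ _

theorem isSubcomodule_span_one :
    let := regularComodule k A
    IsSubcomodule A (Submodule.span k {(1 : A)}) := by
  intro _ w hw
  refine ⟨⟨w, hw⟩ ⊗ₜ 1, ?_⟩
  obtain ⟨c, rfl⟩ := Submodule.mem_span_singleton.1 hw
  change (c • (1 : A)) ⊗ₜ[k] (1 : A) = comul (c • 1)
  rw [map_smul, Bialgebra.comul_one, Algebra.TensorProduct.one_def, TensorProduct.smul_tmul']

theorem exists_isRightInvariant (hA : IsCosemisimple k A) :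
    ∃ h : A →ₗ[k] k, h 1 = 1 ∧ IsRightInvariant h := by
  let := regularComodule k A
  obtain ⟨W, hW, hc⟩ := hA A _ isSubcomodule_span_one
  have one_notMem : (1 : A) ∉ W := fun h1 => by
    have one_eq_zero : (1 : A) = 0 :=
      Submodule.disjoint_def.1 hc.disjoint 1 (Submodule.mem_span_singleton_self 1) h1
    apply one_ne_zero (α := k)
    rw [← Bialgebra.counit_one (R := k) (A := A), one_eq_zero, map_zero]
  obtain ⟨h, h_one, hW0⟩ : ∃ h : A →ₗ[k] k, h 1 = 1 ∧ ∀ w ∈ W, h w = 0 := by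
    obtain ⟨f, hf1, hf⟩ := Submodule.exists_le_ker_of_notMem one_notMem
    exact ⟨(f 1)⁻¹ • f, inv_mul_cancel₀ hf1, fun w hw => by
      rw [LinearMap.smul_apply, LinearMap.mem_ker.1 (hf hw), smul_zero]⟩
  refine ⟨h, h_one, fun a => ?_⟩
  obtain ⟨x, hx, w, hw, rfl⟩ := Submodule.mem_sup.1 (hc.sup_eq_top.ge (Submodule.mem_top (x := a)))
  obtain ⟨c, rfl⟩ := Submodule.mem_span_singleton.1 hx
  have comul_w : h.rTensor A (comul w) = 0 := by
    obtain ⟨t, ht⟩ := hW w hw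
    rw [show comul w = _ from ht.symm, ← LinearMap.rTensor_comp_apply,
      show h ∘ₗ W.subtype = 0 from LinearMap.ext fun x => hW0 x x.2, LinearMap.rTensor_zero,
      LinearMap.zero_apply]
  rw [map_add, map_add, comul_w, map_smul, map_smul, Bialgebra.comul_one,
    Algebra.TensorProduct.one_def, map_add h, hW0 w hw, map_smul, LinearMap.rTensor_tmul,
    TensorProduct.smul_tmul', add_zero, add_zero]

/-- A complement of the kernel of `f` in the regular comodule is spanned by a `d` with
`d₁ ⊗ d₂ = d ⊗ 1`, that is, by a scalar. -/
theorem IsRightInvariant.eq_zero (hA : IsCosemisimple k A) {f : A →ₗ[k] k}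
    (hf : IsRightInvariant f) (f_one : f 1 = 0) : f = 0 := by
  let := regularComodule k A
  obtain ⟨D, hD, hc⟩ := hA A (LinearMap.ker f) fun w hw => by
    refine (Module.Flat.rTensor_exact A (LinearMap.exact_subtype_ker_map f) _).1 ?_
    change f.rTensor A (comul w) = 0
    rw [hf, LinearMap.mem_ker.1 hw, TensorProduct.zero_tmul]
  have f_injective : Function.Injective (f ∘ₗ D.subtype) := by
    rw [injective_iff_map_eq_zero]
    exact fun y hy => Subtype.ext (Submodule.disjoint_def.1 hc.disjoint y hy y.2)
  have f_apply (d : D) : f d = 0 := by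
    obtain ⟨t, ht⟩ := hD d d.2
    have t_eq : t = d ⊗ₜ (1 : A) := by
      apply Module.Flat.rTensor_preserves_injective_linearMap (M := A) _ f_injective
      rw [LinearMap.rTensor_comp_apply, ht]
      exact hf d
    have comul_d : comul (d : A) = (d : A) ⊗ₜ[k] (1 : A) := by
      rw [← D.subtype_apply, ← LinearMap.rTensor_tmul, ← t_eq]
      exact ht.symm
    have d_eq : counit (R := k) (d : A) • (1 : A) = d := by
      have := congrArg (TensorProduct.lid k A) (rTensor_counit_comul (R := k) (d : A))
      rwa [comul_d, LinearMap.rTensor_tmul, TensorProduct.lid_tmul, TensorProduct.lid_tmul,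
        one_smul] at this
    rw [← d_eq, map_smul, f_one, smul_zero]
  ext a
  obtain ⟨x, hx, d, hd, rfl⟩ := Submodule.mem_sup.1 (hc.sup_eq_top.ge (Submodule.mem_top (x := a)))
  rw [map_add, LinearMap.mem_ker.1 hx, f_apply ⟨d, hd⟩, add_zero, LinearMap.zero_apply]

theorem exists_isHaar (hA : IsCosemisimple k A) : ∃ h : A →ₗ[k] k, IsHaar h := by
  obtain ⟨h, h_one, hh⟩ := exists_isRightInvariant hA
  have convMul_right := isRightInvariant_iff_convMul.1 hh
  have convMul_left (f : A →ₗ[k] k) : toConv f * toConv h = f 1 • toConv h := by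
    let g : A →ₗ[k] k := (toConv f * toConv h - f 1 • toConv h).ofConv
    have hg : IsRightInvariant g := isRightInvariant_iff_convMul.2 fun f' => by
      change (toConv f * toConv h - f 1 • toConv h) * toConv f' =
        f' 1 • (toConv f * toConv h - f 1 • toConv h)
      rw [sub_mul, mul_assoc, smul_mul_assoc, convMul_right, mul_smul_comm, smul_sub,
        smul_comm (f 1)]
    have g_one : g 1 = 0 := by
      simp [g, h_one, LinearMap.convMul_apply, Algebra.TensorProduct.one_def]
    exact sub_eq_zero.1 (congrArg toConv (hg.eq_zero hA g_one))
  refine ⟨h, h_one, fun a => ?_, fun a => by rw [hh, TensorProduct.lid_tmul]⟩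
  rw [← sub_eq_zero, ← Module.forall_dual_apply_eq_zero_iff k]
  intro f
  have := LinearMap.congr_fun (congrArg ofConv (convMul_left f)) a
  have eval : f (TensorProduct.rid k A (h.lTensor A (comul a))) = (toConv f * toConv h) a := by
    rw [(ℛ k a).convMul_apply]
    simp [← (ℛ k a).eq, mul_comm]
  rw [map_sub, eval, convMul_left, map_smul, sub_eq_zero]
  exact mul_comm _ _

end Cosemisimple

section FreeProduct

variable {k A B H : Type u} [Field k] [Ring A] [Algebra k A] [Ring B] [Algebra k B] [Ring H]
  [Algebra k H] {φ : A →ₐ[k] H} {ψ : B →ₐ[k] H}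

/-- `φ` and `ψ` exhibit `H` as the free product of the algebras `A` and `B`. Uniqueness in the
universal property is encoded by generation. -/
structure IsFreeProd (φ : A →ₐ[k] H) (ψ : B →ₐ[k] H) : Prop where
  exists_lift : ∀ {R : Type u} [Ring R] [Algebra k R] (f : A →ₐ[k] R) (g : B →ₐ[k] R),
    ∃ l : H →ₐ[k] R, (∀ a, l (φ a) = f a) ∧ ∀ b, l (ψ b) = g b
  mem_of_range_le : ∀ S : Subalgebra k H, φ.range ≤ S → ψ.range ≤ S → ∀ x, x ∈ S

namespace IsFreeProd

theorem symm (h : IsFreeProd φ ψ) : IsFreeProd ψ φ where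
  exists_lift f g := by
    obtain ⟨l, hl⟩ := h.exists_lift g f
    exact ⟨l, hl.symm⟩
  mem_of_range_le S hψ hφ := h.mem_of_range_le S hφ hψ

theorem exists_opLift (h : IsFreeProd φ ψ) {R : Type u} [Ring R] [Algebra k R]
    (f : Aᵐᵒᵖ →ₐ[k] R) (g : Bᵐᵒᵖ →ₐ[k] R) : ∃ l : Hᵐᵒᵖ →ₐ[k] R,
      (∀ a, l (MulOpposite.op (φ a)) = f (MulOpposite.op a)) ∧
        ∀ b, l (MulOpposite.op (ψ b)) = g (MulOpposite.op b) := by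
  obtain ⟨l, hφ, hψ⟩ := h.exists_lift (AlgHom.opComm.symm f) (AlgHom.opComm.symm g)
  exact ⟨AlgHom.opComm l, fun a => congrArg MulOpposite.unop (hφ a),
    fun b => congrArg MulOpposite.unop (hψ b)⟩

theorem comp_rightAction_eq (h : IsFreeProd φ ψ) {M N : Type u} [AddCommGroup M] [Module k M]
    [AddCommGroup N] [Module k N] {σ : Hᵐᵒᵖ →ₐ[k] Module.End k M} {τ : Hᵐᵒᵖ →ₐ[k] Module.End k N}
    {j : M →ₗ[k] N}
    (hφ : ∀ a, τ (MulOpposite.op (φ a)) ∘ₗ j = j ∘ₗ σ (MulOpposite.op (φ a)))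
    (hψ : ∀ b, τ (MulOpposite.op (ψ b)) ∘ₗ j = j ∘ₗ σ (MulOpposite.op (ψ b))) (x : H) :
    τ (MulOpposite.op x) ∘ₗ j = j ∘ₗ σ (MulOpposite.op x) := by
  let S : Subalgebra k H :=
    { carrier := {x | τ (MulOpposite.op x) ∘ₗ j = j ∘ₗ σ (MulOpposite.op x)}
      mul_mem' := fun {x y} hx hy => by
        rw [Set.mem_ofPred_eq] at hx hy ⊢
        rw [MulOpposite.op_mul, map_mul, map_mul, Module.End.mul_eq_comp, Module.End.mul_eq_comp,
          LinearMap.comp_assoc, hx, ← LinearMap.comp_assoc, hy, LinearMap.comp_assoc]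
      add_mem' := fun {x y} hx hy => by
        rw [Set.mem_ofPred_eq] at hx hy ⊢
        rw [MulOpposite.op_add, map_add, map_add, LinearMap.add_comp, LinearMap.comp_add, hx, hy]
      algebraMap_mem' := fun c => by
        rw [Set.mem_ofPred_eq, ← MulOpposite.algebraMap_apply, AlgHom.commutes, AlgHom.commutes]
        ext m
        exact (map_smul j c m).symm }
  refine h.mem_of_range_le S ?_ ?_ x
  · rintro _ ⟨a, rfl⟩
    exact hφ a
  · rintro _ ⟨b, rfl⟩
    exact hψ b

end IsFreeProd

variable {V W : Type u} [AddCommGroup V] [Module k V] [AddCommGroup W] [Module k W]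

variable (k A W) in
/-- The right action of `A` on the coinduced module `Hom(A, W)`. -/
def coinducedAction : Aᵐᵒᵖ →ₐ[k] Module.End k (A →ₗ[k] W) where
  toFun a := LinearMap.lcomp k W (LinearMap.mulLeft k a.unop)
  map_one' := by ext; simp
  map_mul' a b := by ext; simp
  map_zero' := by ext; simp
  map_add' a b := by ext; simp [add_mul]
  commutes' c := by ext; simp [Algebra.algebraMap_eq_smul_one]

@[simp] theorem coinducedAction_apply (a x : A) (F : A →ₗ[k] W) :
    coinducedAction k A W (MulOpposite.op a) F x = F (a * x) := rfl

/-- The extension of an action on `W` to a space in which `W` is a direct summand, the augmentation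
acting on the complement. -/
def extendAction (ε : B →ₐ[k] k) (σ : B →ₐ[k] Module.End k W) (j : W →ₗ[k] V) (e : V →ₗ[k] W)
    (he : ∀ w, e (j w) = w) : B →ₐ[k] Module.End k V where
  toFun b := j ∘ₗ σ b ∘ₗ e + ε b • (LinearMap.id - j ∘ₗ e)
  map_one' := by ext; simp
  map_mul' a b := by ext; simp [he, mul_smul]
  map_zero' := by ext; simp
  map_add' a b := by ext; simp [add_smul]; abel
  commutes' c := by ext; simp [Algebra.algebraMap_eq_smul_one, smul_sub]

theorem extendAction_apply_map (ε : B →ₐ[k] k) (σ : B →ₐ[k] Module.End k W) {j : W →ₗ[k] V}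
    {e : V →ₗ[k] W} (he : ∀ w, e (j w) = w) (b : B) (w : W) :
    extendAction ε σ j e he b (j w) = j (σ b w) := by
  simp [extendAction, he]

variable [Module Hᵐᵒᵖ W] [IsScalarTower k Hᵐᵒᵖ W]

variable (φ W) in
/-- The embedding of an `H`-module in the module coinduced from its restriction to `A`. -/
def coinducedUnit : W →ₗ[k] A →ₗ[k] W :=
  LinearMap.flip ((Algebra.lsmul k k W).toLinearMap ∘ₗ (MulOpposite.opLinearEquiv k).toLinearMap ∘ₗ
    φ.toLinearMap)

@[simp] theorem coinducedUnit_apply (w : W) (a : A) :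
    coinducedUnit φ W w a = MulOpposite.op (φ a) • w := rfl

/-- `B` acts on `Hom(A, W)` through the augmentation outside the image of `W`. -/
theorem IsFreeProd.exists_coinducedAction (h : IsFreeProd φ ψ) (ε : B →ₐ[k] k) :
    ∃ τ : Hᵐᵒᵖ →ₐ[k] Module.End k (A →ₗ[k] W),
      (∀ a, τ (MulOpposite.op (φ a)) = coinducedAction k A W (MulOpposite.op a)) ∧
        ∀ x w, τ (MulOpposite.op x) (coinducedUnit φ W w) =
          coinducedUnit φ W (MulOpposite.op x • w) := by
  let actB : Bᵐᵒᵖ →ₐ[k] Module.End k W := (Algebra.lsmul k k W).comp (AlgHom.op ψ)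
  let εop : Bᵐᵒᵖ →ₐ[k] k := ε.fromOpposite fun _ _ => Commute.all _ _
  have left_inv (w : W) : LinearMap.applyₗ (R := k) (1 : A) (coinducedUnit φ W w) = w := by simp
  obtain ⟨τ, hτφ, hτψ⟩ := h.exists_opLift (coinducedAction k A W)
    (extendAction εop actB (coinducedUnit φ W) (LinearMap.applyₗ 1) left_inv)
  refine ⟨τ, hτφ, fun x w => LinearMap.congr_fun
    (h.comp_rightAction_eq (σ := Algebra.lsmul k k W) (fun a => ?_) (fun b => ?_) x) w⟩
  · rw [hτφ]
    ext w x
    simp [mul_smul]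
  · rw [hτψ]
    exact LinearMap.ext fun w => extendAction_apply_map _ _ left_inv _ _

end FreeProduct

namespace YetterDrinfeld

variable {k A B H : Type u} [Field k] [Ring A] [HopfAlgebra k A] [Ring B] [Algebra k B] [Ring H]
  [HopfAlgebra k H] {φ : A →ₐc[k] H} {ψ : B →ₐ[k] H}

/-- The map `X → ind X` extends along the split injection `X → Y` to a map from `Y` to the module
coinduced from `ind X`, hence to a map from `ind Y` when that module is one over `H`. -/
theorem indMap_injective (h : IsFreeProd (φ : A →ₐ[k] H) ψ) (ε : B →ₐ[k] k)
    {X Y : YetterDrinfeld k A} (f : X ⟶ Y) (hf : Function.Injective f.toLin) :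
    Function.Injective (indMap φ f).toLin := by
  obtain ⟨r, hr⟩ := f.toLin.exists_leftInverse_of_injective (LinearMap.ker_eq_bot.2 hf)
  obtain ⟨τ, hτφ, hτ⟩ := h.exists_coinducedAction (W := ind φ X) ε
  let g : Y →ₗ[k] A →ₗ[k] ind φ X :=
    LinearMap.flip (LinearMap.llcomp k Y X (ind φ X) (indUnit φ X).toLin ∘ₗ
      LinearMap.llcomp k Y Y X r ∘ₗ (rightActHom k A Y).ofConv)
  have g_map (v : X) : g (f.toLin v) = coinducedUnit (φ : A →ₐ[k] H) _ ((indUnit φ X).toLin v) := by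
    ext a
    change (indUnit φ X).toLin (r (MulOpposite.op a • f.toLin v)) =
      MulOpposite.op (φ a) • (indUnit φ X).toLin v
    rw [← f.map_act, ← LinearMap.comp_apply r, hr, LinearMap.id_apply, (indUnit φ X).map_act]
  obtain ⟨l, hl⟩ := exists_indLin (φ := φ) (LinearMap.lcomp k _ g ∘ₗ τ.toLinearMap ∘ₗ
    (MulOpposite.opLinearEquiv k).toLinearMap) fun x a y => by
      change τ (MulOpposite.op x) (g (MulOpposite.op a • y)) = τ (MulOpposite.op (φ a * x)) (g y)
      have g_act : g (MulOpposite.op a • y) = coinducedAction k A _ (MulOpposite.op a) (g y) := by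
        ext x
        change (indUnit φ X).toLin (r (MulOpposite.op x • MulOpposite.op a • y)) =
          (indUnit φ X).toLin (r (MulOpposite.op (a * x) • y))
        rw [MulOpposite.op_mul, mul_smul]
      rw [MulOpposite.op_mul, map_mul, g_act, ← hτφ]
      rfl
  have l_comp : l ∘ₗ (indMap φ f).toLin = coinducedUnit (φ : A →ₐ[k] H) (ind φ X) := by
    refine ind_linearMap_ext fun x v => ?_
    rw [LinearMap.comp_apply, (indMap φ f).map_act, indMap_unit, hl, ← hτ, ← g_map]
    rfl
  refine Function.Injective.of_comp (f := l) ?_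
  rw [← LinearMap.coe_comp, l_comp]
  refine Function.LeftInverse.injective (g := LinearMap.applyₗ (R := k) (1 : A)) fun w => ?_
  simp

theorem induction_preservesMonomorphisms (h : IsFreeProd (φ : A →ₐ[k] H) ψ) (ε : B →ₐ[k] k) :
    (induction φ).PreservesMonomorphisms where
  preserves f _ := mono_of_injective _ (indMap_injective h ε f (injective_of_mono f))

end YetterDrinfeld

section Subcoalgebra

open Coalgebra

variable {k C : Type u} [Field k]

/-- The subspace `V` of a coalgebra satisfies `Δ(V) ⊆ V ⊗ V`, the right-hand side being encoded as
a subspace of `C ⊗ C`. -/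
def IsSubcoalgebra [AddCommGroup C] [Module k C] [Coalgebra k C] (V : Submodule k C) : Prop :=
  V.map comul ≤ Submodule.map₂ (TensorProduct.mk k C C) V V

variable [Ring C]

theorem map₂_mk_mul_le [Algebra k C] (P Q P' Q' : Submodule k C) :
    Submodule.map₂ (TensorProduct.mk k C C) P Q * Submodule.map₂ (TensorProduct.mk k C C) P' Q' ≤
      Submodule.map₂ (TensorProduct.mk k C C) (P * P') (Q * Q') := by
  rw [Submodule.map₂_eq_span_image2, Submodule.map₂_eq_span_image2, Submodule.span_mul_span,
    Submodule.span_le]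
  rintro _ ⟨_, ⟨p, hp, q, hq, rfl⟩, _, ⟨p', hp', q', hq', rfl⟩, rfl⟩
  change (p ⊗ₜ[k] q) * (p' ⊗ₜ[k] q') ∈ _
  rw [Algebra.TensorProduct.tmul_mul_tmul]
  exact Submodule.apply_mem_map₂ (TensorProduct.mk k C C) (Submodule.mul_mem_mul hp hp')
    (Submodule.mul_mem_mul hq hq')

variable [Bialgebra k C]

theorem IsHaar.isSubcoalgebra_ker {h : C →ₗ[k] k} (hh : IsHaar h) :
    IsSubcoalgebra (LinearMap.ker h) := by
  let P : C →ₗ[k] C := LinearMap.id - LinearMap.toSpanSingleton k C 1 ∘ₗ h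
  have range_le : LinearMap.range P ≤ LinearMap.ker h := by
    rintro _ ⟨c, rfl⟩
    simp [P, hh.map_one]
  have rTensor_P (z : C ⊗[k] C) :
      P.rTensor C z = z - 1 ⊗ₜ TensorProduct.lid k C (h.rTensor C z) := by
    induction z with
    | zero => simp
    | add x y hx hy => simp only [map_add, hx, hy, tmul_add]; abel
    | tmul x y => simp [P, smul_tmul]
  have lTensor_P (z : C ⊗[k] C) :
      P.lTensor C z = z - TensorProduct.rid k C (h.lTensor C z) ⊗ₜ 1 := by
    induction z with
    | zero => simp
    | add x y hx hy => simp only [map_add, hx, hy, add_tmul]; abel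
    | tmul x y => simp [P, smul_tmul']
  rintro _ ⟨c, hc, rfl⟩
  rw [SetLike.mem_coe, LinearMap.mem_ker] at hc
  have map_P : TensorProduct.map P P (comul c) = comul c := by
    rw [← LinearMap.rTensor_comp_lTensor, LinearMap.comp_apply, lTensor_P, hh.apply_snd, hc,
      zero_smul, zero_tmul, sub_zero, rTensor_P, hh.apply_fst, hc, zero_smul, tmul_zero, sub_zero]
  rw [← map_P]
  exact Submodule.map₂_le_map₂ range_le range_le
    (TensorProduct.range_map P P ▸ LinearMap.mem_range_self _ _)

theorem isSubcoalgebra_top : IsSubcoalgebra (⊤ : Submodule k C) := by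
  rw [IsSubcoalgebra, TensorProduct.map₂_mk_top_top_eq_top]
  exact le_top

namespace IsSubcoalgebra

variable {V W : Submodule k C}

theorem mul (hV : IsSubcoalgebra V) (hW : IsSubcoalgebra W) : IsSubcoalgebra (V * W) := by
  refine Submodule.map_le_iff_le_comap.2 (Submodule.mul_le.2 fun v hv w hw => ?_)
  rw [Submodule.mem_comap, Bialgebra.comul_mul]
  exact map₂_mk_mul_le V V W W
    (Submodule.mul_mem_mul (hV (Submodule.mem_map_of_mem hv)) (hW (Submodule.mem_map_of_mem hw)))

theorem map {D : Type u} [Ring D] [Bialgebra k D] (hV : IsSubcoalgebra V) (φ : C →ₐc[k] D) :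
    IsSubcoalgebra (V.map (φ : C →ₗ[k] D)) := by
  rintro _ ⟨_, ⟨v, hv, rfl⟩, rfl⟩
  have comul_mem := Submodule.mem_map_of_mem
    (f := TensorProduct.map (φ : C →ₗ[k] D) (φ : C →ₗ[k] D)) (hV (Submodule.mem_map_of_mem hv))
  rw [Submodule.map_map₂] at comul_mem
  rw [Submodule.map₂_map_map]
  exact CoalgHomClass.map_comp_comul_apply φ v ▸ comul_mem

theorem adjoin (hV : IsSubcoalgebra V) :
    IsSubcoalgebra (Subalgebra.toSubmodule (Algebra.adjoin k (V : Set C))) := by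
  rintro _ ⟨x, hx, rfl⟩
  set S := Subalgebra.toSubmodule (Algebra.adjoin k (V : Set C))
  have S_mul_S : S * S ≤ S := (Subalgebra.isIdempotentElem_toSubmodule _).le
  have V_le : V ≤ S := Algebra.subset_adjoin
  induction hx using Algebra.adjoin_induction with
  | mem x hx => exact Submodule.map₂_le_map₂ V_le V_le (hV (Submodule.mem_map_of_mem hx))
  | algebraMap c =>
    rw [Algebra.algebraMap_eq_smul_one, map_smul, Bialgebra.comul_one]
    exact Submodule.smul_mem _ c
      (Submodule.apply_mem_map₂ _ (Subalgebra.one_mem _) (Subalgebra.one_mem _))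
  | add x y _ _ hx hy => rw [map_add]; exact add_mem hx hy
  | mul x y _ _ hx hy =>
    rw [Bialgebra.comul_mul]
    exact Submodule.map₂_le_map₂ S_mul_S S_mul_S (map₂_mk_mul_le S S S S
      (Submodule.mul_mem_mul hx hy))

end IsSubcoalgebra

end Subcoalgebra

section ReducedWords

theorem one_add_mul_one_add_le {R : Type u} [IdemSemiring R] {p q s : R} (one_le : 1 ≤ s)
    (hs : s * (p * q) ≤ s) (hs' : s ≤ 1 + s * (p * q)) (hq : q * q ≤ 1 + q) :
    (1 + q * s * (1 + p)) * (1 + q) ≤ 1 + q * s * (1 + p) := by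
  set N := 1 + q * s * (1 + p)
  have qs_le : q * s ≤ N := by
    simp only [N, mul_add, mul_one, ← add_assoc]
    exact le_add_right le_add_self
  have q_le : q ≤ N := by
    grw [← qs_le, ← one_le, mul_one]
  have qspq_le : q * s * p * q ≤ q * s := by
    grw [mul_assoc, mul_assoc, hs]
  have qsq_le : q * s * q ≤ N := calc
    q * s * q ≤ q * (1 + s * (p * q)) * q := by grw [hs']
    _ = q * q + q * s * p * (q * q) := by simp only [mul_add, add_mul, mul_one, mul_assoc]
    _ ≤ q * q + q * s * p * (1 + q) := by gcongr
    _ = q * q + (q * s * p + q * s * p * q) := by rw [mul_add, mul_one]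
    _ ≤ N := by
      refine add_le (hq.trans (add_le le_self_add q_le)) (add_le ?_ (qspq_le.trans qs_le))
      simp only [N, mul_add]
      exact le_add_left le_add_self
  have N_mul_q : N * q = q + (q * s * q + q * s * p * q) := by
    simp only [N, mul_add, add_mul, mul_one, one_mul]
  rw [mul_add, mul_one, N_mul_q]
  exact add_le le_rfl (add_le q_le (add_le qsq_le (qspq_le.trans qs_le)))

variable {k A B H : Type u} [Field k] [Ring A] [Algebra k A] [Ring B] [Algebra k B] [Ring H]
  [Algebra k H] {φ : A →ₐ[k] H} {ψ : B →ₐ[k] H} {hA : A →ₗ[k] k} {hB : B →ₗ[k] k}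

theorem toSubmodule_adjoin_le_one_add_mul (V : Submodule k H) :
    Subalgebra.toSubmodule (Algebra.adjoin k (V : Set H)) ≤
      1 + Subalgebra.toSubmodule (Algebra.adjoin k (V : Set H)) * V := by
  rw [Submodule.add_eq_sup]
  nth_rw 1 [Algebra.adjoin_eq_span]
  refine Submodule.span_le.2 fun x hx => ?_
  induction hx using Submonoid.closure_induction_right with
  | one => exact Submodule.mem_sup_left (Submodule.one_le.1 le_rfl)
  | mul_right x hx v hv _ =>
    exact Submodule.mem_sup_right
      (Submodule.mul_mem_mul (Algebra.adjoin_eq_span k (V : Set H) ▸ Submodule.subset_span hx) hv)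

theorem toSubmodule_range_eq_one_add_map_ker (φ : A →ₐ[k] H) (hA_one : hA 1 = 1) :
    Subalgebra.toSubmodule φ.range = 1 + (LinearMap.ker hA).map φ.toLinearMap := by
  refine le_antisymm ?_ (sup_le ?_ ?_)
  · rintro _ ⟨a, rfl⟩
    refine Submodule.mem_sup.2 ⟨hA a • 1, Submodule.smul_mem _ _ (Submodule.one_le.1 le_rfl),
      φ (a - hA a • 1), ⟨a - hA a • 1, by simp [hA_one], rfl⟩, ?_⟩
    simp
  · exact Submodule.one_le.2 (one_mem φ.range)
  · rintro _ ⟨a, -, rfl⟩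
    exact ⟨a, rfl⟩

/-- The span of the reduced words that start and end in `B`, all letters of which are killed by the
functionals `hA` and `hB`. -/
def innerWords (φ : A →ₐ[k] H) (ψ : B →ₐ[k] H) (hA : A →ₗ[k] k) (hB : B →ₗ[k] k) :
    Submodule k H :=
  (LinearMap.ker hB).map ψ.toLinearMap * Subalgebra.toSubmodule (Algebra.adjoin k
    ↑((LinearMap.ker hA).map φ.toLinearMap * (LinearMap.ker hB).map ψ.toLinearMap))

/-- The span of the words with at least one letter from `B`, all letters except the first and the
last one being killed by `hA` and `hB`; these two are arbitrary elements of `A`. -/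
def wordSpan (φ : A →ₐ[k] H) (ψ : B →ₐ[k] H) (hA : A →ₗ[k] k) (hB : B →ₗ[k] k) :
    Submodule k H :=
  Subalgebra.toSubmodule φ.range *
    (innerWords φ ψ hA hB * Subalgebra.toSubmodule φ.range)

theorem range_mul_wordSpan (φ : A →ₐ[k] H) (ψ : B →ₐ[k] H) (hA : A →ₗ[k] k) (hB : B →ₗ[k] k) :
    Subalgebra.toSubmodule φ.range * wordSpan φ ψ hA hB = wordSpan φ ψ hA hB := by
  rw [wordSpan, ← mul_assoc, (Subalgebra.isIdempotentElem_toSubmodule _).eq]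

theorem wordSpan_mul_range (φ : A →ₐ[k] H) (ψ : B →ₐ[k] H) (hA : A →ₗ[k] k) (hB : B →ₗ[k] k) :
    wordSpan φ ψ hA hB * Subalgebra.toSubmodule φ.range = wordSpan φ ψ hA hB := by
  simp only [wordSpan, mul_assoc, (Subalgebra.isIdempotentElem_toSubmodule φ.range).eq]

theorem IsFreeProd.eq_top_of_mul_le (h : IsFreeProd φ ψ) {T : Submodule k H} (one_le : 1 ≤ T)
    (hφ : T * Subalgebra.toSubmodule φ.range ≤ T) (hψ : T * Subalgebra.toSubmodule ψ.range ≤ T) :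
    T = ⊤ := by
  let S : Subalgebra k H :=
    { carrier := {x | ∀ y ∈ T, y * x ∈ T}
      mul_mem' := fun {x x'} hx hx' y hy => mul_assoc y x x' ▸ hx' _ (hx _ hy)
      add_mem' := fun {x x'} hx hx' y hy => mul_add y x x' ▸ add_mem (hx _ hy) (hx' _ hy)
      algebraMap_mem' := fun c y hy => by
        rw [← Algebra.commutes, ← Algebra.smul_def]
        exact Submodule.smul_mem _ c hy }
  refine eq_top_iff.2 fun x _ => ?_
  rw [← one_mul x]
  exact h.mem_of_range_le S (fun _ hx y hy => hφ (Submodule.mul_mem_mul hy hx))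
    (fun _ hx y hy => hψ (Submodule.mul_mem_mul hy hx)) x 1 (Submodule.one_le.1 one_le)

theorem IsFreeProd.range_sup_wordSpan (h : IsFreeProd φ ψ) (hA_one : hA 1 = 1)
    (hB_one : hB 1 = 1) : Subalgebra.toSubmodule φ.range ⊔ wordSpan φ ψ hA hB = ⊤ := by
  set P := Subalgebra.toSubmodule φ.range
  set A₀ := (LinearMap.ker hA).map φ.toLinearMap
  set B₀ := (LinearMap.ker hB).map ψ.toLinearMap
  set S := Subalgebra.toSubmodule (Algebra.adjoin k (↑(A₀ * B₀) : Set H))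
  have P_eq : P = 1 + A₀ := toSubmodule_range_eq_one_add_map_ker φ hA_one
  have P_mul_P : P * P = P := Subalgebra.isIdempotentElem_toSubmodule φ.range
  have Q_eq : Subalgebra.toSubmodule ψ.range = 1 + B₀ :=
    toSubmodule_range_eq_one_add_map_ker ψ hB_one
  have B₀_mul_B₀ : B₀ * B₀ ≤ 1 + B₀ := by
    rw [← Q_eq, ← (Subalgebra.isIdempotentElem_toSubmodule ψ.range).eq, Q_eq]
    exact mul_le_mul' le_add_self le_add_self
  have A₀_mul_B₀_le : A₀ * B₀ ≤ S := Algebra.subset_adjoin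
  have S_mul_le : S * (A₀ * B₀) ≤ S :=
    (mul_le_mul' le_rfl A₀_mul_B₀_le).trans (Subalgebra.isIdempotentElem_toSubmodule _).le
  have T_eq : P ⊔ wordSpan φ ψ hA hB = P * (1 + B₀ * S * P) := by
    rw [mul_add, mul_one]
    rfl
  refine h.eq_top_of_mul_le ?_ ?_ ?_
  · exact le_sup_of_le_left (Submodule.one_le.2 (one_mem φ.range))
  · rw [← Submodule.add_eq_sup, add_mul, wordSpan_mul_range, P_mul_P]
  · rw [T_eq, Q_eq, mul_assoc]
    gcongr
    rw [P_eq]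
    exact one_add_mul_one_add_le (Submodule.one_le.2 (Subalgebra.one_mem _)) S_mul_le
      (toSubmodule_adjoin_le_one_add_mul _) B₀_mul_B₀

end ReducedWords

section Fock

variable {k A B H : Type u} [Field k] [Ring A] [Algebra k A] [Ring B] [Algebra k B] [Ring H]
  [Algebra k H] {φ : A →ₐ[k] H} {ψ : B →ₐ[k] H} {hA : A →ₗ[k] k} {hB : B →ₗ[k] k}

/-- The decomposition `A ≃ k × ker h` given by a normalized functional `h`. -/
def splitKer (hA_one : hA 1 = 1) : A ≃ₗ[k] k × LinearMap.ker hA :=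
  let sub : A →ₗ[k] A := LinearMap.id - LinearMap.toSpanSingleton k A 1 ∘ₗ hA
  have sub_mem (a : A) : sub a ∈ LinearMap.ker hA := by simp [sub, hA_one]
  LinearEquiv.ofLinearMap (hA.prod (sub.codRestrict _ sub_mem))
    ((LinearMap.toSpanSingleton k A 1).coprod (LinearMap.ker hA).subtype)
    (by ext x <;> simp [sub, hA_one]) (by ext; simp [sub])

/-- The decomposition `A ⊗ Z ≃ Z × (ker h ⊗ Z)` given by a normalized functional `h`. -/
def splitEquiv (hA_one : hA 1 = 1) (Z : Type u) [AddCommGroup Z] [Module k Z] :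
    A ⊗[k] Z ≃ₗ[k] Z × (LinearMap.ker hA ⊗[k] Z) :=
  (splitKer hA_one).rTensor Z ≪≫ₗ TensorProduct.prodLeft k k k (LinearMap.ker hA) Z ≪≫ₗ
    (TensorProduct.lid k Z).prodCongr (LinearEquiv.refl k _)

variable {Z : Type u} [AddCommGroup Z] [Module k Z]

theorem splitEquiv_one_tmul (hA_one : hA 1 = 1) (z : Z) :
    splitEquiv hA_one Z (1 ⊗ₜ z) = (z, 0) := by
  have split_one : splitKer hA_one 1 = (1, 0) :=
    (LinearEquiv.eq_symm_apply _).1 (by simp [splitKer])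
  simp [splitEquiv, split_one]

theorem splitEquiv_tmul_of_ker (hA_one : hA 1 = 1) (a : LinearMap.ker hA) (z : Z) :
    splitEquiv hA_one Z (a ⊗ₜ z) = (0, a ⊗ₜ z) := by
  have split_ker : splitKer hA_one a = (0, a) :=
    (LinearEquiv.eq_symm_apply _).1 (by simp [splitKer])
  simp [splitEquiv, split_ker]

theorem exists_equiv_prod_tensor (k X : Type u) [Field k] [AddCommGroup X] [Module k X] :
    ∃ (T : Type u) (_ : AddCommGroup T) (_ : Module k T), Nonempty (T ≃ₗ[k] k × (X ⊗[k] T)) := by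
  let b := Module.Basis.ofVectorSpace k X
  let J := Module.Basis.ofVectorSpaceIndex k X
  let words : Module.Basis (List J) k (List J →₀ k) := Finsupp.basisSingleOne
  let headTail : List J ≃ Unit ⊕ (J × List J) :=
    { toFun
        | [] => Sum.inl ()
        | x :: l => Sum.inr (x, l)
      invFun
        | Sum.inl _ => []
        | Sum.inr (x, l) => x :: l
      left_inv := by rintro (_ | _) <;> rfl
      right_inv := by rintro (_ | _) <;> rfl }
  exact ⟨_, inferInstance, inferInstance,
    ⟨words.equiv ((Module.Basis.singleton Unit k).prod (b.tensorProduct words)) headTail⟩⟩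

theorem exists_fock (hA_one : hA 1 = 1) (hB_one : hB 1 = 1) :
    ∃ (T L : Type u) (_ : AddCommGroup T) (_ : Module k T) (_ : AddCommGroup L) (_ : Module k L)
      (e : B ⊗[k] T ≃ₗ[k] k × (A ⊗[k] L)), (∃ t, e (1 ⊗ₜ t) = (1, 0)) ∧
        (∀ (a : LinearMap.ker hA) l, ∃ t, e (1 ⊗ₜ t) = (0, (a : A) ⊗ₜ l)) ∧
          ∀ (b : LinearMap.ker hB) t, ∃ l, e ((b : B) ⊗ₜ t) = (0, 1 ⊗ₜ l) := by
  obtain ⟨T, _, _, ⟨j⟩⟩ := exists_equiv_prod_tensor k (LinearMap.ker hA ⊗[k] LinearMap.ker hB)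
  let L := LinearMap.ker hB ⊗[k] T
  let peel : T ≃ₗ[k] k × (LinearMap.ker hA ⊗[k] L) :=
    j ≪≫ₗ (LinearEquiv.refl k k).prodCongr (TensorProduct.assoc k _ _ _)
  let e : B ⊗[k] T ≃ₗ[k] k × (A ⊗[k] L) :=
    splitEquiv hB_one T ≪≫ₗ peel.prodCongr (LinearEquiv.refl k L) ≪≫ₗ
      LinearEquiv.prodAssoc k k (LinearMap.ker hA ⊗[k] L) L ≪≫ₗ
      (LinearEquiv.refl k k).prodCongr (LinearEquiv.prodComm k _ _ ≪≫ₗ (splitEquiv hA_one L).symm)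
  have e_one_tmul (c : k) (x : LinearMap.ker hA ⊗[k] L) :
      e (1 ⊗ₜ peel.symm (c, x)) = (c, (splitEquiv hA_one L).symm (0, x)) := by
    simp only [e, LinearEquiv.trans_apply, splitEquiv_one_tmul, LinearEquiv.prodCongr_apply,
      LinearEquiv.apply_symm_apply]
    rfl
  have e_ker_tmul (b : LinearMap.ker hB) (t : T) :
      e ((b : B) ⊗ₜ t) = (0, (splitEquiv hA_one L).symm (b ⊗ₜ t, 0)) := by
    simp only [e, LinearEquiv.trans_apply, splitEquiv_tmul_of_ker, LinearEquiv.prodCongr_apply,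
      map_zero]
    rfl
  refine ⟨T, L, inferInstance, inferInstance, inferInstance, inferInstance, e,
    ⟨peel.symm (1, 0), ?_⟩, fun a l => ⟨peel.symm (0, a ⊗ₜ l), ?_⟩,
    fun b t => ⟨b ⊗ₜ t, ?_⟩⟩
  · rw [e_one_tmul, Prod.mk_zero_zero, map_zero]
  · rw [e_one_tmul, (LinearEquiv.symm_apply_eq _).2 (splitEquiv_tmul_of_ker hA_one a l).symm]
  · rw [e_ker_tmul, (LinearEquiv.symm_apply_eq _).2 (splitEquiv_one_tmul hA_one (b ⊗ₜ t)).symm]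

theorem IsFreeProd.exists_action (h : IsFreeProd φ ψ) (ε : A →ₐ[k] k) {T L : Type u}
    [AddCommGroup T] [Module k T] [AddCommGroup L] [Module k L]
    (e : B ⊗[k] T ≃ₗ[k] k × (A ⊗[k] L)) :
    ∃ τ : Hᵐᵒᵖ →ₐ[k] Module.End k (k × (A ⊗[k] L)),
      (∀ a c z, τ (MulOpposite.op (φ a)) (c, z) = (ε a * c, MulOpposite.op a • z)) ∧
        ∀ b z, τ (MulOpposite.op (ψ b)) (e z) = e (MulOpposite.op b • z) := by
  let σA : Aᵐᵒᵖ →ₐ[k] Module.End k (k × (A ⊗[k] L)) :=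
    (LinearMap.prodMapAlgHom k k (A ⊗[k] L)).comp
      (((Algebra.lsmul k k k).comp (ε.fromOpposite fun _ _ => Commute.all _ _)).prod
        (Algebra.lsmul k k (A ⊗[k] L)))
  let σB : Bᵐᵒᵖ →ₐ[k] Module.End k (k × (A ⊗[k] L)) :=
    (e.conjAlgEquiv k).toAlgHom.comp (Algebra.lsmul k k (B ⊗[k] T))
  obtain ⟨τ, τ_φ, τ_ψ⟩ := h.exists_opLift (R := Module.End k (k × (A ⊗[k] L))) σA σB
  refine ⟨τ, fun a c z => ?_, fun b z => ?_⟩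
  · rw [τ_φ]
    rfl
  · rw [τ_ψ]
    change e (MulOpposite.op b • e.symm (e z)) = _
    rw [LinearEquiv.symm_apply_apply]

theorem IsFreeProd.exists_vacuum (h : IsFreeProd φ ψ) (ε : A →ₐ[k] k) (hA_one : hA 1 = 1)
    (hB_one : hB 1 = 1) :
    ∃ (N : Type u) (_ : AddCommGroup N) (_ : Module k N) (τ : Hᵐᵒᵖ →ₐ[k] Module.End k N)
      (Ω : N) (R : Submodule k N) (f : N →ₗ[k] k),
      f Ω = 1 ∧ (∀ a, τ (MulOpposite.op (φ a)) Ω = ε a • Ω) ∧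
        (∀ b ∈ LinearMap.ker hB, τ (MulOpposite.op (ψ b)) Ω ∈ R) ∧
        (∀ a ∈ LinearMap.ker hA, ∀ b ∈ LinearMap.ker hB, ∀ r ∈ R,
          τ (MulOpposite.op (φ a * ψ b)) r ∈ R) ∧
        ∀ a, ∀ r ∈ R, f (τ (MulOpposite.op (φ a)) r) = 0 := by
  obtain ⟨T, L, _, _, _, _, e, ⟨t₀, ht₀⟩, exists_of_A, exists_of_B⟩ :=
    exists_fock hA_one hB_one
  obtain ⟨τ, act_φ, act_ψ⟩ := h.exists_action ε e
  have act_ker_φ (a : A) (ha : a ∈ LinearMap.ker hA) (l : L) :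
      ∃ t, τ (MulOpposite.op (φ a)) (0, 1 ⊗ₜ l) = e (1 ⊗ₜ t) := by
    obtain ⟨t, ht⟩ := exists_of_A ⟨a, ha⟩ l
    refine ⟨t, ?_⟩
    rw [act_φ, mul_zero, ht, TensorProduct.smul_tmul', op_smul_eq_mul, one_mul]
  have act_ker_ψ (b : B) (hb : b ∈ LinearMap.ker hB) (t : T) :
      ∃ l, τ (MulOpposite.op (ψ b)) (e (1 ⊗ₜ t)) = (0, 1 ⊗ₜ l) := by
    obtain ⟨l, hl⟩ := exists_of_B ⟨b, hb⟩ t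
    refine ⟨l, ?_⟩
    rw [act_ψ, ← hl, TensorProduct.smul_tmul', op_smul_eq_mul, one_mul]
  refine ⟨k × (A ⊗[k] L), inferInstance, inferInstance, τ, (1, 0),
    LinearMap.range (LinearMap.inr k k (A ⊗[k] L) ∘ₗ TensorProduct.mk k A L 1),
    LinearMap.fst k k (A ⊗[k] L), rfl, fun a => ?_, fun b hb => ?_, ?_, ?_⟩
  · rw [act_φ, smul_zero, Prod.smul_mk, smul_zero, smul_eq_mul]
  · obtain ⟨l, hl⟩ := act_ker_ψ b hb t₀
    exact ⟨l, (ht₀ ▸ hl).symm⟩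
  · rintro a ha b hb _ ⟨l, rfl⟩
    obtain ⟨t, ht⟩ := act_ker_φ a ha l
    obtain ⟨l', hl'⟩ := act_ker_ψ b hb t
    refine ⟨l', ?_⟩
    rw [MulOpposite.op_mul, map_mul]
    exact ((congrArg (τ (MulOpposite.op (ψ b))) ht).trans hl').symm
  · rintro a _ ⟨l, rfl⟩
    exact (congrArg Prod.fst (act_φ a 0 (1 ⊗ₜ l))).trans (mul_zero _)

/-- The elements of `H` whose right action on `N` preserves `R`. -/
def rightStabilizer {N : Type u} [AddCommGroup N] [Module k N] (τ : Hᵐᵒᵖ →ₐ[k] Module.End k N)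
    (R : Submodule k N) : Subalgebra k H where
  carrier := {x | ∀ r ∈ R, τ (MulOpposite.op x) r ∈ R}
  mul_mem' {x y} hx hy r hr := by
    rw [MulOpposite.op_mul, map_mul]
    exact hy _ (hx r hr)
  add_mem' {x y} hx hy r hr := by
    rw [MulOpposite.op_add, map_add]
    exact add_mem (hx r hr) (hy r hr)
  algebraMap_mem' c r hr := by
    rw [← MulOpposite.algebraMap_apply, AlgHom.commutes]
    exact R.smul_mem c hr

theorem act_innerWords_mem {N : Type u} [AddCommGroup N] [Module k N]
    {τ : Hᵐᵒᵖ →ₐ[k] Module.End k N} {Ω : N} {R : Submodule k N}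
    (hΩ : ∀ b ∈ LinearMap.ker hB, τ (MulOpposite.op (ψ b)) Ω ∈ R)
    (hR : ∀ a ∈ LinearMap.ker hA, ∀ b ∈ LinearMap.ker hB, ∀ r ∈ R,
      τ (MulOpposite.op (φ a * ψ b)) r ∈ R) {x : H} (hx : x ∈ innerWords φ ψ hA hB) :
    τ (MulOpposite.op x) Ω ∈ R := by
  have mul_le : (LinearMap.ker hA).map φ.toLinearMap * (LinearMap.ker hB).map ψ.toLinearMap ≤
      Subalgebra.toSubmodule (rightStabilizer τ R) := by
    refine Submodule.mul_le.2 ?_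
    rintro _ ⟨a, ha, rfl⟩ _ ⟨b, hb, rfl⟩
    exact hR a ha b hb
  let orbit : H →ₗ[k] N :=
    LinearMap.applyₗ Ω ∘ₗ τ.toLinearMap ∘ₗ (MulOpposite.opLinearEquiv k).toLinearMap
  refine (Submodule.mul_le (P := R.comap orbit)).2 ?_ hx
  rintro _ ⟨b, hb, rfl⟩ s hs
  change τ (MulOpposite.op (ψ b * s)) Ω ∈ R
  rw [MulOpposite.op_mul, map_mul]
  exact Algebra.adjoin_le mul_le hs _ (hΩ b hb)

theorem IsFreeProd.exists_functional (h : IsFreeProd φ ψ) (ε : A →ₐ[k] k) (hA_one : hA 1 = 1)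
    (hB_one : hB 1 = 1) :
    ∃ f : H →ₗ[k] k, (∀ a, f (φ a) = ε a) ∧ wordSpan φ ψ hA hB ≤ LinearMap.ker f := by
  obtain ⟨N, _, _, τ, Ω, R, f, f_Ω, Ω_φ, Ω_ψ, R_word, f_R⟩ := h.exists_vacuum ε hA_one hB_one
  let coeff : H →ₗ[k] k :=
    f ∘ₗ LinearMap.applyₗ Ω ∘ₗ τ.toLinearMap ∘ₗ (MulOpposite.opLinearEquiv k).toLinearMap
  have coeff_mul (x y : H) :
      coeff (x * y) = f (τ (MulOpposite.op y) (τ (MulOpposite.op x) Ω)) := by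
    change f (τ (MulOpposite.op (x * y)) Ω) = _
    rw [MulOpposite.op_mul, map_mul]
    rfl
  have inner_mul_range_le :
      innerWords φ ψ hA hB * Subalgebra.toSubmodule φ.range ≤ LinearMap.ker coeff := by
    refine Submodule.mul_le.2 ?_
    rintro x hx _ ⟨a, rfl⟩
    exact (coeff_mul x _).trans (f_R a _ (act_innerWords_mem Ω_ψ R_word hx))
  refine ⟨coeff, fun a => ?_, Submodule.mul_le.2 ?_⟩
  · change f (τ (MulOpposite.op (φ a)) Ω) = ε a
    rw [Ω_φ, map_smul, f_Ω, smul_eq_mul, mul_one]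
  · rintro _ ⟨a, rfl⟩ y hy
    have coeff_y : coeff y = 0 := inner_mul_range_le hy
    refine (coeff_mul _ y).trans ((congrArg (f <| τ (MulOpposite.op y) ·) (Ω_φ a)).trans ?_)
    rw [map_smul, map_smul]
    exact (congrArg (ε a • ·) coeff_y).trans (smul_zero _)

end Fock

section FreeProductExpectation

open Coalgebra

variable {k A B H : Type u} [Field k] [Ring A] [HopfAlgebra k A] [Ring B] [HopfAlgebra k B]
  [Ring H] [HopfAlgebra k H] {φ : A →ₐc[k] H} {ψ : B →ₐc[k] H} {hA : A →ₗ[k] k} {hB : B →ₗ[k] k}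

theorem comul_bialgHom (φ : A →ₐc[k] H) (a : A) :
    comul (R := k) (φ a) = TensorProduct.map (φ : A →ₗ[k] H) φ (comul (R := k) a) :=
  (CoalgHomClass.map_comp_comul_apply φ a).symm

theorem IsSubcoalgebra.rTensor_comul_eq_zero {M : Submodule k H} (hM : IsSubcoalgebra M)
    {N : Type u} [AddCommGroup N] [Module k N] {f : H →ₗ[k] N} (hf : M ≤ LinearMap.ker f) {m : H}
    (hm : m ∈ M) : f.rTensor H (comul m) = 0 := by
  have map₂_le : Submodule.map₂ (TensorProduct.mk k H H) M M ≤ LinearMap.ker (f.rTensor H) :=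
    Submodule.map₂_le.2 fun x hx y _ =>
      (congrArg (· ⊗ₜ[k] y) (LinearMap.mem_ker.1 (hf hx))).trans (zero_tmul _ _)
  exact map₂_le (hM (Submodule.mem_map_of_mem hm))

theorem IsSubcoalgebra.lTensor_comul_eq_zero {M : Submodule k H} (hM : IsSubcoalgebra M)
    {N : Type u} [AddCommGroup N] [Module k N] {f : H →ₗ[k] N} (hf : M ≤ LinearMap.ker f) {m : H}
    (hm : m ∈ M) : f.lTensor H (comul m) = 0 := by
  have map₂_le : Submodule.map₂ (TensorProduct.mk k H H) M M ≤ LinearMap.ker (f.lTensor H) :=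
    Submodule.map₂_le.2 fun x _ y hy =>
      (congrArg (x ⊗ₜ[k] ·) (LinearMap.mem_ker.1 (hf hy))).trans (tmul_zero _ _)
  exact map₂_le (hM (Submodule.mem_map_of_mem hm))

theorem isExpectation_of_complement {E : H →ₗ[k] A} {M : Submodule k H} (hM : IsSubcoalgebra M)
    (sup_eq : Subalgebra.toSubmodule (φ : A →ₐ[k] H).range ⊔ M = ⊤)
    (range_mul : Subalgebra.toSubmodule (φ : A →ₐ[k] H).range * M ≤ M)
    (mul_range : M * Subalgebra.toSubmodule (φ : A →ₐ[k] H).range ≤ M)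
    (E_φ : ∀ a, E (φ a) = a) (E_M : M ≤ LinearMap.ker E) : IsExpectation φ E := by
  have φ_mem (a : A) : φ a ∈ Subalgebra.toSubmodule (φ : A →ₐ[k] H).range := ⟨a, rfl⟩
  have exists_add (h : H) : ∃ a, ∃ m ∈ M, φ a + m = h := by
    obtain ⟨_, ⟨a, rfl⟩, m, hm, eq⟩ :=
      Submodule.mem_sup.1 (sup_eq.ge (Submodule.mem_top (x := h)))
    exact ⟨a, m, hm, eq⟩
  have E_add (a : A) {m : H} (hm : m ∈ M) : E (φ a + m) = a := by
    rw [map_add, E_φ, LinearMap.mem_ker.1 (E_M hm), add_zero]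
  have E_comp : E ∘ₗ (φ : A →ₗ[k] H) = LinearMap.id := LinearMap.ext E_φ
  refine ⟨E_φ, fun a h => ?_, fun h a => ?_, fun h => ?_, fun h => ?_⟩ <;>
    obtain ⟨a', m, hm, rfl⟩ := exists_add h
  · rw [mul_add, ← map_mul φ, E_add _ (range_mul (Submodule.mul_mem_mul (φ_mem a) hm)), E_add _ hm]
  · rw [add_mul, ← map_mul φ, E_add _ (mul_range (Submodule.mul_mem_mul hm (φ_mem a))),
      E_add _ hm]
  · rw [map_add, map_add, hM.rTensor_comul_eq_zero E_M hm, add_zero, E_add _ hm, comul_bialgHom,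
      ← LinearMap.comp_apply, LinearMap.rTensor_comp_map, E_comp]
    rfl
  · rw [map_add, map_add, hM.lTensor_comul_eq_zero E_M hm, add_zero, E_add _ hm, comul_bialgHom,
      ← LinearMap.comp_apply, LinearMap.lTensor_comp_map, E_comp]
    rfl

theorem isSubcoalgebra_range (φ : A →ₐc[k] H) :
    IsSubcoalgebra (Subalgebra.toSubmodule (φ : A →ₐ[k] H).range) := by
  have range_eq : Subalgebra.toSubmodule (φ : A →ₐ[k] H).range =
      (⊤ : Submodule k A).map (φ : A →ₗ[k] H) := by
    rw [Submodule.map_top]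
    rfl
  exact range_eq ▸ isSubcoalgebra_top.map φ

theorem isSubcoalgebra_wordSpan (φ : A →ₐc[k] H) (ψ : B →ₐc[k] H) (hhA : IsHaar hA)
    (hhB : IsHaar hB) : IsSubcoalgebra (wordSpan (φ : A →ₐ[k] H) (ψ : B →ₐ[k] H) hA hB) :=
  have ker_A := hhA.isSubcoalgebra_ker.map φ
  have ker_B := hhB.isSubcoalgebra_ker.map ψ
  (isSubcoalgebra_range φ).mul
    ((ker_B.mul (ker_A.mul ker_B).adjoin).mul (isSubcoalgebra_range φ))

theorem IsFreeProd.exists_isExpectation (h : IsFreeProd (φ : A →ₐ[k] H) (ψ : B →ₐ[k] H))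
    (hhA : IsHaar hA) (hhB : IsHaar hB) : ∃ E : H →ₗ[k] A, IsExpectation φ E := by
  obtain ⟨f, f_φ, f_wordSpan⟩ :=
    h.exists_functional (Bialgebra.counitAlgHom k A) hhA.map_one hhB.map_one
  obtain ⟨π, π_φ, -⟩ := h.exists_lift (AlgHom.id k A)
    ((Algebra.ofId k A).comp (Bialgebra.counitAlgHom k B))
  let E : H →ₗ[k] A :=
    π.toLinearMap ∘ₗ (TensorProduct.lid k H).toLinearMap ∘ₗ f.rTensor H ∘ₗ comul
  have hM := isSubcoalgebra_wordSpan φ ψ hhA hhB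
  refine ⟨E, isExpectation_of_complement hM (h.range_sup_wordSpan hhA.map_one hhB.map_one)
    (range_mul_wordSpan _ _ _ _).le (wordSpan_mul_range _ _ _ _).le (fun a => ?_) fun m hm => ?_⟩
  · have f_comp : f ∘ₗ (φ : A →ₗ[k] H) = counit (R := k) (A := A) := LinearMap.ext f_φ
    have slice (z : k ⊗[k] A) :
        π (TensorProduct.lid k H ((φ : A →ₗ[k] H).lTensor k z)) = TensorProduct.lid k A z := by
      induction z with
      | zero => simp only [map_zero]
      | add y z hy hz => simp only [map_add, hy, hz]
      | tmul c x => exact (map_smul π c (φ x)).trans (congrArg (c • ·) (π_φ x))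
    have map_eq : TensorProduct.map (counit (R := k) (A := A)) (φ : A →ₗ[k] H) =
        (φ : A →ₗ[k] H).lTensor k ∘ₗ counit.rTensor A := by
      rw [LinearMap.lTensor_comp_rTensor]
    change π (TensorProduct.lid k H (f.rTensor H (comul (φ a)))) = a
    rw [comul_bialgHom, ← LinearMap.comp_apply (f.rTensor H), LinearMap.rTensor_comp_map, f_comp,
      map_eq, LinearMap.comp_apply, slice, rTensor_counit_comul, TensorProduct.lid_tmul, one_smul]
  · change π (TensorProduct.lid k H (f.rTensor H (comul m))) = 0
    rw [hM.rTensor_comul_eq_zero f_wordSpan hm, map_zero, map_zero]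

end FreeProductExpectation

section TwistedDerivation

variable {k A B H R : Type u} [Field k] [Ring A] [Algebra k A] [Ring B] [Algebra k B] [Ring H]
  [Algebra k H] [Ring R] [Algebra k R]

/-- A linear map `D` which is a derivation for the left action of the algebra through `ε` and its
right action through `ρ`. -/
def IsTwistedDerivation (ε : A →ₐ[k] k) (ρ : A →ₐ[k] R) (D : A →ₗ[k] R) : Prop :=
  ∀ x y, D (x * y) = D x * ρ y + ε x • D y

theorem isTwistedDerivation_zero (ε : A →ₐ[k] k) (ρ : A →ₐ[k] R) : IsTwistedDerivation ε ρ 0 :=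
  fun x y => by simp

theorem isTwistedDerivation_sub_smul_one (ε : A →ₐ[k] k) (ρ : A →ₐ[k] R) :
    IsTwistedDerivation ε ρ (ρ.toLinearMap - (Algebra.ofId k R).toLinearMap ∘ₗ ε.toLinearMap) :=
  fun x y => by simp [Algebra.ofId_apply, Algebra.algebraMap_eq_smul_one, sub_mul, mul_smul,
    smul_sub]

namespace IsTwistedDerivation

variable {ε : A →ₐ[k] k} {ρ : A →ₐ[k] R} {D : A →ₗ[k] R}

/-- The representation by upper triangular matrices corresponding to a twisted derivation. -/
def toMatrix (hD : IsTwistedDerivation ε ρ D) : A →ₐ[k] Matrix (Fin 2) (Fin 2) R :=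
  AlgHom.ofLinearMap
    { toFun := fun x => !![algebraMap k R (ε x), D x; 0, ρ x]
      map_add' := fun x y => by simp
      map_smul' := fun c x => by simp [← Algebra.smul_def] }
    (by
      have map_one : D 1 = 0 := by simpa using hD 1 1
      simp [map_one, Matrix.one_fin_two])
    (fun x y => by simp [hD x y, ← Algebra.smul_def, add_comm])

end IsTwistedDerivation

/-- The elements on which a matrix representation is upper triangular with diagonal `ε`, `ρ`. -/
def triangularLocus (τ : A →ₐ[k] Matrix (Fin 2) (Fin 2) R) (ε : A →ₐ[k] k) (ρ : A →ₐ[k] R) :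
    Subalgebra k A where
  carrier := {x | τ x = !![algebraMap k R (ε x), τ x 0 1; 0, ρ x]}
  mul_mem' {x y} hx hy := by
    rw [Set.mem_ofPred_eq] at hx hy ⊢
    rw [map_mul, hx, hy]
    simp [← Algebra.smul_def]
  add_mem' {x y} hx hy := by
    rw [Set.mem_ofPred_eq] at hx hy ⊢
    rw [map_add, hx, hy]
    simp
  algebraMap_mem' c := by
    rw [Set.mem_ofPred_eq, AlgHom.commutes, AlgHom.commutes, AlgHom.commutes,
      Matrix.eta_fin_two (algebraMap k _ c)]
    simp [Matrix.algebraMap_matrix_apply]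

theorem isTwistedDerivation_entry {τ : A →ₐ[k] Matrix (Fin 2) (Fin 2) R} {ε : A →ₐ[k] k}
    {ρ : A →ₐ[k] R} (hτ : ∀ x, τ x = !![algebraMap k R (ε x), τ x 0 1; 0, ρ x]) :
    IsTwistedDerivation ε ρ (Matrix.entryLinearMap k R 0 1 ∘ₗ τ.toLinearMap) := fun x y => by
  change τ (x * y) 0 1 = τ x 0 1 * ρ y + ε x • τ y 0 1
  rw [map_mul, Algebra.smul_def, add_comm]
  nth_rw 1 [hτ x, hτ y]
  simp [← Algebra.smul_def]

variable {φ : A →ₐ[k] H} {ψ : B →ₐ[k] H}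

theorem IsFreeProd.exists_isTwistedDerivation (h : IsFreeProd φ ψ) (ε : H →ₐ[k] k)
    (ρ : H →ₐ[k] R) : ∃ D : H →ₗ[k] R, IsTwistedDerivation ε ρ D ∧
      (∀ a, D (φ a) = ρ (φ a) - ε (φ a) • 1) ∧ ∀ b, D (ψ b) = 0 := by
  have hA := isTwistedDerivation_sub_smul_one (ε.comp φ) (ρ.comp φ)
  have hB := isTwistedDerivation_zero (ε.comp ψ) (ρ.comp ψ)
  obtain ⟨τ, τ_φ, τ_ψ⟩ := h.exists_lift hA.toMatrix hB.toMatrix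
  have τ_eq (x : H) : τ x = !![algebraMap k R (ε x), τ x 0 1; 0, ρ x] := by
    refine h.mem_of_range_le (triangularLocus τ ε ρ) ?_ ?_ x
    · rintro _ ⟨a, rfl⟩
      change τ (φ a) = !![algebraMap k R (ε (φ a)), τ (φ a) 0 1; 0, ρ (φ a)]
      rw [τ_φ]
      rfl
    · rintro _ ⟨b, rfl⟩
      change τ (ψ b) = !![algebraMap k R (ε (ψ b)), τ (ψ b) 0 1; 0, ρ (ψ b)]
      rw [τ_ψ]
      rfl
  refine ⟨_, isTwistedDerivation_entry τ_eq, fun a => ?_, fun b => ?_⟩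
  · change τ (φ a) 0 1 = _
    rw [τ_φ, ← Algebra.algebraMap_eq_smul_one]
    rfl
  · change τ (ψ b) 0 1 = 0
    rw [τ_ψ]
    rfl

end TwistedDerivation

namespace YetterDrinfeld

open Coalgebra RightComodule

section Trivial

variable {k A H : Type u} [Field k] [Ring A] [HopfAlgebra k A] [Ring H] [HopfAlgebra k H]
  (φ : A →ₐc[k] H)

theorem trivial_act (a : A) (c : trivial k A) :
    MulOpposite.op a • c = counit (R := k) a • c := rfl

variable (k A) in
/-- The vector space underlying the trivial module. -/
def trivialEquiv : trivial k A ≃ₗ[k] k := LinearEquiv.refl k k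

variable (k H) in
/-- The free Yetter-Drinfeld module on the trivial comodule. -/
abbrev freeTrivial : YetterDrinfeld k H := free (trivial k H).comodule

variable (k H) in
/-- The right module underlying the free Yetter-Drinfeld module on the trivial comodule is the
regular one. -/
def freeTrivialEquiv : freeTrivial k H ≃ₗ[k] H := TensorProduct.rid k H

theorem freeTrivialEquiv_smul_unit (h : H) (c : trivial k H) :
    freeTrivialEquiv k H (MulOpposite.op h • freeUnit (trivial k H).comodule c) =
      trivialEquiv k H c • h :=
  (congrArg (freeTrivialEquiv k H) (tmul_eq_op_smul h c)).symm.trans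
    (TensorProduct.rid_tmul h (trivialEquiv k H c))

theorem freeTrivialEquiv_act (h : H) (x : freeTrivial k H) :
    freeTrivialEquiv k H (MulOpposite.op h • x) = freeTrivialEquiv k H x * h := by
  suffices eq : (freeTrivialEquiv k H).toLinearMap ∘ₗ rightAct k H (freeTrivial k H) h =
      LinearMap.mulRight k h ∘ₗ (freeTrivialEquiv k H).toLinearMap from LinearMap.congr_fun eq x
  refine free_linearMap_ext fun g c => ?_
  simp only [LinearMap.comp_apply, rightAct_apply, smul_smul, ← MulOpposite.op_mul,
    LinearEquiv.coe_coe, freeTrivialEquiv_smul_unit, LinearMap.mulRight_apply, smul_mul_assoc]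

theorem counit_freeTrivialEquiv (x : freeTrivial k H) :
    counit (R := k) (freeTrivialEquiv k H x) =
      trivialEquiv k H ((freeCounit (trivial k H)).toLin x) := by
  suffices eq : counit ∘ₗ (freeTrivialEquiv k H).toLinearMap =
      (trivialEquiv k H).toLinearMap ∘ₗ (freeCounit (trivial k H)).toLin from
    LinearMap.congr_fun eq x
  refine free_linearMap_ext fun h c => ?_
  simp only [LinearMap.comp_apply, LinearEquiv.coe_coe, (freeCounit (trivial k H)).map_act,
    freeCounit_unit, trivial_act, freeTrivialEquiv_smul_unit, map_smul, smul_eq_mul, mul_comm]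

/-- The identity of `k`, from the trivial module over `A` to the trivial module over `H`. -/
def trivialHom : RelHom φ (trivial k A) (trivial k H) where
  toLin := ((trivialEquiv k A).trans (trivialEquiv k H).symm).toLinearMap
  map_act a c := congrArg (· * trivialEquiv k A c) (CoalgHomClass.counit_comp_apply φ a).symm
  map_coact c := congrArg (trivialEquiv k A c ⊗ₜ[k] ·) (map_one φ).symm

/-- The canonical morphism from the module induced by the trivial module to the trivial module. -/
def indToTrivial : ind φ (trivial k A) ⟶ trivial k H := indLift (trivialHom φ)

/-- The canonical map from `k` to the module induced by the trivial module. -/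
def trivialUnit : trivial k H →ₗ[k] ind φ (trivial k A) := (indUnit φ (trivial k A)).toLin

theorem indToTrivial_unit (c : trivial k H) : (indToTrivial φ).toLin (trivialUnit φ c) = c :=
  indLift_unit (trivialHom φ) c

theorem epi_indToTrivial : Epi (indToTrivial φ) :=
  epi_of_surjective _ fun c => ⟨_, indToTrivial_unit φ c⟩

theorem trivialUnit_act (a : A) (c : trivial k H) :
    MulOpposite.op (φ a) • trivialUnit φ c = trivialUnit φ (MulOpposite.op (φ a) • c) := by
  refine ((indUnit φ (trivial k A)).map_act a c).symm.trans ?_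
  exact congrArg (trivialUnit φ) ((trivialHom φ).map_act a c)

theorem isColinear_trivialUnit : IsColinear LinearMap.id (trivial k H).comodule
    (ind φ (trivial k A)).comodule (trivialUnit φ) := fun c =>
  ((indUnit φ (trivial k A)).map_coact c).trans
    (congrArg (trivialUnit φ c ⊗ₜ[k] ·) (map_one φ))

/-- The morphism from the free module on the trivial comodule to the module induced by the trivial
module. -/
def freeToInd : freeTrivial k H ⟶ ind φ (trivial k A) := freeHom (isColinear_trivialUnit φ)

theorem freeToInd_unit (c : trivial k H) :
    (freeToInd φ).toLin (freeUnit (trivial k H).comodule c) = trivialUnit φ c :=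
  freeHom_unit _ c

theorem freeToInd_comp_indToTrivial :
    freeToInd φ ≫ indToTrivial φ = freeCounit (trivial k H) :=
  free_hom_ext fun c => by rw [comp_toLin, freeToInd_unit, indToTrivial_unit, freeCounit_unit]

theorem exists_comp_freeToInd {N : Type u} [AddCommGroup N] [Module k N] (D : H →ₗ[k] N)
    (hD : ∀ a x, D (φ a * x) = counit (R := k) a • D x) :
    ∃ l : ind φ (trivial k A) →ₗ[k] N,
      l ∘ₗ (freeToInd φ).toLin = D ∘ₗ (freeTrivialEquiv k H).toLinearMap := by
  obtain ⟨l, hl⟩ := exists_indLin (φ := φ) (X := trivial k A)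
    ((LinearMap.lsmul k N ∘ₗ (trivialEquiv k A).toLinearMap).flip ∘ₗ D) fun h a c => by
      change (counit (R := k) a * trivialEquiv k A c) • D h = trivialEquiv k A c • D (φ a * h)
      rw [hD, smul_smul, mul_comm]
  refine ⟨l, free_linearMap_ext fun h c => ?_⟩
  rw [LinearMap.comp_apply, (freeToInd φ).map_act, freeToInd_unit, LinearMap.comp_apply,
    LinearEquiv.coe_coe, freeTrivialEquiv_smul_unit, D.map_smul]
  exact hl h c

end Trivial

section MayerVietoris

variable {k A B H : Type u} [Field k] [Ring A] [HopfAlgebra k A] [Ring B] [HopfAlgebra k B]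
  [Ring H] [HopfAlgebra k H] {φ : A →ₐc[k] H} {ψ : B →ₐc[k] H}

theorem freeToInd_jointly_injective (h : IsFreeProd (φ : A →ₐ[k] H) (ψ : B →ₐ[k] H))
    {x : freeTrivial k H} (hφ : (freeToInd φ).toLin x = 0) (hψ : (freeToInd ψ).toLin x = 0) :
    x = 0 := by
  obtain ⟨D, hD, D_φ, D_ψ⟩ :=
    h.exists_isTwistedDerivation (Bialgebra.counitAlgHom k H) (AlgHom.id k H)
  obtain ⟨l, hl⟩ := exists_comp_freeToInd φ (D - LinearMap.id) fun a y => by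
    have D_φ_mul : D (φ a * y) = (φ a - counit (R := k) (φ a) • 1) * y +
        counit (R := k) (φ a) • D y := (hD _ _).trans (congrArg (· * y + _) (D_φ a))
    rw [LinearMap.sub_apply, D_φ_mul, CoalgHomClass.counit_comp_apply, sub_mul, smul_one_mul]
    simp only [LinearMap.sub_apply, LinearMap.id_apply, smul_sub]
    abel
  obtain ⟨m, hm⟩ := exists_comp_freeToInd ψ D fun b y => by
    have D_ψ_mul : D (ψ b * y) = 0 * y + counit (R := k) (ψ b) • D y :=
      (hD _ _).trans (congrArg (· * y + _) (D_ψ b))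
    rw [D_ψ_mul, CoalgHomClass.counit_comp_apply, zero_mul, zero_add]
  have D_eq_self : D (freeTrivialEquiv k H x) - freeTrivialEquiv k H x = 0 :=
    (LinearMap.congr_fun hl x).symm.trans ((congrArg l hφ).trans (map_zero l))
  have D_eq_zero : D (freeTrivialEquiv k H x) = 0 :=
    (LinearMap.congr_fun hm x).symm.trans ((congrArg m hψ).trans (map_zero m))
  rw [D_eq_zero, zero_sub, neg_eq_zero] at D_eq_self
  exact (freeTrivialEquiv k H).map_eq_zero_iff.1 D_eq_self

theorem map_act_of_isFreeProd (h : IsFreeProd (φ : A →ₐ[k] H) (ψ : B →ₐ[k] H))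
    {X Y : YetterDrinfeld k H} {j : X →ₗ[k] Y}
    (hφ : ∀ a v, j (MulOpposite.op (φ a) • v) = MulOpposite.op (φ a) • j v)
    (hψ : ∀ b v, j (MulOpposite.op (ψ b) • v) = MulOpposite.op (ψ b) • j v) (x : H) (v : X) :
    j (MulOpposite.op x • v) = MulOpposite.op x • j v :=
  (LinearMap.congr_fun (h.comp_rightAction_eq (σ := Algebra.lsmul k k X) (τ := Algebra.lsmul k k Y)
    (fun a => LinearMap.ext fun v => (hφ a v).symm)
    (fun b => LinearMap.ext fun v => (hψ b v).symm) x) v).symm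

theorem exists_trivial_desc (h : IsFreeProd (φ : A →ₐ[k] H) (ψ : B →ₐ[k] H))
    {W : YetterDrinfeld k H} {f : ind φ (trivial k A) ⟶ W} {g : ind ψ (trivial k B) ⟶ W}
    (hfg : freeToInd φ ≫ f = freeToInd ψ ≫ g) :
    ∃ t : trivial k H ⟶ W, indToTrivial φ ≫ t = f ∧ indToTrivial ψ ≫ t = g := by
  have unit_eq (c : trivial k H) : f.toLin (trivialUnit φ c) = g.toLin (trivialUnit ψ c) := by
    have := Hom.congr_fun hfg (freeUnit (trivial k H).comodule c)
    rwa [comp_toLin, comp_toLin, freeToInd_unit, freeToInd_unit] at this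
  let t : trivial k H ⟶ W := Hom.mk (f.toLin ∘ₗ trivialUnit φ)
    (fun x c => map_act_of_isFreeProd h
      (fun a c => by
        rw [LinearMap.comp_apply, LinearMap.comp_apply, ← trivialUnit_act, f.map_act])
      (fun b c => by
        rw [LinearMap.comp_apply, LinearMap.comp_apply, unit_eq, unit_eq, ← trivialUnit_act,
          g.map_act]) x c)
    (IsColinear.comp (φ := LinearMap.id) (ψ := LinearMap.id) f.map_coact
      (isColinear_trivialUnit φ))
  refine ⟨t, ind_hom_ext fun c => ?_, ind_hom_ext fun c => ?_⟩
  · exact congrArg t.toLin (indToTrivial_unit φ c)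
  · exact (congrArg t.toLin (indToTrivial_unit ψ c)).trans (unit_eq c)

theorem isPushout_freeToInd (h : IsFreeProd (φ : A →ₐ[k] H) (ψ : B →ₐ[k] H)) :
    IsPushout (freeToInd φ) (freeToInd ψ) (indToTrivial φ) (indToTrivial ψ) := by
  have := epi_indToTrivial φ
  refine ⟨⟨by rw [freeToInd_comp_indToTrivial, freeToInd_comp_indToTrivial]⟩,
    ⟨Limits.PushoutCocone.IsColimit.mk _
      (fun s => (exists_trivial_desc h s.condition).choose)
      (fun s => (exists_trivial_desc h s.condition).choose_spec.1)
      (fun s => (exists_trivial_desc h s.condition).choose_spec.2)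
      fun s m hm _ => ?_⟩⟩
  rw [← cancel_epi (indToTrivial φ), hm, (exists_trivial_desc h s.condition).choose_spec.1]

theorem mayerVietoris_shortExact (h : IsFreeProd (φ : A →ₐ[k] H) (ψ : B →ₐ[k] H)) :
    (isPushout_freeToInd h).shortComplex.ShortExact where
  exact := (isPushout_freeToInd h).exact_shortComplex
  epi_g := (isPushout_freeToInd h).epi_shortComplex_g
  mono_f := by
    refine mono_of_injective _ ((injective_iff_map_eq_zero _).2 fun x hx => ?_)
    let fst : ind φ (trivial k A) ⊞ ind ψ (trivial k B) ⟶ _ := Limits.biprod.fst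
    let snd : ind φ (trivial k A) ⊞ ind ψ (trivial k B) ⟶ _ := Limits.biprod.snd
    have comp_fst := Limits.biprod.lift_fst (freeToInd φ) (-freeToInd ψ)
    have comp_snd := Limits.biprod.lift_snd (freeToInd φ) (-freeToInd ψ)
    refine freeToInd_jointly_injective h ?_ ?_
    · refine (Hom.congr_fun comp_fst x).symm.trans ?_
      exact (congrArg fst.toLin hx).trans (map_zero _)
    · refine neg_eq_zero.1 ((Hom.congr_fun comp_snd x).symm.trans ?_)
      exact (congrArg snd.toLin hx).trans (map_zero _)

end MayerVietoris

end YetterDrinfeld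

theorem exists_ne_zero_counit_eq_zero {k A : Type u} [Field k] [Ring A] [Bialgebra k A]
    (hA : ¬ Function.Surjective (algebraMap k A)) :
    ∃ a : A, a ≠ 0 ∧ Coalgebra.counit (R := k) a = 0 := by
  obtain ⟨a, ha⟩ := not_forall.1 hA
  refine ⟨a - algebraMap k A (Coalgebra.counit a), fun h => ha ⟨_, (sub_eq_zero.1 h).symm⟩, ?_⟩
  rw [map_sub, Bialgebra.counit_algebraMap, sub_self]

theorem eq_zero_or_eq_zero_of_tmul_eq_zero {k V W : Type u} [Field k] [AddCommGroup V] [Module k V]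
    [AddCommGroup W] [Module k W] {v : V} {w : W} (h : v ⊗ₜ[k] w = 0) : v = 0 ∨ w = 0 := by
  refine or_iff_not_imp_right.2 fun hw => ?_
  refine (Module.forall_dual_apply_eq_zero_iff k v).1 fun f => ?_
  have f_smul_eq_zero : f v • w = 0 := by
    simpa only [LinearMap.rTensor_tmul, TensorProduct.lid_tmul, map_zero] using
      congrArg (fun z => TensorProduct.lid k W (f.rTensor W z)) h
  exact (smul_eq_zero.1 f_smul_eq_zero).resolve_right hw

theorem IsTwistedDerivation.mul_add_eq_zero {k H R : Type u} [Field k] [Ring H] [Algebra k H]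
    [Ring R] [Algebra k R] {ε : H →ₐ[k] k} {ρ : H →ₐ[k] R} {D : H →ₗ[k] R}
    (hD : IsTwistedDerivation ε ρ D) {t x : H} (ht : ε t = 1) (htx : t * x = 0) :
    D t * ρ x + D x = 0 := by
  rw [← one_smul k (D x), ← ht, ← hD, htx, map_zero]

theorem IsFreeProd.eq_zero_or_eq_zero_of_mul_eq_zero {k A B H : Type u} [Field k] [Ring A]
    [Algebra k A] [Ring B] [Algebra k B] [Ring H] [Algebra k H] {φ : A →ₐ[k] H} {ψ : B →ₐ[k] H}
    (h : IsFreeProd φ ψ) (ε : H →ₐ[k] k) {t : H} (ht : ε t = 1) {a : A} {b : B}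
    (hta : t * φ a = 0) (htb : t * ψ b = 0) : a = 0 ∨ b = 0 := by
  obtain ⟨ρ, ρ_φ, ρ_ψ⟩ := h.exists_lift (R := A ⊗[k] B) Algebra.TensorProduct.includeLeft
    Algebra.TensorProduct.includeRight
  obtain ⟨D, hD, D_φ, D_ψ⟩ := h.exists_isTwistedDerivation ε ρ
  have ε_φ : ε (φ a) = 0 := by rw [← one_mul (ε (φ a)), ← ht, ← map_mul, hta, map_zero]
  have D_t_mul_left : D t * (a ⊗ₜ[k] 1) + a ⊗ₜ[k] 1 = 0 := by
    simpa only [D_φ, ρ_φ, ε_φ, zero_smul, sub_zero, Algebra.TensorProduct.includeLeft_apply] using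
      hD.mul_add_eq_zero ht hta
  have D_t_mul_right : D t * (1 ⊗ₜ[k] b) = 0 := by
    simpa only [D_ψ, ρ_ψ, add_zero, Algebra.TensorProduct.includeRight_apply] using
      hD.mul_add_eq_zero ht htb
  have tmul_eq : a ⊗ₜ[k] b = (D t * (a ⊗ₜ[k] 1) + a ⊗ₜ[k] 1) * ((1 : A) ⊗ₜ[k] b) -
      D t * ((1 : A) ⊗ₜ[k] b) * (a ⊗ₜ[k] (1 : B)) := by
    simp only [add_mul, mul_assoc, Algebra.TensorProduct.tmul_mul_tmul, mul_one, one_mul,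
      add_sub_cancel_left]
  refine eq_zero_or_eq_zero_of_tmul_eq_zero (k := k) ?_
  rw [tmul_eq, D_t_mul_left, D_t_mul_right, zero_mul, zero_mul, sub_zero]

namespace YetterDrinfeld

open Coalgebra

section Projective

variable {k A B H : Type u} [Field k] [Ring A] [HopfAlgebra k A] [Ring B] [HopfAlgebra k B]
  [Ring H] [HopfAlgebra k H] {φ : A →ₐc[k] H} {ψ : B →ₐc[k] H}

variable (k H) in
theorem exists_integral [Projective (trivial k H)] :
    ∃ t : H, counit (R := k) t = 1 ∧ ∀ x, t * x = counit (R := k) x • t := by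
  have := epi_of_surjective _ (freeCounit_surjective (trivial k H))
  let s := Projective.factorThru (𝟙 _) (freeCounit (trivial k H))
  have hs : s ≫ freeCounit (trivial k H) = 𝟙 _ := Projective.factorThru_comp _ _
  let one : trivial k H := (trivialEquiv k H).symm 1
  refine ⟨freeTrivialEquiv k H (s.toLin one), ?_, fun x => ?_⟩
  · exact (counit_freeTrivialEquiv _).trans (congrArg (trivialEquiv k H) (Hom.congr_fun hs one))
  · rw [← freeTrivialEquiv_act, ← s.map_act, trivial_act, map_smul, map_smul]

theorem not_projective_trivial (h : IsFreeProd (φ : A →ₐ[k] H) (ψ : B →ₐ[k] H))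
    (hA : ¬ Function.Surjective (algebraMap k A)) (hB : ¬ Function.Surjective (algebraMap k B)) :
    ¬ Projective (trivial k H) := by
  intro hP
  obtain ⟨t, counit_t, t_mul⟩ := exists_integral k H
  obtain ⟨a, a_ne, counit_a⟩ := exists_ne_zero_counit_eq_zero hA
  obtain ⟨b, b_ne, counit_b⟩ := exists_ne_zero_counit_eq_zero hB
  have t_mul_φ : t * φ a = 0 := by
    rw [t_mul, CoalgHomClass.counit_comp_apply, counit_a, zero_smul]
  have t_mul_ψ : t * ψ b = 0 := by
    rw [t_mul, CoalgHomClass.counit_comp_apply, counit_b, zero_smul]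
  exact (h.eq_zero_or_eq_zero_of_mul_eq_zero (Bialgebra.counitAlgHom k H) counit_t t_mul_φ
    t_mul_ψ).elim a_ne b_ne

end Projective

section Dimension

variable {k A B H : Type u} [Field k] [Ring A] [HopfAlgebra k A] [Ring B] [HopfAlgebra k B]
  [Ring H] [HopfAlgebra k H] {φ : A →ₐc[k] H} {ψ : B →ₐc[k] H} {hA : A →ₗ[k] k} {hB : B →ₗ[k] k}

theorem hasProjectiveDimensionLT_trivial_iff (h : IsFreeProd (φ : A →ₐ[k] H) (ψ : B →ₐ[k] H))
    (hhA : IsHaar hA) (hhB : IsHaar hB) (n : ℕ) :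
    HasProjectiveDimensionLT (trivial k H) (n + 2) ↔
      HasProjectiveDimensionLT (trivial k A) (n + 2) ∧
        HasProjectiveDimensionLT (trivial k B) (n + 2) := by
  obtain ⟨EA, hEA⟩ := h.exists_isExpectation hhA hhB
  obtain ⟨EB, hEB⟩ := h.symm.exists_isExpectation hhB hhA
  have := induction_preservesMonomorphisms h (Bialgebra.counitAlgHom k B)
  have := induction_preservesMonomorphisms h.symm (Bialgebra.counitAlgHom k A)
  have hS := mayerVietoris_shortExact h
  have : Projective (freeTrivial k H) := projective_free (hEA.isHaar_comp hhA) _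
  have pd_free (m : ℕ) : HasProjectiveDimensionLT (freeTrivial k H) (m + 1) :=
    hasProjectiveDimensionLT_of_ge _ 1 _ (by omega)
  rw [← hasProjectiveDimensionLT_ind_iff hEA hhA, ← hasProjectiveDimensionLT_ind_iff hEB hhB]
  refine ⟨fun pd_H => ?_, fun ⟨pd_A, pd_B⟩ => ?_⟩
  · have : HasProjectiveDimensionLT (ind φ (trivial k A) ⊞ ind ψ (trivial k B)) (n + 2) :=
      hS.hasProjectiveDimensionLT_X₂ (n + 2) (pd_free (n + 1)) pd_H
    exact ⟨Retract.hasProjectiveDimensionLT (Y := ind φ (trivial k A) ⊞ ind ψ (trivial k B))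
        ⟨Limits.biprod.inl, Limits.biprod.fst, Limits.biprod.inl_fst⟩ _,
      Retract.hasProjectiveDimensionLT (Y := ind φ (trivial k A) ⊞ ind ψ (trivial k B))
        ⟨Limits.biprod.inr, Limits.biprod.snd, Limits.biprod.inr_snd⟩ _⟩
  · have : HasProjectiveDimensionLT (ind φ (trivial k A) ⊞ ind ψ (trivial k B)) (n + 2) :=
      inferInstance
    exact hS.hasProjectiveDimensionLT_X₃ (n + 1) (pd_free n) this

theorem cdGS_le_iff (n : ℕ) :
    cdGS k A ≤ n ↔ HasProjectiveDimensionLT (trivial k A) (n + 1) := by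
  have : HasExt.{u + 1} (YetterDrinfeld k A) := HasExt.standard _
  rw [cdGS, sSup_le_iff]
  refine ⟨fun h => ⟨fun i hi V => ?_⟩, ?_⟩
  · by_contra hV
    have i_le := Nat.cast_le.1 (h i ⟨i, V, rfl, not_subsingleton_iff_nontrivial.1 hV⟩)
    omega
  · rintro h _ ⟨i, V, rfl, hV⟩
    refine Nat.cast_le.2 (not_lt.1 fun hi => not_subsingleton_iff_nontrivial.2 hV ?_)
    exact HasProjectiveDimensionLT.subsingleton (trivial k A) (n + 1) i (by omega) V

end Dimension

end YetterDrinfeld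

theorem le_of_forall_le_natCast_succ {a b : ℕ∞} (hb : 1 ≤ b)
    (h : ∀ n : ℕ, b ≤ (n + 1 : ℕ) → a ≤ (n + 1 : ℕ)) : a ≤ b := by
  induction b with
  | top => exact le_top
  | coe m =>
    obtain ⟨n, rfl⟩ := Nat.exists_eq_add_of_le' (Nat.one_le_cast.1 hb)
    exact h n le_rfl

section HopfFreeProduct

open LinearAlgebra.FreeProduct

variable (k A B : Type u) [Field k] [Ring A] [HopfAlgebra k A] [Ring B] [HopfAlgebra k B]

/-- The inclusion of a factor into the free product, as a morphism of bialgebras. -/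
def factorHom (i : Bool) : FactorPair A B i →ₐc[k] HopfFreeProduct k A B :=
  BialgHom.ofAlgHom (ι k (FactorPair A B) i)
    (AlgHom.ext fun a => counitHom_ι k (FactorPair A B) i a)
    (AlgHom.ext fun a => (comulHom_ι k (FactorPair A B) i a).symm)

/-- The inclusion of the first factor into the free product. -/
def freeProdInl : A →ₐc[k] HopfFreeProduct k A B := factorHom k A B false

/-- The inclusion of the second factor into the free product. -/
def freeProdInr : B →ₐc[k] HopfFreeProduct k A B := factorHom k A B true

theorem isFreeProd_hopfFreeProduct : IsFreeProd
    (freeProdInl k A B : A →ₐ[k] HopfFreeProduct k A B)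
    (freeProdInr k A B : B →ₐ[k] HopfFreeProduct k A B) where
  exists_lift {R} _ _ f g := by
    let F : ∀ i, FactorPair A B i →ₐ[k] R
      | false => f
      | true => g
    exact ⟨lift k (FactorPair A B) (fun {i} => F i), lift_ι_apply F false, lift_ι_apply F true⟩
  mem_of_range_le S hA hB := mem_of_factors S fun
    | false => fun a => hA ⟨a, rfl⟩
    | true => fun b => hB ⟨b, rfl⟩

end HopfFreeProduct

section Main

variable {k A B : Type u} [Field k] [Ring A] [HopfAlgebra k A] [Ring B] [HopfAlgebra k B]

theorem one_le_cdGS_hopfFreeProduct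
    (hA : ¬ Function.Surjective (algebraMap k A)) (hB : ¬ Function.Surjective (algebraMap k B)) :
    1 ≤ cdGS k (HopfFreeProduct k A B) := by
  refine Order.one_le_iff_ne_zero.2 fun cd_eq_zero => ?_
  refine YetterDrinfeld.not_projective_trivial (isFreeProd_hopfFreeProduct k A B) hA hB ?_
  exact projective_iff_hasProjectiveDimensionLT_one.2
    ((YetterDrinfeld.cdGS_le_iff 0).1 cd_eq_zero.le)

theorem cdGS_hopfFreeProduct_le_succ_iff (hA : IsCosemisimple k A) (hB : IsCosemisimple k B)
    (n : ℕ) : cdGS k (HopfFreeProduct k A B) ≤ (n + 1 : ℕ) ↔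
      max (cdGS k A) (cdGS k B) ≤ (n + 1 : ℕ) := by
  obtain ⟨_, hhA⟩ := exists_isHaar hA
  obtain ⟨_, hhB⟩ := exists_isHaar hB
  rw [max_le_iff, YetterDrinfeld.cdGS_le_iff, YetterDrinfeld.cdGS_le_iff,
    YetterDrinfeld.cdGS_le_iff]
  exact YetterDrinfeld.hasProjectiveDimensionLT_trivial_iff (isFreeProd_hopfFreeProduct k A B)
    hhA hhB n

theorem corollary5_general (hA : IsCosemisimple k A) (hB : IsCosemisimple k B)
    (hA_nontrivial : ¬ Function.Surjective (algebraMap k A))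
    (hB_nontrivial : ¬ Function.Surjective (algebraMap k B)) :
    (cdGS k A = 0 ∧ cdGS k B = 0 → cdGS k (HopfFreeProduct k A B) = 1) ∧
    (1 ≤ max (cdGS k A) (cdGS k B) →
      cdGS k (HopfFreeProduct k A B) = max (cdGS k A) (cdGS k B)) := by
  have one_le := one_le_cdGS_hopfFreeProduct hA_nontrivial hB_nontrivial
  have le_iff := cdGS_hopfFreeProduct_le_succ_iff hA hB
  refine ⟨fun ⟨cd_A, cd_B⟩ => le_antisymm ?_ one_le, fun h => le_antisymm ?_ ?_⟩
  · refine (le_iff 0).2 ?_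
    rw [cd_A, cd_B, max_self]
    exact bot_le
  · exact le_of_forall_le_natCast_succ h fun n => (le_iff n).2
  · exact le_of_forall_le_natCast_succ one_le fun n => (le_iff n).1

end Main

end

theorem corollary5 (k A B : Type u) [Field k] [IsAlgClosed k] [CharZero k]
    [Ring A] [HopfAlgebra k A] [Ring B] [HopfAlgebra k B]
    (hA : IsCosemisimple k A) (hB : IsCosemisimple k B)
    (hA_nontrivial : ¬ Function.Surjective (algebraMap k A))
    (hB_nontrivial : ¬ Function.Surjective (algebraMap k B)) :
    (cdGS k A = 0 ∧ cdGS k B = 0 → cdGS k (HopfFreeProduct k A B) = 1) ∧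
    (1 ≤ max (cdGS k A) (cdGS k B) →
      cdGS k (HopfFreeProduct k A B) = max (cdGS k A) (cdGS k B)) :=
  corollary5_general hA hB hA_nontrivial hB_nontrivial
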